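/- Let $p$ be an odd prime, $\mathcal K$ a field of characteristic $p$, $q\in\mathcal K$, and $n\ge 2$. Let $\mathcal O(2n+1;\underline 1)$ be the restricted divided power algebra over $\mathcal K$ in the variables $x_i$, $-n\le i\le n$, with basis $x^{(\alpha)}$, $0\le\alpha\le\tau=(p-1,\dots,p-1)$ (equivalently $\mathcal K[x_{-n},\dots,x_n]/(x_i^p)$ with $x^{(\alpha)}=\prod_i x_i^{\alpha_i}/\alpha_i!$), let $D_i$ be its partial derivatives and $\mathbf W(2n+1;\underline 1)=\mathrm{Der}\,\mathcal O(2n+1;\underline 1)$. Let $\epsilon_i$ be the $i$-th unit multi-index and put $$\mathcal D_K(f)=(2f-Ef)D_0+(D_0f)E+\sum_{i=1}^n\big((D_{-i}f)D_i-(D_if)D_{-i}\big),\qquad E=\sum_{i=1}^n(x_iD_i+x_{-i}D_{-i}).$$ The image $\mathbf K'(2n+1;\underline 1)$ of $\mathcal D_K$ is a Lie subalgebra of $\mathbf W(2n+1;\underline 1)$; its derived algebra $\mathbf K=\mathbf K(2n+1;\underline 1)$ is the contact algebra. Call $\alpha$ admissible if $0\le\alpha\le\tau$, and moreover $\alpha\ne\tau$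 in case $2n+4\equiv0\pmod p$; then $\mathcal D_K(x^{(\alpha)})\in\mathbf K$. Let $\mathbf u(\mathbf K)=U(\mathbf K)/I$, where $I$ is the ideal generated by $\mathcal D_K(x^{(\alpha)})^p-\mathcal D_K(x^{(\alpha)})$ for $\alpha=\epsilon_0$ and $\alpha=\epsilon_i+\epsilon_{-i}$ $(1\le i\le n)$ and by $\mathcal D_K(x^{(\alpha)})^p$ for all other admissible $\alpha$. Let $\mathcal K[t]_p^{(q)}=\mathcal K[t]/(t^p-qt)$ and $\mathbf u_{t,q}(\mathbf K)=\mathbf u(\mathbf K)\otimes_{\mathcal K}\mathcal K[t]_p^{(q)}$. For an element $x$ of a ring and an integer $a$ write $x_a^{\langle m\rangle}=(x+a)(x+a+1)\cdots(x+a+m-1)$, $x^{\langle m\rangle}=x_0^{\langle m\rangle}$ and $x^{[m]}=x(x-1)\cdots(x-m+1)$. For $1\le k\le n$ put $h(k)=\mathcal D_K(x^{(\epsilon_k+\epsilon_{-k})})$, $e(k)=2\mathcal D_K(x^{(2\epsilon_k+\epsilon_{-k})})$, $d_k^{(m)}=\frac1{m!}(\mathrm{ad}\,e(k))^m$ for $0\le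 m<p$, and $$\mathcal F(k)=\sum_{r=0}^{p-1}\frac{(-1)^r}{r!}\,h(k)^{[r]}\otimes e(k)^rt^r .$$ **Theorem.** Let $1\le k\ne k'\le n$. All tensor products below are over $\mathcal K[t]_p^{(q)}$. The algebra $\mathbf u_{t,q}(\mathbf K)$ has a standard Hopf algebra structure $(\Delta_0,\varepsilon,S_0)$ over $\mathcal K[t]_p^{(q)}$ in which the elements $\mathcal D_K(x^{(\alpha)})$ ($\alpha$ admissible) are primitive; $\mathcal F(k)$ and $\mathcal F(k')$ are commuting Drinfel'd twists for it, and so is $\mathcal F=\mathcal F(k)\mathcal F(k')$. The elements $1-e(k)t$ and $1-e(k')t$ are invertible, and with the product undeformed, $\Delta=\mathcal F\Delta_0\mathcal F^{-1}$ is the coproduct of a noncommutative and noncocommutative Hopf algebra $(\mathbf u_{t,q}(\mathbf K),m,\iota,\Delta,S,\varepsilon)$ over $\mathcal K[t]_p^{(q)}$ such that, for all admissible $\alpha$, $$\begin{aligned}\Delta(\mathcal D_K(x^{(\alpha)}))={}&\mathcal D_K(x^{(\alpha)})\otimes(1-e(k)t)^{\alpha_k-\alpha_{-k}}(1-e(k')t)^{\alpha_{k'}-\alpha_{-k'}}\\&+\sum_{m,\ell=0}^{p-1}(-1)^{\ell+m}h(k')^{\langle\ell\rangle}h(k)^{\langle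 m\rangle}\otimes(1-e(k')t)^{-\ell}(1-e(k)t)^{-m}\,d_k^{(m)}d_{k'}^{(\ell)}(\mathcal D_K(x^{(\alpha)}))\,t^{m+\ell},\\ S(\mathcal D_K(x^{(\alpha)}))={}&-(1-e(k')t)^{\alpha_{-k'}-\alpha_{k'}}(1-e(k)t)^{\alpha_{-k}-\alpha_k}\sum_{m,\ell=0}^{p-1}d_k^{(m)}d_{k'}^{(\ell)}(\mathcal D_K(x^{(\alpha)}))\,h(k)_1^{\langle m\rangle}h(k')_1^{\langle\ell\rangle}\,t^{m+\ell},\\ \varepsilon(\mathcal D_K(x^{(\alpha)}))={}&0.\end{aligned}$$ Moreover $\dim_{\mathcal K}\mathbf u_{t,q}(\mathbf K)=p^{p^{2n+1}+1}$ if $2n+4\not\equiv0\pmod p$, and $\dim_{\mathcal K}\mathbf u_{t,q}(\mathbf K)=p^{p^{2n+1}}$ if $2n+4\equiv0\pmod p$. -/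

import Mathlib

open scoped TensorProduct
noncomputable section
namespace ContactHopf

/-- The index set `{-n, …, n}` of the `2n+1` variables: `zero` is `0`, `pos i` and `neg i` (`i : Fin n`) are
`i+1` and `-(i+1)`. -/
abbrev Idx (n : ℕ) : Type := Unit ⊕ (Fin n ⊕ Fin n)
abbrev Idx.zero {n : ℕ} : Idx n := Sum.inl ()
abbrev Idx.pos {n : ℕ} (i : Fin n) : Idx n := Sum.inr (Sum.inl i)
abbrev Idx.neg {n : ℕ} (i : Fin n) : Idx n := Sum.inr (Sum.inr i)

section
variable (𝒦 : Type*) [Field 𝒦] (p n : ℕ)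

/-- The ideal generated by the `p`-th powers of the variables. -/
def truncIdeal : Ideal (MvPolynomial (Idx n) 𝒦) :=
  Ideal.span (Set.range fun i : Idx n => (MvPolynomial.X i : MvPolynomial (Idx n) 𝒦) ^ p)

/-- The algebra `O(2n+1; 1)`. In characteristic `p` the restricted divided power algebra, with basis `x^(α)`,
`0 ≤ α ≤ τ = (p-1, …, p-1)`, is the truncated polynomial algebra, with `x^(α) = ∏ xᵢ^αᵢ / αᵢ!`
(see `divPow`). -/
def TruncPoly : Type _ := MvPolynomial (Idx n) 𝒦 ⧸ truncIdeal 𝒦 p n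

instance : CommRing (TruncPoly 𝒦 p n) :=
  inferInstanceAs (CommRing (MvPolynomial (Idx n) 𝒦 ⧸ truncIdeal 𝒦 p n))

instance : Algebra 𝒦 (TruncPoly 𝒦 p n) :=
  inferInstanceAs (Algebra 𝒦 (MvPolynomial (Idx n) 𝒦 ⧸ truncIdeal 𝒦 p n))

/-- The quotient map from polynomials. -/
def TruncPoly.mk : MvPolynomial (Idx n) 𝒦 →ₐ[𝒦] TruncPoly 𝒦 p n :=
  Ideal.Quotient.mkₐ 𝒦 (truncIdeal 𝒦 p n)

theorem TruncPoly.mk_surjective : Function.Surjective (TruncPoly.mk 𝒦 p n) :=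
  Ideal.Quotient.mkₐ_surjective 𝒦 (truncIdeal 𝒦 p n)

theorem TruncPoly.mk_eq_zero (f : MvPolynomial (Idx n) 𝒦) :
    TruncPoly.mk 𝒦 p n f = 0 ↔ f ∈ truncIdeal 𝒦 p n :=
  Ideal.Quotient.eq_zero_iff_mem

/-- The variable `xᵢ = x^(εᵢ)`. -/
def xvar (i : Idx n) : TruncPoly 𝒦 p n := TruncPoly.mk 𝒦 p n (MvPolynomial.X i)

/-- The Jacobson-Witt algebra `W(2n+1; 1)`: all derivations of `O(2n+1; 1)`, with the commutator bracket. -/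
abbrev Witt : Type _ := Derivation 𝒦 (TruncPoly 𝒦 p n) (TruncPoly 𝒦 p n)

theorem witt_ext {D D' : Witt 𝒦 p n} (h : ∀ i, D (xvar 𝒦 p n i) = D' (xvar 𝒦 p n i)) : D = D' := by
  ext f
  obtain ⟨f, rfl⟩ := TruncPoly.mk_surjective 𝒦 p n f
  induction f using MvPolynomial.induction_on with
  | C a =>
    have : TruncPoly.mk 𝒦 p n (MvPolynomial.C a) = algebraMap 𝒦 _ a :=
      (TruncPoly.mk 𝒦 p n).commutes a
    rw [this]; simp
  | add f g hf hg => simp only [map_add, hf, hg]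
  | mul_X f i hf =>
    rw [map_mul, Derivation.leibniz, Derivation.leibniz, hf]
    congr 2
    exact h i

variable [CharP 𝒦 p]

theorem pderiv_mem_truncIdeal (i : Idx n) (f : MvPolynomial (Idx n) 𝒦)
    (hf : TruncPoly.mk 𝒦 p n f = 0) :
    TruncPoly.mk 𝒦 p n (MvPolynomial.pderiv i f) = 0 := by
  rw [TruncPoly.mk_eq_zero] at hf ⊢
  unfold truncIdeal at hf
  induction hf using Submodule.span_induction with
  | mem x h =>
    obtain ⟨j, rfl⟩ := h
    simp [Derivation.leibniz_pow, ← Nat.cast_smul_eq_nsmul (MvPolynomial (Idx n) 𝒦)]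
  | zero => simp
  | add x y _ _ hx hy => rw [map_add]; exact Ideal.add_mem _ hx hy
  | smul a x hx ih =>
    rw [smul_eq_mul, Derivation.leibniz, smul_eq_mul, smul_eq_mul]
    exact Ideal.add_mem _ (Ideal.mul_mem_left _ _ ih) (Ideal.mul_mem_right _ _ hx)

/-- The partial derivative `Dᵢ`; it sends `x^(α)` to `x^(α - εᵢ)`. -/
def pd (i : Idx n) : Witt 𝒦 p n :=
  Derivation.liftOfSurjective (f := TruncPoly.mk 𝒦 p n) (TruncPoly.mk_surjective 𝒦 p n)
    (d := MvPolynomial.pderiv i) (pderiv_mem_truncIdeal 𝒦 p n i)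

theorem pd_xvar (i j : Idx n) :
    pd 𝒦 p n i (xvar 𝒦 p n j) = if j = i then 1 else 0 := by
  have := Derivation.liftOfSurjective_apply (TruncPoly.mk_surjective 𝒦 p n)
    (pderiv_mem_truncIdeal 𝒦 p n i) (MvPolynomial.X j)
  refine this.trans ?_
  rw [MvPolynomial.pderiv_X]
  by_cases h : j = i
  · subst h; simp
  · simp [h]

theorem pd_comm (i j : Idx n) (f : TruncPoly 𝒦 p n) :
    pd 𝒦 p n i (pd 𝒦 p n j f) = pd 𝒦 p n j (pd 𝒦 p n i f) := by
  have h : ⁅pd 𝒦 p n i, pd 𝒦 p n j⁆ = 0 := by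
    apply witt_ext 𝒦 p n
    intro k
    rw [Derivation.commutator_apply, pd_xvar, pd_xvar]
    have h0 : ∀ (a b c : Idx n), pd 𝒦 p n a (if c = b then 1 else 0) = 0 := by
      intro a b c
      split_ifs <;> simp
    simp [h0]
  have := congrArg (fun D : Witt 𝒦 p n => D f) h
  simpa [Derivation.commutator_apply, sub_eq_zero] using this

/-- Euler field in the variables `x_{±i}`, `1 ≤ i ≤ n`. -/
def euler : Witt 𝒦 p n :=
  ∑ i : Fin n, (xvar 𝒦 p n (.pos i) • pd 𝒦 p n (.pos i) + xvar 𝒦 p n (.neg i) • pd 𝒦 p n (.neg i))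

/-- The map `D_K : O(2n+1; 1) → W(2n+1; 1)`,
`D_K f = (2f - E f) D₀ + D₀ f · E + ∑ᵢ (D₋ᵢ f · Dᵢ - Dᵢ f · D₋ᵢ)` with `E = ∑ᵢ (xᵢ Dᵢ + x₋ᵢ D₋ᵢ)`.
Here `E x^(α) = ∑ᵢ (αᵢ + α₋ᵢ) x^(α)`. -/
def contactD : TruncPoly 𝒦 p n →ₗ[𝒦] Witt 𝒦 p n where
  toFun f :=
    (2 * f - euler 𝒦 p n f) • pd 𝒦 p n .zero + pd 𝒦 p n .zero f • euler 𝒦 p n +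
      ∑ i : Fin n, (pd 𝒦 p n (.neg i) f • pd 𝒦 p n (.pos i) -
        pd 𝒦 p n (.pos i) f • pd 𝒦 p n (.neg i))
  map_add' f g := by
    simp only [map_add]
    have h : ∀ i : Fin n, (pd 𝒦 p n (.neg i) f + pd 𝒦 p n (.neg i) g) • pd 𝒦 p n (.pos i) -
        (pd 𝒦 p n (.pos i) f + pd 𝒦 p n (.pos i) g) • pd 𝒦 p n (.neg i) =
        (pd 𝒦 p n (.neg i) f • pd 𝒦 p n (.pos i) - pd 𝒦 p n (.pos i) f • pd 𝒦 p n (.neg i)) +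
        (pd 𝒦 p n (.neg i) g • pd 𝒦 p n (.pos i) - pd 𝒦 p n (.pos i) g • pd 𝒦 p n (.neg i)) :=
      fun i => by module
    rw [Finset.sum_congr rfl fun i _ => h i, Finset.sum_add_distrib]
    module
  map_smul' c f := by
    simp only [Derivation.map_smul, RingHom.id_apply]
    have h : ∀ i : Fin n, (c • pd 𝒦 p n (.neg i) f) • pd 𝒦 p n (.pos i) -
        (c • pd 𝒦 p n (.pos i) f) • pd 𝒦 p n (.neg i) =
        c • (pd 𝒦 p n (.neg i) f • pd 𝒦 p n (.pos i) -
          pd 𝒦 p n (.pos i) f • pd 𝒦 p n (.neg i)) := fun i => by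
      rw [smul_sub, smul_assoc, smul_assoc]
    rw [Finset.sum_congr rfl fun i _ => h i, ← Finset.smul_sum, smul_add, smul_add,
      mul_smul_comm, ← smul_sub, smul_assoc, smul_assoc]

/-- The part `∑ᵢ (D₋ᵢ f · Dᵢ g - Dᵢ f · D₋ᵢ g)` of `D_K f g`. -/
def pois (f g : TruncPoly 𝒦 p n) : TruncPoly 𝒦 p n :=
  ∑ i : Fin n, (pd 𝒦 p n (.neg i) f * pd 𝒦 p n (.pos i) g -
        pd 𝒦 p n (.pos i) f * pd 𝒦 p n (.neg i) g)

theorem contactD_apply (f g : TruncPoly 𝒦 p n) : contactD 𝒦 p n f g =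
    (2 * f - euler 𝒦 p n f) * pd 𝒦 p n .zero g + pd 𝒦 p n .zero f * euler 𝒦 p n g + pois 𝒦 p n f g := by
  have h : ∀ (s : Finset (Fin n)) (F : Fin n → Witt 𝒦 p n), (∑ i ∈ s, F i) g = ∑ i ∈ s, F i g := by
    intro s F
    exact map_sum (⟨⟨fun D => D g, rfl⟩, fun _ _ => rfl⟩ : Witt 𝒦 p n →+ TruncPoly 𝒦 p n) F s
  simp only [contactD, LinearMap.coe_mk, AddHom.coe_mk, Derivation.add_apply, h, pois,
    Derivation.smul_apply, Derivation.sub_apply, smul_eq_mul]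

theorem euler_apply (g : TruncPoly 𝒦 p n) : euler 𝒦 p n g =
    ∑ i : Fin n, (xvar 𝒦 p n (.pos i) * pd 𝒦 p n (.pos i) g + xvar 𝒦 p n (.neg i) * pd 𝒦 p n (.neg i) g) := by
  have h : ∀ (s : Finset (Fin n)) (F : Fin n → Witt 𝒦 p n), (∑ i ∈ s, F i) g = ∑ i ∈ s, F i g := by
    intro s F
    exact map_sum (⟨⟨fun D => D g, rfl⟩, fun _ _ => rfl⟩ : Witt 𝒦 p n →+ TruncPoly 𝒦 p n) F s
  simp only [euler, h, Derivation.add_apply, Derivation.smul_apply, smul_eq_mul]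

theorem pois_anti (f g : TruncPoly 𝒦 p n) : pois 𝒦 p n f g = - pois 𝒦 p n g f := by
  unfold pois
  rw [← Finset.sum_neg_distrib]
  exact Finset.sum_congr rfl fun i _ => by ring

theorem pd_pois (j : Idx n) (f g : TruncPoly 𝒦 p n) : pd 𝒦 p n j (pois 𝒦 p n f g) =
    pois 𝒦 p n (pd 𝒦 p n j f) g + pois 𝒦 p n f (pd 𝒦 p n j g) := by
  unfold pois
  rw [map_sum, ← Finset.sum_add_distrib]
  refine Finset.sum_congr rfl fun i _ => ?_
  simp only [map_sub, Derivation.leibniz, smul_eq_mul]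
  rw [pd_comm 𝒦 p n j (.neg i) f, pd_comm 𝒦 p n j (.neg i) g, pd_comm 𝒦 p n j (.pos i) f,
    pd_comm 𝒦 p n j (.pos i) g]
  ring

theorem pd_euler_zero (f : TruncPoly 𝒦 p n) : pd 𝒦 p n .zero (euler 𝒦 p n f) =
    euler 𝒦 p n (pd 𝒦 p n .zero f) := by
  rw [euler_apply, euler_apply, map_sum]
  refine Finset.sum_congr rfl fun i _ => ?_
  simp only [map_add, Derivation.leibniz, smul_eq_mul, pd_xvar]
  rw [pd_comm 𝒦 p n .zero (.neg i) f, pd_comm 𝒦 p n .zero (.pos i) f]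
  simp

theorem pd_euler_inr (j : Fin n ⊕ Fin n) (f : TruncPoly 𝒦 p n) : pd 𝒦 p n (.inr j) (euler 𝒦 p n f) =
    euler 𝒦 p n (pd 𝒦 p n (.inr j) f) + pd 𝒦 p n (.inr j) f := by
  have h : ∀ i : Fin n, pd 𝒦 p n (.inr j) (xvar 𝒦 p n (.pos i) * pd 𝒦 p n (.pos i) f +
      xvar 𝒦 p n (.neg i) * pd 𝒦 p n (.neg i) f) =
      (xvar 𝒦 p n (.pos i) * pd 𝒦 p n (.pos i) (pd 𝒦 p n (.inr j) f) +
      xvar 𝒦 p n (.neg i) * pd 𝒦 p n (.neg i) (pd 𝒦 p n (.inr j) f)) +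
      ((if Idx.pos i = (.inr j : Idx n) then 1 else 0) * pd 𝒦 p n (.pos i) f +
       (if Idx.neg i = (.inr j : Idx n) then 1 else 0) * pd 𝒦 p n (.neg i) f) := by
    intro i
    simp only [map_add, Derivation.leibniz, smul_eq_mul, pd_xvar]
    rw [pd_comm 𝒦 p n (.inr j) (.neg i) f, pd_comm 𝒦 p n (.inr j) (.pos i) f]
    ring
  rw [euler_apply, euler_apply, map_sum, Finset.sum_congr rfl fun i _ => h i, Finset.sum_add_distrib]
  congr 1
  rcases j with j | j <;> simp

theorem euler_pois (f g : TruncPoly 𝒦 p n) : euler 𝒦 p n (pois 𝒦 p n f g) =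
    pois 𝒦 p n (euler 𝒦 p n f) g + pois 𝒦 p n f (euler 𝒦 p n g) - 2 * pois 𝒦 p n f g := by
  unfold pois
  rw [map_sum, ← Finset.sum_add_distrib, Finset.mul_sum, ← Finset.sum_sub_distrib]
  refine Finset.sum_congr rfl fun i _ => ?_
  simp only [map_sub, Derivation.leibniz, smul_eq_mul, Idx.pos, Idx.neg, pd_euler_inr]
  ring

theorem contactD_skew (f g : TruncPoly 𝒦 p n) :
    contactD 𝒦 p n f g - 2 * pd 𝒦 p n .zero f * g = -(contactD 𝒦 p n g f - 2 * pd 𝒦 p n .zero g * f) := by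
  rw [contactD_apply, contactD_apply, pois_anti]; ring

theorem contactD_xzero (f : TruncPoly 𝒦 p n) :
    contactD 𝒦 p n f (xvar 𝒦 p n .zero) = 2 * f - euler 𝒦 p n f := by
  simp [contactD_apply, pois, euler_apply, pd_xvar]

theorem contactD_xpos (f : TruncPoly 𝒦 p n) (i : Fin n) :
    contactD 𝒦 p n f (xvar 𝒦 p n (.pos i)) =
      pd 𝒦 p n .zero f * xvar 𝒦 p n (.pos i) + pd 𝒦 p n (.neg i) f := by
  simp [contactD_apply, pois, euler_apply, pd_xvar]

theorem contactD_xneg (f : TruncPoly 𝒦 p n) (i : Fin n) :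
    contactD 𝒦 p n f (xvar 𝒦 p n (.neg i)) =
      pd 𝒦 p n .zero f * xvar 𝒦 p n (.neg i) - pd 𝒦 p n (.pos i) f := by
  simp [contactD_apply, pois, euler_apply, pd_xvar, sub_eq_add_neg]

/-- The image of `D_K` is closed under the bracket. -/
theorem contactD_lie (f g : TruncPoly 𝒦 p n) :
    ⁅contactD 𝒦 p n f, contactD 𝒦 p n g⁆ =
      contactD 𝒦 p n (contactD 𝒦 p n f g - 2 * pd 𝒦 p n .zero f * g) := by
  have h2 : ∀ D : Witt 𝒦 p n, D 2 = 0 := fun D => by simpa using D.map_natCast 2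
  apply witt_ext 𝒦 p n
  intro k
  rw [Derivation.commutator_apply]
  rcases k with k | k | k
  · change contactD 𝒦 p n f (contactD 𝒦 p n g (xvar 𝒦 p n .zero)) -
      contactD 𝒦 p n g (contactD 𝒦 p n f (xvar 𝒦 p n .zero)) =
      contactD 𝒦 p n _ (xvar 𝒦 p n .zero)
    rw [contactD_xzero, contactD_xzero, contactD_xzero]
    simp only [contactD_apply, map_add, map_sub, Derivation.leibniz, smul_eq_mul, h2, euler_pois,
      pd_euler_zero]
    rw [pois_anti 𝒦 p n (euler 𝒦 p n f) g, pois_anti 𝒦 p n g f]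
    ring
  · change contactD 𝒦 p n f (contactD 𝒦 p n g (xvar 𝒦 p n (.pos k))) -
      contactD 𝒦 p n g (contactD 𝒦 p n f (xvar 𝒦 p n (.pos k))) =
      contactD 𝒦 p n _ (xvar 𝒦 p n (.pos k))
    have hx : euler 𝒦 p n (xvar 𝒦 p n (.pos k)) = xvar 𝒦 p n (.pos k) := by
      simp [euler_apply, pd_xvar]
    have hp : ∀ g, pois 𝒦 p n g (xvar 𝒦 p n (.pos k)) = pd 𝒦 p n (.neg k) g := fun g => by
      simp [pois, pd_xvar]
    rw [contactD_xpos, contactD_xpos, contactD_xpos]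
    simp only [contactD_apply, map_add, map_sub, Derivation.leibniz, smul_eq_mul, h2, pd_pois,
      pd_euler_zero, Idx.neg, pd_euler_inr, hx, hp]
    rw [pois_anti 𝒦 p n g, pois_anti 𝒦 p n g, pd_comm 𝒦 p n .zero (.inr (.inr k)) f,
      pd_comm 𝒦 p n .zero (.inr (.inr k)) g]
    simp only [pd_xvar]
    simp
    ring
  · change contactD 𝒦 p n f (contactD 𝒦 p n g (xvar 𝒦 p n (.neg k))) -
      contactD 𝒦 p n g (contactD 𝒦 p n f (xvar 𝒦 p n (.neg k))) =
      contactD 𝒦 p n _ (xvar 𝒦 p n (.neg k))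
    have hx : euler 𝒦 p n (xvar 𝒦 p n (.neg k)) = xvar 𝒦 p n (.neg k) := by
      simp [euler_apply, pd_xvar]
    have hp : ∀ g, pois 𝒦 p n g (xvar 𝒦 p n (.neg k)) = - pd 𝒦 p n (.pos k) g := fun g => by
      simp [pois, pd_xvar]
    rw [contactD_xneg, contactD_xneg, contactD_xneg]
    simp only [contactD_apply, map_add, map_sub, Derivation.leibniz, smul_eq_mul, h2, pd_pois,
      pd_euler_zero, Idx.pos, pd_euler_inr, hx, hp]
    rw [pois_anti 𝒦 p n g, pois_anti 𝒦 p n g, pd_comm 𝒦 p n .zero (.inr (.inl k)) f,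
      pd_comm 𝒦 p n .zero (.inr (.inl k)) g]
    simp only [pd_xvar]
    simp
    ring

/-- `K'(2n+1; 1) = D_K(O(2n+1; 1))`. -/
def contactPrime : LieSubalgebra 𝒦 (Witt 𝒦 p n) :=
  { LinearMap.range (contactD 𝒦 p n) with
    lie_mem' := by
      rintro _ _ ⟨f, rfl⟩ ⟨g, rfl⟩
      exact ⟨_, (contactD_lie 𝒦 p n f g).symm⟩ }

/-- The contact algebra `K(2n+1; 1)`, the derived algebra of `K'(2n+1; 1)`. -/
def contactIdeal : LieIdeal 𝒦 (contactPrime 𝒦 p n) :=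
  LieAlgebra.derivedSeries 𝒦 (contactPrime 𝒦 p n) 1

/-- The contact algebra `K(2n+1; 1)` as a Lie algebra. -/
abbrev ContactAlg : Type _ := contactIdeal 𝒦 p n

/-- The divided power monomial `x^(α) = ∏ᵢ xᵢ^αᵢ / αᵢ!`, for `0 ≤ α ≤ τ`. -/
def divPow (α : Idx n → ℕ) : TruncPoly 𝒦 p n :=
  ∏ i, ((Nat.factorial (α i) : 𝒦)⁻¹ • xvar 𝒦 p n i ^ α i)

/-- `D_K(x^(α))` as an element of `K'(2n+1; 1)`. -/
def contactElt (α : Idx n → ℕ) : contactPrime 𝒦 p n :=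
  ⟨contactD 𝒦 p n (divPow 𝒦 p n α), divPow 𝒦 p n α, rfl⟩

/-- The multi-indices of the basis of `K(2n+1; 1)`: `0 ≤ α ≤ τ`, and `α ≠ τ` when `2n + 4 ≡ 0 mod p`. -/
def Admissible (α : Idx n → ℕ) : Prop :=
  (∀ i, α i ≤ p - 1) ∧ (p ∣ 2 * n + 4 → α ≠ fun _ => p - 1)

theorem pd_divPow (α : Idx n → ℕ) (j : Idx n) (hα : ((α j + 1 : ℕ) : 𝒦) ≠ 0) :
    pd 𝒦 p n j (divPow 𝒦 p n (α + Pi.single j 1)) = divPow 𝒦 p n α := by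
  have h0 : ∀ (s : Finset (Idx n)) (β : Idx n → ℕ), j ∉ s →
      pd 𝒦 p n j (∏ i ∈ s, ((Nat.factorial (β i) : 𝒦)⁻¹ • xvar 𝒦 p n i ^ β i)) = 0 := by
    intro s β
    induction s using Finset.induction_on with
    | empty => simp
    | insert a s ha ih =>
      intro hj
      rw [Finset.mem_insert, not_or] at hj
      rw [Finset.prod_insert ha, Derivation.leibniz, ih hj.2, Derivation.map_smul,
        Derivation.leibniz_pow, pd_xvar, if_neg (Ne.symm hj.1)]
      simp
  unfold divPow
  rw [← Finset.mul_prod_erase Finset.univ _ (Finset.mem_univ j), Derivation.leibniz,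
    h0 _ _ (Finset.notMem_erase j _), ← Finset.mul_prod_erase Finset.univ _ (Finset.mem_univ j),
    Derivation.map_smul, Derivation.leibniz_pow, pd_xvar]
  have h1 : ∏ x ∈ Finset.univ.erase j, ((Nat.factorial ((α + Pi.single j 1 : Idx n → ℕ) x) : 𝒦)⁻¹ •
        xvar 𝒦 p n x ^ (α + Pi.single j 1 : Idx n → ℕ) x) =
      ∏ x ∈ Finset.univ.erase j, ((Nat.factorial (α x) : 𝒦)⁻¹ • xvar 𝒦 p n x ^ α x) := by
    refine Finset.prod_congr rfl fun x hx => ?_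
    rw [Pi.add_apply, Pi.single_eq_of_ne (Finset.ne_of_mem_erase hx), add_zero]
  rw [h1, Pi.add_apply, Pi.single_eq_same, if_pos rfl]
  simp only [smul_eq_mul, Nat.add_sub_cancel, mul_one, Nat.factorial_succ, mul_zero, zero_add]
  rw [mul_comm]
  congr 1
  rw [← Nat.cast_smul_eq_nsmul 𝒦, smul_smul, Nat.cast_mul]
  congr 1
  field_simp

theorem xvar_mul_pd_divPow (α : Idx n → ℕ) (j : Idx n) :
    xvar 𝒦 p n j * pd 𝒦 p n j (divPow 𝒦 p n α) = (α j : 𝒦) • divPow 𝒦 p n α := by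
  have h0 : ∀ (s : Finset (Idx n)),
      xvar 𝒦 p n j * pd 𝒦 p n j (∏ i ∈ s, ((Nat.factorial (α i) : 𝒦)⁻¹ • xvar 𝒦 p n i ^ α i)) =
      (if j ∈ s then (α j : 𝒦) else 0) •
        ∏ i ∈ s, ((Nat.factorial (α i) : 𝒦)⁻¹ • xvar 𝒦 p n i ^ α i) := by
    intro s
    induction s using Finset.induction_on with
    | empty => simp
    | insert a s ha ih =>
      rw [Finset.prod_insert ha, Derivation.leibniz, Derivation.map_smul, Derivation.leibniz_pow,
        pd_xvar, mul_add, smul_eq_mul, mul_left_comm, ih]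
      by_cases hj : a = j
      · subst hj
        rw [if_neg ha, if_pos (Finset.mem_insert_self _ _), if_pos rfl]
        rcases Nat.eq_zero_or_pos (α a) with h | h
        · simp [h]
        · obtain ⟨m, hm⟩ : ∃ m, α a = m + 1 := ⟨α a - 1, by omega⟩
          rw [hm, Nat.add_sub_cancel, ← Nat.cast_smul_eq_nsmul 𝒦]
          simp only [smul_eq_mul, mul_one, zero_smul, mul_zero, zero_add, pow_succ,
            smul_mul_assoc, mul_smul_comm, smul_smul]
          congr 1
          · ring
          · ring
      · rw [if_neg hj]
        have : (j ∈ insert a s) = (j ∈ s) := by simp [Ne.symm hj]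
        simp only [this, smul_zero, add_zero, mul_smul_comm, mul_zero]
  have := h0 Finset.univ
  rwa [if_pos (Finset.mem_univ j)] at this

/-- For `p ≠ 2`, all `D_K(x^(α))` with `α` admissible lie in the derived algebra `K(2n+1; 1)`. -/
theorem contactD_mem (hp : p.Prime) (hp2 : p ≠ 2) (α : Idx n → ℕ) (hα : Admissible p n α) :
    contactElt 𝒦 p n α ∈ contactIdeal 𝒦 p n := by
  have := Fact.mk hp
  obtain ⟨hα, hτ⟩ := hα
  have hp' := hp.two_le
  have h2 : (2 : 𝒦) ≠ 0 := by
    intro h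
    have : ((2 : ℕ) : 𝒦) = 0 := by exact_mod_cast h
    rw [CharP.cast_eq_zero_iff 𝒦 p] at this
    exact hp2 ((Nat.prime_dvd_prime_iff_eq hp Nat.prime_two).1 this)
  have key : ∀ x y : contactPrime 𝒦 p n, ⁅x, y⁆ ∈ contactIdeal 𝒦 p n := fun x y =>
    LieSubmodule.lie_mem_lie (LieSubmodule.mem_top x) (LieSubmodule.mem_top y)
  -- all brackets of contact fields
  let S : Submodule 𝒦 (TruncPoly 𝒦 p n) :=
    ((contactIdeal 𝒦 p n).toSubmodule.map (contactPrime 𝒦 p n).toSubmodule.subtype).comap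
      (contactD 𝒦 p n)
  have hS : ∀ f, f ∈ S → (⟨contactD 𝒦 p n f, f, rfl⟩ : contactPrime 𝒦 p n) ∈
      contactIdeal 𝒦 p n := by
    rintro f ⟨x, hx, hxf⟩
    have : x = ⟨contactD 𝒦 p n f, f, rfl⟩ := Subtype.ext hxf
    rw [← this]
    exact hx
  have hB : ∀ f g, contactD 𝒦 p n f g - 2 * pd 𝒦 p n .zero f * g ∈ S := by
    intro f g
    refine ⟨_, key ⟨_, f, rfl⟩ ⟨_, g, rfl⟩, ?_⟩
    exact contactD_lie 𝒦 p n f g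
  apply hS
  have h0 : ∀ g, pd 𝒦 p n .zero g ∈ S := by
    intro g
    have h := hB 1 g
    simp only [contactD_apply, pois, Derivation.map_one_eq_zero] at h
    have h' := S.smul_mem (2 : 𝒦)⁻¹ h
    convert h' using 1
    have : (2 : TruncPoly 𝒦 p n) = algebraMap 𝒦 _ 2 := (map_ofNat (algebraMap 𝒦 _) 2).symm
    simp only [mul_one, sub_zero, zero_mul, add_zero, mul_zero, Finset.sum_const_zero]
    rw [this, ← Algebra.smul_def, smul_smul, inv_mul_cancel₀ h2, one_smul]
  have hne : ∀ m : ℕ, m < p - 1 → ((m + 1 : ℕ) : 𝒦) ≠ 0 := by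
    intro m hm h
    rw [CharP.cast_eq_zero_iff 𝒦 p] at h
    have := Nat.le_of_dvd (by omega) h
    omega
  have hpos : ∀ (i : Fin n) g, pd 𝒦 p n (.neg i) g ∈ S := by
    intro i g
    have h := hB (xvar 𝒦 p n (.pos i)) g
    have h1 := h0 (xvar 𝒦 p n (.pos i) * g)
    have := S.sub_mem h1 h
    convert this using 1
    have e1 : euler 𝒦 p n (xvar 𝒦 p n (.pos i)) = xvar 𝒦 p n (.pos i) := by
      simp [euler_apply, pd_xvar]
    have e2 : pois 𝒦 p n (xvar 𝒦 p n (.pos i)) g = - pd 𝒦 p n (.neg i) g := by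
      simp [pois, pd_xvar]
    rw [contactD_apply, e1, e2]
    simp [pd_xvar]
    ring
  have hneg : ∀ (i : Fin n) g, pd 𝒦 p n (.pos i) g ∈ S := by
    intro i g
    have h := hB (xvar 𝒦 p n (.neg i)) g
    have h1 := h0 (xvar 𝒦 p n (.neg i) * g)
    have := S.sub_mem h h1
    convert this using 1
    have e1 : euler 𝒦 p n (xvar 𝒦 p n (.neg i)) = xvar 𝒦 p n (.neg i) := by
      simp [euler_apply, pd_xvar]
    have e2 : pois 𝒦 p n (xvar 𝒦 p n (.neg i)) g = pd 𝒦 p n (.pos i) g := by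
      simp [pois, pd_xvar]
    rw [contactD_apply, e1, e2]
    simp [pd_xvar]
    ring
  by_cases hmax : ∃ j, α j < p - 1
  · obtain ⟨j, hj⟩ := hmax
    rw [← pd_divPow 𝒦 p n α j (hne _ hj)]
    rcases j with j | j | j
    · exact h0 _
    · exact hneg _ _
    · exact hpos _ _
  · push Not at hmax
    have hα' : ∀ j, α j = p - 1 := fun j => le_antisymm (hα j) (hmax j)
    have hn : ¬ p ∣ 2 * n + 4 := fun h => hτ h (funext hα')
    have h := hB (xvar 𝒦 p n .zero) (divPow 𝒦 p n α)
    have e1 : euler 𝒦 p n (xvar 𝒦 p n .zero) = 0 := by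
      simp [euler_apply, pd_xvar]
    have e2 : pois 𝒦 p n (xvar 𝒦 p n .zero) (divPow 𝒦 p n α) = 0 := by
      simp [pois, pd_xvar]
    have e3 : pd 𝒦 p n .zero (xvar 𝒦 p n .zero) = 1 := by simp [pd_xvar]
    have hc : ∀ j, (α j : 𝒦) = -1 := by
      intro j
      rw [hα' j, Nat.cast_sub (by omega), CharP.cast_eq_zero]; simp
    rw [contactD_apply, e1, e2, e3, euler_apply] at h
    simp only [xvar_mul_pd_divPow, hc, sub_zero, mul_assoc, add_zero, one_mul,
      Finset.sum_const, Finset.card_univ, Fintype.card_fin, mul_one] at h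
    have e4 : (2 : TruncPoly 𝒦 p n) * (-1 : 𝒦) • divPow 𝒦 p n α +
        n • ((-1 : 𝒦) • divPow 𝒦 p n α + (-1 : 𝒦) • divPow 𝒦 p n α) - 2 * divPow 𝒦 p n α =
        (-((2 * n + 4 : ℕ) : 𝒦)) • divPow 𝒦 p n α := by
      rw [two_mul, two_mul]
      push_cast
      module
    rw [e4] at h
    have hd : -((2 * n + 4 : ℕ) : 𝒦) ≠ 0 := by
      rw [neg_ne_zero, Ne, CharP.cast_eq_zero_iff 𝒦 p]
      exact hn
    have := S.smul_mem (-((2 * n + 4 : ℕ) : 𝒦))⁻¹ h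
    rwa [smul_smul, inv_mul_cancel₀ hd, one_smul] at this

open Classical in
/-- `D_K(x^(α))` as an element of `K(2n+1; 1)`. For admissible `α` (and `p ≠ 2`) it does lie there, see
`contactD_mem`; the value `0` in the other case is never used. -/
def contactGen (α : Idx n → ℕ) : ContactAlg 𝒦 p n :=
  if h : contactElt 𝒦 p n α ∈ contactIdeal 𝒦 p n then ⟨contactElt 𝒦 p n α, h⟩ else 0

theorem contactGen_coe (hp : p.Prime) (hp2 : p ≠ 2) (α : Idx n → ℕ) (hα : Admissible p n α) :
    ((contactGen 𝒦 p n α : contactPrime 𝒦 p n) : Witt 𝒦 p n) =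
      contactD 𝒦 p n (divPow 𝒦 p n α) := by
  rw [contactGen, dif_pos (contactD_mem 𝒦 p n hp hp2 α hα)]
  rfl

/-- The multi-index `εᵢ`. -/
def eps {n : ℕ} (i : Idx n) : Idx n → ℕ := Pi.single i 1

/-- The multi-index `ε_k + ε_{-k}`. -/
def idxH {n : ℕ} (k : Fin n) : Idx n → ℕ := eps (.pos k) + eps (.neg k)

/-- The multi-index `2ε_k + ε_{-k}`. -/
def idxE {n : ℕ} (k : Fin n) : Idx n → ℕ := 2 • eps (.pos k) + eps (.neg k)

/-- The generators of the ideal `I` of `U(K(2n+1; 1))`: `D_K(x^(α))^p - D_K(x^(α))` for `α = ε₀` and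
`α = ε_k + ε_{-k}`, and `D_K(x^(α))^p` for the other admissible `α`. -/
inductive RestrictedRel : UniversalEnvelopingAlgebra 𝒦 (ContactAlg 𝒦 p n) →
    UniversalEnvelopingAlgebra 𝒦 (ContactAlg 𝒦 p n) → Prop
  | zero : RestrictedRel
      (UniversalEnvelopingAlgebra.ι 𝒦 (contactGen 𝒦 p n (eps .zero)) ^ p)
      (UniversalEnvelopingAlgebra.ι 𝒦 (contactGen 𝒦 p n (eps .zero)))
  | toral (k : Fin n) : RestrictedRel
      (UniversalEnvelopingAlgebra.ι 𝒦 (contactGen 𝒦 p n (idxH k)) ^ p)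
      (UniversalEnvelopingAlgebra.ι 𝒦 (contactGen 𝒦 p n (idxH k)))
  | nil (α : Idx n → ℕ) (hα : Admissible p n α) (h0 : α ≠ eps .zero)
      (hk : ∀ k, α ≠ idxH k) : RestrictedRel
      (UniversalEnvelopingAlgebra.ι 𝒦 (contactGen 𝒦 p n α) ^ p) 0

/-- The restricted universal enveloping algebra `u(K(2n+1; 1)) = U(K(2n+1; 1)) / I`. -/
def RestrictedU : Type _ := RingQuot (RestrictedRel 𝒦 p n)

instance : Ring (RestrictedU 𝒦 p n) := inferInstanceAs (Ring (RingQuot (RestrictedRel 𝒦 p n)))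

instance : Algebra 𝒦 (RestrictedU 𝒦 p n) :=
  inferInstanceAs (Algebra 𝒦 (RingQuot (RestrictedRel 𝒦 p n)))

/-- The class of `D_K(x^(α))` in `u(K(2n+1; 1))`. -/
def genU (α : Idx n → ℕ) : RestrictedU 𝒦 p n :=
  RingQuot.mkAlgHom 𝒦 (RestrictedRel 𝒦 p n)
    (UniversalEnvelopingAlgebra.ι 𝒦 (contactGen 𝒦 p n α))

end

section
variable (𝒦 : Type*) [Field 𝒦] (p n : ℕ) (q : 𝒦)

/-- The ring `𝒦[t]_p^(q) = 𝒦[t] / (t^p - q t)`. -/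
abbrev TruncBase : Type _ :=
  AdjoinRoot ((Polynomial.X : Polynomial 𝒦) ^ p - Polynomial.C q * Polynomial.X)

/-- The class of `t` in `𝒦[t]_p^(q)`. -/
def tvar : TruncBase 𝒦 p q := AdjoinRoot.root _

variable [CharP 𝒦 p]

/-- `u_{t,q}(K(2n+1; 1)) = u(K(2n+1; 1)) ⊗ 𝒦[t]_p^(q)`, as an algebra over `𝒦[t]_p^(q)`. -/
abbrev UTQ : Type _ := TruncBase 𝒦 p q ⊗[𝒦] RestrictedU 𝒦 p n

/-- `D_K(x^(α))` in `u_{t,q}(K(2n+1; 1))`. -/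
def gen (α : Idx n → ℕ) : UTQ 𝒦 p n q := 1 ⊗ₜ[𝒦] genU 𝒦 p n α

variable {n} in
/-- `h(k) = D_K(x^(ε_k + ε_{-k}))`. -/
def hElt (k : Fin n) : UTQ 𝒦 p n q := gen 𝒦 p n q (idxH k)

variable {n} in
/-- `e(k) = 2 D_K(x^(2ε_k + ε_{-k}))`. -/
def eElt (k : Fin n) : UTQ 𝒦 p n q := 2 * gen 𝒦 p n q (idxE k)

end

/-- `x^⟨m⟩ = x (x + 1) ⋯ (x + m - 1)`; thus `x_a^⟨m⟩` is `rising (x + a) m`. -/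
def rising {A : Type*} [Ring A] (x : A) : ℕ → A
  | 0 => 1
  | m + 1 => rising x m * (x + m)

/-- `x^[m] = x (x - 1) ⋯ (x - m + 1)`. -/
def falling {A : Type*} [Ring A] (x : A) : ℕ → A
  | 0 => 1
  | m + 1 => falling x m * (x - m)

/-- `d^(m) = (ad e)^m / m!`, for `m < p`. -/
def divAd (𝒦 : Type*) {A : Type*} [Field 𝒦] [Ring A] [Algebra 𝒦 A] (e : A) (m : ℕ) (a : A) : A :=
  (Nat.factorial m : 𝒦)⁻¹ • (fun y => e * y - y * e)^[m] a

/-- A Hopf algebra structure on a given (fixed) `R`-algebra `A`. -/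
structure HopfStructure (R A : Type*) [CommRing R] [Ring A] [Algebra R A] where
  comul : A →ₐ[R] A ⊗[R] A
  counit : A →ₐ[R] R
  antipode : A →ₗ[R] A
  coassoc : (Algebra.TensorProduct.assoc R R R A A A).toAlgHom.comp
      ((Algebra.TensorProduct.map comul (.id R A)).comp comul) =
    (Algebra.TensorProduct.map (.id R A) comul).comp comul
  counit_left : (Algebra.TensorProduct.map counit (.id R A)).comp comul =
    (Algebra.TensorProduct.lid R A).symm
  counit_right : (Algebra.TensorProduct.map (.id R A) counit).comp comul =
    (Algebra.TensorProduct.rid R R A).symm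
  antipode_left : LinearMap.mul' R A ∘ₗ antipode.rTensor A ∘ₗ comul.toLinearMap =
    Algebra.linearMap R A ∘ₗ counit.toLinearMap
  antipode_right : LinearMap.mul' R A ∘ₗ antipode.lTensor A ∘ₗ comul.toLinearMap =
    Algebra.linearMap R A ∘ₗ counit.toLinearMap

/-- The Hopf algebra of Mathlib that a `HopfStructure` is; its algebra structure is the given one. -/
abbrev HopfStructure.toHopfAlgebra {R A : Type*} [CommRing R] [Ring A] [i : Algebra R A]
    (H : HopfStructure R A) : HopfAlgebra R A :=
  letI : Bialgebra R A :=
    Bialgebra.ofAlgHom H.comul H.counit H.coassoc H.counit_left H.counit_right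
  { antipode := H.antipode
    mul_antipode_rTensor_comul := H.antipode_left
    mul_antipode_lTensor_comul := H.antipode_right }

theorem HopfStructure.toHopfAlgebra_toAlgebra {R A : Type*} [CommRing R] [Ring A]
    [i : Algebra R A] (H : HopfStructure R A) : H.toHopfAlgebra.toAlgebra = i := rfl

/-- Drinfel'd twists on a Hopf algebra `A`. -/
structure IsDrinfeldTwist {R A : Type*} [CommRing R] [Ring A] [Algebra R A]
    (H : HopfStructure R A) (F : A ⊗[R] A) : Prop where
  isUnit : IsUnit F
  cocycle : Algebra.TensorProduct.assoc R R R A A A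
      (F ⊗ₜ[R] (1 : A) * Algebra.TensorProduct.map H.comul (.id R A) F) =
    (1 : A) ⊗ₜ[R] F * Algebra.TensorProduct.map (.id R A) H.comul F
  counit_left : Algebra.TensorProduct.lid R A
    (Algebra.TensorProduct.map H.counit (.id R A) F) = 1
  counit_right : Algebra.TensorProduct.rid R R A
    (Algebra.TensorProduct.map (.id R A) H.counit F) = 1

/-- The vertical twist `F(k) = ∑_{r < p} (-1)^r / r! · h(k)^[r] ⊗ e(k)^r t^r` on `u_{t,q}(K(2n+1; 1))`;
the terms with `r ≥ p` are absent since `e(k)^p = 0`. -/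
def verticalTwist (𝒦 : Type*) [Field 𝒦] (p : ℕ) {n : ℕ} (q : 𝒦) [CharP 𝒦 p] (k : Fin n) :
    UTQ 𝒦 p n q ⊗[TruncBase 𝒦 p q] UTQ 𝒦 p n q :=
  ∑ r ∈ Finset.range p,
    (((-1 : 𝒦) ^ r * (Nat.factorial r : 𝒦)⁻¹) • falling (hElt 𝒦 p q k) r) ⊗ₜ[TruncBase 𝒦 p q]
      (tvar 𝒦 p q ^ r • eElt 𝒦 p q k ^ r)

end ContactHopf
end

/-! Put h = h(k) and T = e(k)t. The twist calculus needs only three relations: h T = T (h + 1), h^p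
= h and T^p = 0. In these terms F(k) is the truncated binomial series (1 - 1⊗T)^(h⊗1), written with
`fpow`. The truncation does no harm in characteristic p, because T^p = 0 cuts off powers of T and
h^[p] = h^p - h = 0 cuts off falling factorials. The exponent laws of (1 - Y)^X therefore hold
exactly: exponents add, integer exponents give honest powers of 1 - Y, and an element of weight z
shifts the exponent by z when moved across.

The cocycle condition becomes (1 - T₂)^X (1 - T₃)^(X+Y) = (1 - T₃)^Y (1 - T₂ - T₃)^X, which is
`fpow_cocycle`. For primitive a of weight z, moving F across a⊗1 produces the factor (1 - T)^z, and
moving it across 1⊗a produces a series in the divided powers of ad T (`fpow_mul_eq_sum`). Their sum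
is the formula for Δ. The new antipode is S₀ conjugated by w = m(id⊗S₀)F, which is (1 + T)^h with h
written on the left; `fpow_sub_mul_eq_sum` moves a across it. The data for k and k' commute with
each other, so the product of the two twists is a twist and the two computations can be composed.

The standard structure on u_{t,q}(K) comes from the universal property: a linear map on K that
respects brackets and the prescribed p-th powers of the basis extends to u(K).

The dimension is a Poincaré-Birkhoff-Witt theorem for u(K). Straightening shows that ordered
monomials with exponents below p span. For independence, the p-th powers of the operators D_K(x^(α))
on O(2n+1) are computed and found to be the prescribed ones (`contactEnd_pow_eq_zero` and its toral
companions). K then acts by invariant vector fields on the space of matrices over a basis of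
O(2n+1), still compatibly with p-th powers. These fields are linearly independent at the identity
matrix, and a leading-term argument (`linearIndependent_orderedMonomial`) separates the monomials.
The basis of K itself follows from one identity: the top coefficient of a bracket is a multiple of
2n + 4 (`topCoeff_bracket`).

Noncommutativity and noncocommutativity are detected by two matrix coefficients of the action on
O(2n+1) that separate h(k) from e(k). -/

namespace ContactHopf
set_option linter.unusedSectionVars false
noncomputable section

/-! ### Falling and rising factorials in a noncommutative ring -/

section FallingRising
variable {A : Type*} [Ring A]

theorem falling_eq_smeval (x : A) (m : ℕ) : falling x m = (descPochhammer ℤ m).smeval x := by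
  induction m with
  | zero => simp [falling]
  | succ m ih =>
    rw [falling, ih, descPochhammer_succ_right, Polynomial.smeval_mul, Polynomial.smeval_sub,
      Polynomial.smeval_X, Polynomial.smeval_natCast]
    simp

theorem falling_add {x y : A} (h : Commute x y) (m : ℕ) : falling (x + y) m =
    ∑ ij ∈ Finset.HasAntidiagonal.antidiagonal m, (m.choose ij.1 : A) * (falling x ij.1 * falling y ij.2) := by
  simp only [falling_eq_smeval, Ring.descPochhammer_smeval_add m h]

theorem Commute.falling_left {x a : A} (h : Commute x a) (m : ℕ) : Commute (falling x m) a := by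
  induction m with
  | zero => exact Commute.one_left a
  | succ m ih => exact ih.mul_left (h.sub_left (Nat.cast_commute m a))

theorem Commute.rising_left {x a : A} (h : Commute x a) (m : ℕ) : Commute (rising x m) a := by
  induction m with
  | zero => exact Commute.one_left a
  | succ m ih => exact ih.mul_left (h.add_left (Nat.cast_commute m a))

theorem rising_eq_falling (x : A) (m : ℕ) : rising x m = (-1) ^ m * falling (-x) m := by
  induction m with
  | zero => simp [rising, falling]
  | succ m ih => rw [rising, falling, ih, pow_succ]; noncomm_ring

theorem falling_add_index (x : A) (m j : ℕ) :
    falling x (m + j) = falling x m * falling (x - m) j := by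
  induction j with
  | zero => simp [falling]
  | succ j ih => rw [← add_assoc, falling, falling, ih, mul_assoc]; push_cast; rw [sub_sub]

theorem rising_one_eq_falling (x : A) (m : ℕ) : rising (x + 1) m = falling (x + m) m := by
  induction m with
  | zero => simp [rising, falling]
  | succ m ih =>
    rw [rising, ih, add_comm m 1, falling_add_index]
    have h1 : (x + ((1 + m : ℕ) : A)) - ((1 : ℕ) : A) = x + m := by push_cast; abel
    rw [h1]
    have h2 : falling (x + ((1 + m : ℕ) : A)) 1 = x + 1 + m := by
      simp [falling]; abel
    rw [h2]
    exact (Commute.falling_left (by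
      have := (Nat.cast_commute m (x + m)).symm
      have h3 : x + 1 + (m : A) = (x + m) + 1 := by abel
      rw [h3]
      exact (Commute.refl _).add_right (Commute.one_right _)) m)

theorem falling_zero_succ (m : ℕ) : falling (0 : A) (m + 1) = 0 := by
  rw [add_comm, falling_add_index]; simp [falling]

theorem falling_mul_right {x y c : A} (h : x * c = c * y) (m : ℕ) :
    falling x m * c = c * falling y m := by
  induction m with
  | zero => simp [falling]
  | succ m ih =>
    rw [falling, falling, mul_assoc, sub_mul, h, (Nat.cast_commute m c).eq, ← mul_sub, ← mul_assoc,
      ih, mul_assoc]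

theorem map_falling {B : Type*} [Ring B] (f : A →+* B) (x : A) (m : ℕ) :
    f (falling x m) = falling (f x) m := by
  induction m with
  | zero => simp [falling]
  | succ m ih => simp [falling, ih]

end FallingRising

/-! ### The truncated power (1 - Y)^X in characteristic p -/

section CharP
variable (𝒦 : Type*) [Field 𝒦] (p : ℕ) [Fact p.Prime] [CharP 𝒦 p] {A : Type*} [Ring A] [Algebra 𝒦 A]

/-- Over the prime field both sides are monic of degree p and vanish at all p points, so their
difference, of degree below p, is zero. The identity is then mapped to 𝒦. -/
theorem descPochhammer_char : descPochhammer 𝒦 p = Polynomial.X ^ p - Polynomial.X := by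
  have hp := (Fact.out : p.Prime).one_lt
  have hd : (Polynomial.X ^ p - Polynomial.X : Polynomial (ZMod p)).degree = (p : ℕ) := by
    rw [Polynomial.degree_eq_natDegree (FiniteField.X_pow_card_sub_X_ne_zero _ hp),
      FiniteField.X_pow_card_sub_X_natDegree_eq _ hp]
  have hd' : (descPochhammer (ZMod p) p).degree = (p : ℕ) := by
    rw [Polynomial.degree_eq_natDegree (monic_descPochhammer _ _).ne_zero, descPochhammer_natDegree]
  have key : (descPochhammer (ZMod p) p) = Polynomial.X ^ p - Polynomial.X := by
    refine Polynomial.eq_of_degree_sub_lt_of_eval_finset_eq (Finset.univ : Finset (ZMod p)) ?_ ?_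
    · rw [Finset.card_univ, ZMod.card]
      refine (Polynomial.degree_sub_lt_left (hd'.trans hd.symm)
        (monic_descPochhammer _ _).ne_zero ?_).trans_eq hd'
      rw [(monic_descPochhammer _ _).leadingCoeff, Polynomial.leadingCoeff_sub_of_degree_lt]
      · simp
      · rw [Polynomial.degree_X, Polynomial.degree_X_pow]; exact_mod_cast hp
    · intro x _
      rw [descPochhammer_eval_eq_prod_range, Finset.prod_eq_zero (i := x.val)]
      · simp
      · exact Finset.mem_range.2 (ZMod.val_lt x)
      · simp
  have := congrArg (Polynomial.map (ZMod.castHom dvd_rfl 𝒦)) key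
  simpa [descPochhammer_map] using this

theorem aeval_descPochhammer (x : A) (m : ℕ) :
    Polynomial.aeval x (descPochhammer 𝒦 m) = falling x m := by
  induction m with
  | zero => simp [falling]
  | succ m ih => rw [descPochhammer_succ_right, map_mul, ih]; simp [falling]

/-- In characteristic `p` the falling factorial of length `p` is `x ^ p - x`. -/
theorem falling_char (𝒦 : Type*) [Field 𝒦] (p : ℕ) [Fact p.Prime] [CharP 𝒦 p] {A : Type*} [Ring A]
    [Algebra 𝒦 A] (x : A) : falling x p = x ^ p - x := by
  rw [← aeval_descPochhammer 𝒦, descPochhammer_char]; simp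

/-- By Fermat's little theorem the condition x^p = x survives integer translations. -/
theorem falling_sub_int (𝒦 : Type*) [Field 𝒦] (p : ℕ) [Fact p.Prime] [CharP 𝒦 p] {A : Type*} [Ring A]
    [Algebra 𝒦 A] {x : A} (hx : x ^ p = x) (z : ℤ) : falling (x - z) p = 0 := by
  rcases subsingleton_or_nontrivial A with _ | _
  · exact Subsingleton.elim _ _
  have : CharP A p := charP_of_injective_algebraMap (algebraMap 𝒦 A).injective p
  rw [falling_char 𝒦 p, sub_pow_char_of_commute (p := p) (h := (Int.cast_commute z x).symm), hx,
    ← Int.cast_pow]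
  have : ((z ^ p : ℤ) : A) = z := by
    have h := congrArg (ZMod.castHom dvd_rfl A) (ZMod.pow_card (z : ZMod p))
    rw [map_pow, map_intCast] at h
    exact_mod_cast h
  rw [this, sub_self]

omit [Fact p.Prime] in
theorem falling_eq_zero_of_le {x : A} (hx : falling x p = 0) {m : ℕ} (hm : p ≤ m) :
    falling x m = 0 := by
  obtain ⟨j, rfl⟩ := Nat.exists_eq_add_of_le hm
  rw [falling_add_index, hx, zero_mul]

variable {p} in
omit [Fact p.Prime] in
-- This regroups a product of two truncated series by total degree. Every later use has to supply a
-- reason why the part of the square with i + j ≥ p vanishes: either a nilpotent base or a vanishing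
-- falling factorial.
theorem sum_range_mul_range {M : Type*} [AddCommMonoid M] (f : ℕ → ℕ → M)
    (hf : ∀ i j, p ≤ i + j → f i j = 0) :
    ∑ i ∈ Finset.range p, ∑ j ∈ Finset.range p, f i j =
      ∑ r ∈ Finset.range p, ∑ ij ∈ Finset.HasAntidiagonal.antidiagonal r, f ij.1 ij.2 := by
  rw [← Finset.sum_product' (f := f)]
  have h1 : ∑ x ∈ Finset.range p ×ˢ Finset.range p, f x.1 x.2 =
      ∑ x ∈ Finset.range p ×ˢ Finset.range p with x.1 + x.2 < p, f x.1 x.2 := by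
    refine (Finset.sum_filter_of_ne fun x _ hx => ?_).symm
    by_contra h
    exact hx (hf _ _ (not_lt.1 h))
  rw [h1, ← Finset.sum_fiberwise_of_maps_to (t := Finset.range p) (g := fun x : ℕ × ℕ => x.1 + x.2)
    (fun x hx => Finset.mem_range.2 (Finset.mem_filter.1 hx).2)]
  refine Finset.sum_congr rfl fun r hr => Finset.sum_congr ?_ fun _ _ => rfl
  ext ⟨a, b⟩
  simp only [Finset.mem_filter, Finset.mem_product, Finset.mem_range,
    Finset.HasAntidiagonal.mem_antidiagonal] at hr ⊢
  omega

theorem factorial_cast_ne_zero {r : ℕ} (hr : r < p) : (r.factorial : 𝒦) ≠ 0 := by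
  rw [Ne, CharP.cast_eq_zero_iff 𝒦 p, (Fact.out : p.Prime).dvd_factorial]
  omega

theorem choose_mul_inv_factorial {i j : ℕ} (h : i + j < p) :
    ((i + j).choose i : 𝒦) * ((i + j).factorial : 𝒦)⁻¹ = (i.factorial : 𝒦)⁻¹ * (j.factorial : 𝒦)⁻¹ := by
  have h0 := factorial_cast_ne_zero 𝒦 p h
  have h1 := factorial_cast_ne_zero 𝒦 p (show i < p by omega)
  have h2 := factorial_cast_ne_zero 𝒦 p (show j < p by omega)
  have := congrArg (Nat.cast (R := 𝒦)) (Nat.add_choose_mul_factorial_mul_factorial j i)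
  push_cast at this
  field_simp
  rw [add_comm j i] at this
  linear_combination this

/-- The truncated power series `(1 - Y) ^ X`. -/
def fpow (X Y : A) : A :=
  ∑ r ∈ Finset.range p, ((-1) ^ r * (r.factorial : 𝒦)⁻¹) • (falling X r * Y ^ r)

variable {𝒦 p}

omit [Fact p.Prime] [CharP 𝒦 p] in
theorem Commute.fpow_left {X Y a : A} (hX : Commute X a) (hY : Commute Y a) :
    Commute (fpow 𝒦 p X Y) a :=
  Commute.sum_left _ _ _ fun r _ =>
    ((Commute.falling_left hX r).mul_left (hY.pow_left r)).smul_left _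

omit [Fact p.Prime] [CharP 𝒦 p] in
theorem map_fpow {B : Type*} [Ring B] [Algebra 𝒦 B] (f : A →ₐ[𝒦] B) (X Y : A) :
    f (fpow 𝒦 p X Y) = fpow 𝒦 p (f X) (f Y) := by
  simp only [fpow, map_sum, map_smul, map_mul, map_pow]
  exact Finset.sum_congr rfl fun r _ => by
    rw [show f (falling X r) = falling (f X) r from map_falling (f : A →+* B) X r]

/-- Vandermonde's identity for falling factorials. Only X₂ has to commute with Y, since only the
falling factorials of X₂ are moved past powers of Y. -/
theorem fpow_add {X₁ X₂ Y : A} (h : Commute X₁ X₂) (h₂ : Commute X₂ Y)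
    (hY : Y ^ p = 0) : fpow 𝒦 p (X₁ + X₂) Y = fpow 𝒦 p X₁ Y * fpow 𝒦 p X₂ Y := by
  unfold fpow
  rw [Finset.sum_mul_sum, sum_range_mul_range]
  · refine Finset.sum_congr rfl fun r hr => ?_
    rw [falling_add h, Finset.sum_mul, Finset.smul_sum]
    refine Finset.sum_congr rfl fun ij hij => ?_
    obtain ⟨i, j⟩ := ij
    rw [Finset.HasAntidiagonal.mem_antidiagonal] at hij
    subst hij
    dsimp only at hr ⊢
    rw [smul_mul_smul_comm, mul_assoc (falling X₁ i), ← mul_assoc (Y ^ i),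
      ← ((Commute.falling_left h₂ j).pow_right i).eq, mul_assoc (falling X₂ j), ← pow_add,
      ← mul_assoc (falling X₁ i), mul_assoc (Nat.cast _), ← nsmul_eq_mul, ← Nat.cast_smul_eq_nsmul 𝒦,
      smul_smul]
    congr 1
    have := choose_mul_inv_factorial 𝒦 p (Finset.mem_range.1 hr)
    rw [pow_add]
    linear_combination (-1) ^ i * (-1) ^ j * this
  · intro i j hij
    rw [smul_mul_smul_comm, mul_assoc (falling X₁ i), ← mul_assoc (Y ^ i),
      ← ((Commute.falling_left h₂ j).pow_right i).eq, mul_assoc (falling X₂ j), ← pow_add,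
      pow_eq_zero_of_le hij hY, mul_zero, mul_zero, smul_zero]

omit [CharP 𝒦 p] in
theorem fpow_zero_left (Y : A) : fpow 𝒦 p 0 Y = 1 := by
  unfold fpow
  rw [Finset.sum_eq_single 0]
  · simp [falling]
  · intro r _ hr
    obtain ⟨m, rfl⟩ := Nat.exists_eq_succ_of_ne_zero hr
    rw [falling_zero_succ, zero_mul, smul_zero]
  · intro h; exact absurd (Finset.mem_range.2 (Fact.out : p.Prime).pos) h

omit [CharP 𝒦 p] in
theorem fpow_zero_right (X : A) : fpow 𝒦 p X 0 = 1 := by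
  unfold fpow
  rw [Finset.sum_eq_single 0]
  · simp [falling]
  · intro r _ hr
    rw [zero_pow hr, mul_zero, smul_zero]
  · intro h; exact absurd (Finset.mem_range.2 (Fact.out : p.Prime).pos) h

omit [CharP 𝒦 p] in
theorem fpow_one (Y : A) : fpow 𝒦 p 1 Y = 1 - Y := by
  have hp := (Fact.out : p.Prime).two_le
  unfold fpow
  rw [← Finset.sum_subset (Finset.range_subset_range.2 hp)]
  · simp [Finset.sum_range_succ, falling, sub_eq_add_neg]
  · intro r _ hr
    have : 2 ≤ r := by simpa [Nat.lt_iff_add_one_le] using hr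
    obtain ⟨m, rfl⟩ := Nat.exists_eq_add_of_le this
    rw [falling_add_index]
    simp [falling]

theorem fpow_neg_mul {X Y : A} (h : Commute X Y) (hY : Y ^ p = 0) :
    fpow 𝒦 p (-X) Y * fpow 𝒦 p X Y = 1 := by
  rw [← fpow_add ((Commute.refl X).neg_left) h hY, neg_add_cancel, fpow_zero_left]

theorem fpow_mul_neg {X Y : A} (h : Commute X Y) (hY : Y ^ p = 0) :
    fpow 𝒦 p X Y * fpow 𝒦 p (-X) Y = 1 := by
  rw [← fpow_add ((Commute.refl X).neg_right) h.neg_left hY, add_neg_cancel, fpow_zero_left]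

theorem fpow_int {Y : A} (hY : Y ^ p = 0) (g : Aˣ) (hg : (g : A) = 1 - Y) (z : ℤ) :
    fpow 𝒦 p (z : A) Y = ↑(g ^ z) := by
  have step : ∀ z : ℤ, fpow 𝒦 p ((z + 1 : ℤ) : A) Y = fpow 𝒦 p (z : A) Y * g := by
    intro z
    rw [hg, ← fpow_one (𝒦 := 𝒦) (p := p), Int.cast_add, Int.cast_one]
    exact fpow_add (Commute.one_right _) (Commute.one_left _) hY
  induction z using Int.induction_on with
  | zero => simpa using fpow_zero_left Y
  | succ i ih => rw [step, ih, zpow_add_one]; simp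
  | pred i ih =>
    have := step (-(i : ℤ) - 1)
    rw [sub_add_cancel, ih] at this
    rw [zpow_sub_one, Units.val_mul, this, mul_assoc, Units.mul_inv, mul_one]

omit [Fact p.Prime] [CharP 𝒦 p] in
theorem fpow_mul_of_shift {X Y c l : A} (hX : X * c = c * (X + l)) (hY : Commute Y c) :
    fpow 𝒦 p X Y * c = c * fpow 𝒦 p (X + l) Y := by
  unfold fpow
  rw [Finset.sum_mul, Finset.mul_sum]
  refine Finset.sum_congr rfl fun r _ => ?_
  rw [smul_mul_assoc, mul_smul_comm, mul_assoc, (hY.pow_left r).eq, ← mul_assoc,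
    falling_mul_right hX, mul_assoc]

variable (𝒦) in
omit [Fact p.Prime] [CharP 𝒦 p] in
theorem divAd_eq (e : A) (m : ℕ) (a : A) : divAd 𝒦 e m a = (m.factorial : 𝒦)⁻¹ •
    ((LinearMap.mulLeft 𝒦 e - LinearMap.mulRight 𝒦 e) ^ m) a := by
  rw [divAd, Module.End.pow_apply]
  rfl

/-- Right multiplication by E is left multiplication minus ad E, and these commute, so the binomial
theorem applies. Division by s!, legitimate for s < p, turns the binomial coefficients into divided
powers. -/
theorem inv_factorial_smul_mul_pow (a E : A) {s : ℕ} (hs : s < p) :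
    (s.factorial : 𝒦)⁻¹ • (a * E ^ s) = ∑ ij ∈ Finset.HasAntidiagonal.antidiagonal s,
      ((-1) ^ ij.1 * (ij.2.factorial : 𝒦)⁻¹) • (E ^ ij.2 * divAd 𝒦 E ij.1 a) := by
  set L := LinearMap.mulLeft 𝒦 E
  set R := LinearMap.mulRight 𝒦 E
  have hLR : Commute L R := LinearMap.commute_mulLeft_right E E
  have hc : Commute (-(L - R)) L := ((Commute.refl L).sub_left hLR.symm).neg_left
  have h1 : a * E ^ s = ((-(L - R) + L) ^ s) a := by
    rw [neg_sub, sub_add_cancel, LinearMap.pow_mulRight, LinearMap.mulRight_apply]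
  rw [h1, hc.add_pow', LinearMap.sum_apply, Finset.smul_sum]
  refine Finset.sum_congr rfl fun ij hij => ?_
  obtain ⟨i, j⟩ := ij
  rw [Finset.HasAntidiagonal.mem_antidiagonal] at hij
  subst hij
  dsimp only at hs ⊢
  rw [(hc.pow_pow i j).eq, divAd_eq, ← neg_one_smul 𝒦 (L - R), smul_pow, ← Nat.cast_smul_eq_nsmul 𝒦, LinearMap.smul_apply,
    smul_smul, mul_comm, choose_mul_inv_factorial 𝒦 p hs, Module.End.mul_apply,
    LinearMap.smul_apply, LinearMap.pow_mulLeft, LinearMap.mulLeft_apply, mul_smul_comm, smul_smul]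
  rw [mul_smul_comm, smul_smul]
  congr 1
  ring

/-- The mirror image of the preceding lemma: left multiplication is ad E plus right multiplication.
-/
theorem inv_factorial_smul_pow_mul (a E : A) {s : ℕ} (hs : s < p) :
    (s.factorial : 𝒦)⁻¹ • (E ^ s * a) = ∑ ij ∈ Finset.HasAntidiagonal.antidiagonal s,
      (ij.2.factorial : 𝒦)⁻¹ • (divAd 𝒦 E ij.1 a * E ^ ij.2) := by
  set L := LinearMap.mulLeft 𝒦 E
  set R := LinearMap.mulRight 𝒦 E
  have hLR : Commute L R := LinearMap.commute_mulLeft_right E E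
  have hc : Commute (L - R) R := hLR.sub_left (Commute.refl R)
  have h1 : E ^ s * a = (((L - R) + R) ^ s) a := by
    rw [sub_add_cancel, LinearMap.pow_mulLeft, LinearMap.mulLeft_apply]
  rw [h1, hc.add_pow', LinearMap.sum_apply, Finset.smul_sum]
  refine Finset.sum_congr rfl fun ij hij => ?_
  obtain ⟨i, j⟩ := ij
  rw [Finset.HasAntidiagonal.mem_antidiagonal] at hij
  subst hij
  dsimp only at hs ⊢
  rw [(hc.pow_pow i j).eq, divAd_eq, ← Nat.cast_smul_eq_nsmul 𝒦, LinearMap.smul_apply,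
    smul_smul, mul_comm, choose_mul_inv_factorial 𝒦 p hs, Module.End.mul_apply,
    LinearMap.pow_mulRight, LinearMap.mulRight_apply, smul_mul_assoc, smul_smul]
  congr 1
  ring

/-- Conjugation of `a` by `(1 - E) ^ X`, when `X` commutes with `E` and `a`. -/
theorem fpow_mul_eq_sum {X E a : A} (hXE : Commute X E) (hXa : Commute X a) (hE : E ^ p = 0)
    (hX : falling (-X) p = 0) : fpow 𝒦 p X E * a =
      (∑ m ∈ Finset.range p, falling (-X) m * (fpow 𝒦 p (-(m : A)) E * divAd 𝒦 E m a)) *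
        fpow 𝒦 p X E := by
  -- Expanding a (1 - E)^(-X), rather than the conjugate of a, leaves the factorials of -X on the
  -- left. The splitting (-X)^[m+j] = (-X)^[m] (-X-m)^[j] then lets the sum over j be collected into
  -- (1 - E)^(-X-m). Terms with m + j ≥ p vanish because (-X)^[p] = 0.
  have key : a * fpow 𝒦 p (-X) E = ∑ m ∈ Finset.range p,
      falling (-X) m * (fpow 𝒦 p (-X - m) E * divAd 𝒦 E m a) := by
    have h1 : a * fpow 𝒦 p (-X) E = ∑ s ∈ Finset.range p,
        ∑ ij ∈ Finset.HasAntidiagonal.antidiagonal s, ((-1) ^ ij.2 * (ij.2.factorial : 𝒦)⁻¹) •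
          (falling (-X) (ij.1 + ij.2) * (E ^ ij.2 * divAd 𝒦 E ij.1 a)) := by
      rw [fpow, Finset.mul_sum]
      refine Finset.sum_congr rfl fun s hs => ?_
      rw [mul_smul_comm, ← mul_assoc, ← (Commute.falling_left hXa.neg_left s).eq, mul_assoc,
        mul_smul, ← mul_smul_comm, inv_factorial_smul_mul_pow a E (Finset.mem_range.1 hs),
        Finset.mul_sum, Finset.smul_sum]
      refine Finset.sum_congr rfl fun ij hij => ?_
      rw [Finset.HasAntidiagonal.mem_antidiagonal] at hij
      rw [mul_smul_comm, smul_smul, hij]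
      congr 1
      rw [← hij, pow_add]
      have : ((-1 : 𝒦) ^ ij.1) * (-1) ^ ij.1 = 1 := by rw [← mul_pow]; simp
      linear_combination ((-1) ^ ij.2 * (ij.2.factorial : 𝒦)⁻¹) * this
    rw [h1, ← sum_range_mul_range (fun i j => ((-1) ^ j * (j.factorial : 𝒦)⁻¹) •
          (falling (-X) (i + j) * (E ^ j * divAd 𝒦 E i a)))]
    · refine Finset.sum_congr rfl fun m _ => ?_
      rw [fpow, Finset.sum_mul, Finset.mul_sum]
      refine Finset.sum_congr rfl fun j _ => ?_
      rw [smul_mul_assoc, mul_smul_comm, falling_add_index]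
      simp only [mul_assoc]
    · intro i j hij
      rw [falling_eq_zero_of_le p hX hij, zero_mul, smul_zero]
  have h2 := congrArg (fun y => fpow 𝒦 p X E * y * fpow 𝒦 p X E) key
  simp only [mul_assoc] at h2
  rw [fpow_neg_mul hXE hE, mul_one] at h2
  rw [h2, Finset.sum_mul, Finset.mul_sum, Finset.sum_mul]
  refine Finset.sum_congr rfl fun m _ => ?_
  have h3 : fpow 𝒦 p X E * fpow 𝒦 p (-X - m) E = fpow 𝒦 p (-(m : A)) E := by
    rw [← fpow_add]
    · congr 1; abel
    · exact (Commute.refl X).neg_right.sub_right (Nat.cast_commute m X).symm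
    · exact hXE.neg_left.sub_left (Nat.cast_commute m E)
    · exact hE
  have h4 : Commute (fpow 𝒦 p X E) (falling (-X) m) :=
    (Commute.falling_left ((Commute.fpow_left (Commute.refl X) hXE.symm).neg_right.symm) m).symm
  rw [← h3]
  simp only [← mul_assoc]
  rw [h4.eq]

theorem fpow_mul_weight {X E c l : A} (hX : X * c = c * (X + l)) (hc : Commute E c)
    (hXE : Commute X E) (hXl : Commute X l) (hE : E ^ p = 0) :
    fpow 𝒦 p X E * c = c * fpow 𝒦 p l E * fpow 𝒦 p X E := by
  rw [fpow_mul_of_shift hX hc, add_comm, fpow_add hXl.symm hXE hE, mul_assoc]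

omit [Fact p.Prime] [CharP 𝒦 p] [Algebra 𝒦 A] in
theorem mul_pow_of_shift {h T : A} (hT : h * T = T * (h + 1)) (a : ℕ) :
    h * T ^ a = T ^ a * (h + a) := by
  induction a with
  | zero => simp
  | succ a ih =>
    rw [pow_succ, ← mul_assoc, ih, mul_assoc, add_mul, hT, (Nat.cast_commute a T).eq, mul_assoc,
      ← mul_add]
    push_cast; rw [add_assoc, add_comm (1 : A)]

/-- The cocycle identity for `(1 - T) ^ h`. -/
theorem fpow_cocycle {X Y T₂ T₃ : A} (hXY : Commute X Y) (hX2 : Commute X T₂) (hX3 : Commute X T₃)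
    (h23 : Commute T₂ T₃) (hY2 : Y * T₂ = T₂ * (Y + 1)) (h3 : T₃ ^ p = 0)
    (hX : falling X p = 0) :
    fpow 𝒦 p X T₂ * fpow 𝒦 p (X + Y) T₃ = fpow 𝒦 p Y T₃ * fpow 𝒦 p X (T₂ + T₃) := by
  -- Binomial expansion in the commuting T₂ and T₃, with the sum over the exponent of T₃ collected
  -- into a power of 1 - T₃. The hypothesis X^[p] = 0 is what allows the triangle of exponents to be
  -- completed to a square.
  have key : fpow 𝒦 p X (T₂ + T₃) = ∑ a ∈ Finset.range p, ((-1) ^ a * (a.factorial : 𝒦)⁻¹) •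
      (falling X a * (T₂ ^ a * fpow 𝒦 p (X - a) T₃)) := by
    have h1 : fpow 𝒦 p X (T₂ + T₃) = ∑ s ∈ Finset.range p,
        ∑ ij ∈ Finset.HasAntidiagonal.antidiagonal s,
          ((-1) ^ ij.1 * (ij.1.factorial : 𝒦)⁻¹ * ((-1) ^ ij.2 * (ij.2.factorial : 𝒦)⁻¹)) •
          (falling X (ij.1 + ij.2) * (T₂ ^ ij.1 * T₃ ^ ij.2)) := by
      unfold fpow
      refine Finset.sum_congr rfl fun s hs => ?_
      rw [h23.add_pow', Finset.mul_sum, Finset.smul_sum]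
      refine Finset.sum_congr rfl fun ij hij => ?_
      rw [Finset.HasAntidiagonal.mem_antidiagonal] at hij
      subst hij
      have := choose_mul_inv_factorial 𝒦 p (Finset.mem_range.1 hs)
      rw [← Nat.cast_smul_eq_nsmul 𝒦, mul_smul_comm, smul_smul]
      congr 1
      rw [pow_add]
      linear_combination (-1) ^ ij.1 * (-1) ^ ij.2 * this
    rw [h1, ← sum_range_mul_range (fun i j =>
      ((-1) ^ i * (i.factorial : 𝒦)⁻¹ * ((-1) ^ j * (j.factorial : 𝒦)⁻¹)) •
          (falling X (i + j) * (T₂ ^ i * T₃ ^ j)))]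
    · refine Finset.sum_congr rfl fun a _ => ?_
      simp only [fpow, Finset.mul_sum, Finset.smul_sum]
      refine Finset.sum_congr rfl fun j _ => ?_
      rw [mul_smul_comm, mul_smul_comm, smul_smul, falling_add_index]
      congr 1
      have : Commute (falling (X - a) j) (T₂ ^ a) :=
        Commute.falling_left ((hX2.sub_left (Nat.cast_commute a T₂)).pow_right a) j
      rw [← mul_assoc (T₂ ^ a), ← this.eq]
      simp only [mul_assoc]
    · intro i j hij
      rw [falling_eq_zero_of_le p hX hij, zero_mul, smul_zero]
  -- Moving (1 - T₃)^Y across T₂^a raises the exponent Y by a, which compensates the -a in (1 -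
  -- T₃)^(X-a).
  have hshift := mul_pow_of_shift hY2
  rw [key, Finset.mul_sum, fpow, Finset.sum_mul]
  refine Finset.sum_congr rfl fun a _ => ?_
  have hXX : Commute X (fpow 𝒦 p Y T₃) := (Commute.fpow_left hXY.symm hX3.symm).symm
  rw [mul_smul_comm, smul_mul_assoc, ← mul_assoc (fpow 𝒦 p Y T₃), ← (Commute.falling_left hXX a).eq,
    mul_assoc (falling X a), mul_assoc (falling X a), ← mul_assoc (fpow 𝒦 p Y T₃),
    fpow_mul_of_shift (hshift a) (h23.symm.pow_right a), mul_assoc (T₂ ^ a), ← fpow_add]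
  · congr 4; abel
  · exact ((hXY.symm.sub_right (Nat.cast_commute a Y).symm).add_left
      (Nat.cast_commute a _))
  · exact hX3.sub_left (Nat.cast_commute a _)
  · exact h3

theorem pow_mul_falling {h T : A} (hT : h * T = T * (h + 1)) (r s : ℕ) :
    T ^ r * falling h s = falling (h - r) s * T ^ r := by
  refine (falling_mul_right ?_ s).symm
  rw [sub_mul, mul_pow_of_shift hT, mul_add, (Nat.cast_commute r (T ^ r)).eq, add_sub_cancel_right]

omit [Fact p.Prime] [CharP 𝒦 p] in
theorem fpow_neg_right (X T : A) : fpow 𝒦 p X (-T) =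
    ∑ r ∈ Finset.range p, (r.factorial : 𝒦)⁻¹ • (falling X r * T ^ r) := by
  refine Finset.sum_congr rfl fun r _ => ?_
  rcases Nat.even_or_odd r with h | h <;> simp [h.neg_one_pow, h.neg_pow]

/-- Moving T^r past h^[s] gives h^[r] T^r h^[s] T^s = h^[r+s] T^(r+s), so the coefficient in degree
N > 0 is (1 - 1)^N / N! = 0. This is not a case of `fpow_neg_mul`: here the exponent does not
commute with the base, and the inverse of (1 + T)^h in this ordering is (1 - T)^h. -/
theorem fpow_neg_mul_fpow {h T : A} (hT : h * T = T * (h + 1)) (h0 : T ^ p = 0) :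
    fpow 𝒦 p h (-T) * fpow 𝒦 p h T = 1 := by
  have hterm : ∀ r s : ℕ, (r.factorial : 𝒦)⁻¹ • (falling h r * T ^ r) *
      ((-1) ^ s * (s.factorial : 𝒦)⁻¹) • (falling h s * T ^ s) =
      ((r.factorial : 𝒦)⁻¹ * ((-1) ^ s * (s.factorial : 𝒦)⁻¹)) •
        (falling h (r + s) * T ^ (r + s)) := by
    intro r s
    rw [smul_mul_smul_comm, mul_assoc (falling h r), ← mul_assoc (T ^ r), pow_mul_falling hT,
      mul_assoc (falling (h - r) s), ← pow_add, falling_add_index, mul_assoc]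
  rw [fpow_neg_right, fpow, Finset.sum_mul_sum, sum_range_mul_range,
    Finset.sum_eq_single_of_mem 0 (Finset.mem_range.2 (Fact.out : p.Prime).pos)]
  · simp [falling]
  · intro N hN hN0
    have h1 : ∀ ij ∈ Finset.HasAntidiagonal.antidiagonal N,
        (ij.1.factorial : 𝒦)⁻¹ • (falling h ij.1 * T ^ ij.1) *
        ((-1) ^ ij.2 * (ij.2.factorial : 𝒦)⁻¹) • (falling h ij.2 * T ^ ij.2) =
        (N.choose ij.1 • ((1 : 𝒦) ^ ij.1 * (-1) ^ ij.2)) • (N.factorial : 𝒦)⁻¹ •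
          (falling h N * T ^ N) := by
      intro ij hij
      rw [Finset.HasAntidiagonal.mem_antidiagonal] at hij
      subst hij
      rw [hterm, smul_smul]
      congr 1
      have := choose_mul_inv_factorial 𝒦 p (Finset.mem_range.1 hN)
      rw [nsmul_eq_mul, one_pow]
      linear_combination -(-1) ^ ij.2 * this
    rw [Finset.sum_congr rfl h1, ← Finset.sum_smul, ← (Commute.all (1 : 𝒦) (-1)).add_pow',
      add_neg_cancel, zero_pow hN0, zero_smul]
  · intro i j hij
    rw [hterm, pow_eq_zero_of_le hij h0, mul_zero, smul_zero]

theorem falling_succ_sub (x : A) (r : ℕ) :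
    falling x (r + 1) = falling (x - 1) (r + 1) + (r + 1) • falling (x - 1) r := by
  rw [add_comm r 1, falling_add_index, add_comm 1 r, falling.eq_2 (x - 1)]
  have h1 : falling x 1 = x := by simp [falling]
  have h2 : Commute x (falling (x - 1) r) := (Commute.falling_left
    ((Commute.refl x).sub_left (Commute.one_left x)) r).symm
  rw [h1, Nat.cast_one, h2.eq, nsmul_eq_mul, (Nat.cast_commute (r + 1) _).eq, ← mul_add]
  congr 1
  push_cast
  abel

/-- T passes x^[r] by lowering x to x - 1, after which the claim is the Pascal rule
`falling_succ_sub`. The leftover top term contains T^p. -/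
theorem one_sub_mul_fpow {x T : A} (hT : x * T = T * (x + 1)) (h0 : T ^ p = 0) :
    (1 - T) * fpow 𝒦 p x (-T) = fpow 𝒦 p (x - 1) (-T) := by
  have h1 : ∀ r, T * (falling x r * T ^ r) = falling (x - 1) r * T ^ (r + 1) := by
    intro r
    have := pow_mul_falling hT 1 r
    rw [pow_one, Nat.cast_one] at this
    rw [← mul_assoc, this, mul_assoc, ← pow_succ']
  obtain ⟨k, hk⟩ : ∃ k, p = k + 1 := ⟨p - 1, by have := (Fact.out : p.Prime).pos; omega⟩
  rw [sub_mul, one_mul, sub_eq_iff_eq_add, fpow_neg_right, fpow_neg_right, Finset.mul_sum]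
  simp only [mul_smul_comm, h1]
  have e1 : ∀ f : ℕ → A, ∑ r ∈ Finset.range p, f r = ∑ r ∈ Finset.range k, f (r + 1) + f 0 := by
    intro f; rw [hk, Finset.sum_range_succ']
  have e2 : ∀ f : ℕ → A, ∑ r ∈ Finset.range p, f r = ∑ r ∈ Finset.range k, f r + f k := by
    intro f; rw [hk, Finset.sum_range_succ]
  rw [e1, e1, e2 (fun r => (r.factorial : 𝒦)⁻¹ • (falling (x - 1) r * T ^ (r + 1))), ← hk, h0,
    mul_zero, smul_zero, add_zero, add_right_comm, ← Finset.sum_add_distrib]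
  refine congrArg₂ _ (Finset.sum_congr rfl fun r hr => ?_) (by simp [falling])
  have hr' : r + 1 < p := by have := Finset.mem_range.1 hr; omega
  have h3 := factorial_cast_ne_zero 𝒦 p (show r < p by omega)
  have h4 : ((r + 1 : ℕ) : 𝒦) ≠ 0 := by
    rw [Ne, CharP.cast_eq_zero_iff 𝒦 p]
    intro h; have := Nat.le_of_dvd (by omega) h; omega
  rw [falling_succ_sub, add_mul, smul_add, smul_mul_assoc, ← Nat.cast_smul_eq_nsmul 𝒦, smul_smul,
    Nat.factorial_succ]
  congr 2
  push_cast at h4 ⊢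
  field_simp

theorem zpow_mul_fpow {h T : A} (hT : h * T = T * (h + 1)) (h0 : T ^ p = 0) (g : Aˣ)
    (hg : (g : A) = 1 - T) (z : ℤ) :
    ↑(g ^ z) * fpow 𝒦 p h (-T) = fpow 𝒦 p (h - z) (-T) := by
  have step : ∀ z : ℤ, (g : A) * fpow 𝒦 p (h - z) (-T) = fpow 𝒦 p (h - (z + 1 : ℤ)) (-T) := by
    intro z
    rw [hg, one_sub_mul_fpow _ h0]
    · push_cast; rw [sub_sub]
    · rw [sub_mul, hT, (Int.cast_commute z T).eq, ← mul_sub]; congr 1; abel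
  induction z using Int.induction_on with
  | zero => simp
  | succ i ih => rw [← step, ← ih, add_comm, zpow_add]; simp [mul_assoc]
  | pred i ih =>
    have := step (-(i : ℤ) - 1)
    rw [sub_add_cancel, ← ih] at this
    rw [sub_eq_neg_add, zpow_add, Units.val_mul, mul_assoc, zpow_neg_one, ← this,
      Units.inv_mul_cancel_left, sub_eq_neg_add (-(i : ℤ))]

/-- T has weight 1 for h, so the m-th divided power of ad T raises the weight of a from l to l + m.
-/
theorem mul_divAd_of_shift {h T a l : A} (hT : h * T = T * (h + 1)) (ha : h * a = a * (h + l))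
    (hlT : Commute l T) (m : ℕ) : h * divAd 𝒦 T m a = divAd 𝒦 T m a * (h + l + m) := by
  unfold divAd
  rw [mul_smul_comm, smul_mul_assoc]
  congr 1
  induction m with
  | zero => simpa using ha
  | succ m ih =>
    rw [Function.iterate_succ_apply']
    generalize (fun y => T * y - y * T)^[m] a = d at ih ⊢
    have e1 : h * (T * d) = T * d * (h + l + m + 1) := by
      rw [← mul_assoc, hT, mul_assoc, add_mul, one_mul, ih, mul_assoc, mul_add d _ 1, mul_one]
    have e2 : h * (d * T) = d * T * (h + l + m + 1) := by
      rw [← mul_assoc, ih, mul_assoc, mul_assoc, add_mul, add_mul, hT, hlT.eq,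
        (Nat.cast_commute m T).eq, ← mul_add, ← mul_add]
      congr 2; abel
    rw [mul_sub, e1, e2, sub_mul]
    push_cast
    simp only [add_assoc]

/-- Conjugation of `a` by `(1 + T) ^ h`, when `T` raises the eigenvalue of `h` by `1` and
`a` raises it by `l`. -/
theorem fpow_sub_mul_eq_sum {h T a l : A} (hT : h * T = T * (h + 1)) (ha : h * a = a * (h + l))
    (hl : ∀ b, Commute l b) (hl0 : falling (h - l) p = 0) :
    fpow 𝒦 p (h - l) (-T) * a =
      (∑ m ∈ Finset.range p, divAd 𝒦 T m a * rising (h + 1) m) * fpow 𝒦 p h (-T) := by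
  have h1 : fpow 𝒦 p (h - l) (-T) * a = ∑ s ∈ Finset.range p,
      ∑ ij ∈ Finset.HasAntidiagonal.antidiagonal s, (ij.2.factorial : 𝒦)⁻¹ •
        (falling (h - l) (ij.1 + ij.2) * (divAd 𝒦 T ij.1 a * T ^ ij.2)) := by
    rw [fpow_neg_right, Finset.sum_mul]
    refine Finset.sum_congr rfl fun s hs => ?_
    rw [smul_mul_assoc, mul_assoc, ← mul_smul_comm,
      inv_factorial_smul_pow_mul a T (Finset.mem_range.1 hs), Finset.mul_sum]
    refine Finset.sum_congr rfl fun ij hij => ?_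
    rw [Finset.HasAntidiagonal.mem_antidiagonal] at hij
    rw [mul_smul_comm, hij]
  rw [h1, ← sum_range_mul_range (fun i j => (j.factorial : 𝒦)⁻¹ •
        (falling (h - l) (i + j) * (divAd 𝒦 T i a * T ^ j))), Finset.sum_mul]
  · refine Finset.sum_congr rfl fun m _ => ?_
    rw [fpow_neg_right, Finset.mul_sum]
    refine Finset.sum_congr rfl fun j _ => ?_
    -- Passing the m-th divided power turns h - l into h + m, and (h + m)^[m] is the rising
    -- factorial of h + 1. This is the origin of the shift by 1 in the antipode formula.
    have h2 : (h - l) * divAd 𝒦 T m a = divAd 𝒦 T m a * (h + m) := by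
      rw [sub_mul, mul_divAd_of_shift hT ha (hl T), (hl _).eq, ← mul_sub]
      congr 1; abel
    rw [mul_smul_comm, ← mul_assoc, falling_mul_right h2, falling_add_index, add_sub_cancel_right,
      rising_one_eq_falling]
    simp only [mul_assoc]
  · intro i j hij
    rw [falling_eq_zero_of_le p hl0 hij, zero_mul, smul_zero]

end CharP

/-! ### Twisting a Hopf algebra structure -/

section Twist
variable {R A : Type*} [CommRing R] [Ring A] [Algebra R A]

/-- `x ⊗ y ↦ S x * c * y`. -/
def sandwichLeft (S : A →ₗ[R] A) (c : A) : A ⊗[R] A →ₗ[R] A :=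
  LinearMap.mul' R A ∘ₗ (LinearMap.mulRight R c ∘ₗ S).rTensor A

/-- `x ⊗ y ↦ x * c * S y`. -/
def sandwichRight (S : A →ₗ[R] A) (c : A) : A ⊗[R] A →ₗ[R] A :=
  LinearMap.mul' R A ∘ₗ (LinearMap.mulLeft R c ∘ₗ S).lTensor A

@[simp] theorem sandwichLeft_tmul (S : A →ₗ[R] A) (c x y : A) :
    sandwichLeft S c (x ⊗ₜ y) = S x * c * y := by
  simp [sandwichLeft]

@[simp] theorem sandwichRight_tmul (S : A →ₗ[R] A) (c x y : A) :
    sandwichRight S c (x ⊗ₜ y) = x * c * S y := by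
  simp [sandwichRight, mul_assoc]

theorem sandwichLeft_smul (S : A →ₗ[R] A) (r : R) (c : A) (u : A ⊗[R] A) :
    sandwichLeft S (r • c) u = r • sandwichLeft S c u := by
  induction u with
  | zero => simp
  | add u w hu hw => rw [map_add, hu, hw, map_add, smul_add]
  | tmul a b => simp

theorem sandwichRight_smul (S : A →ₗ[R] A) (r : R) (c : A) (u : A ⊗[R] A) :
    sandwichRight S (r • c) u = r • sandwichRight S c u := by
  induction u with
  | zero => simp
  | add u w hu hw => rw [map_add, hu, hw, map_add, smul_add]
  | tmul a b => simp

/-- Because S reverses products, c ↦ S(x) c y is a right action of A ⊗ A on A, and `sandwichRight`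
gives a left action. The antipode axioms for a twisted coproduct F Δ(a) F⁻¹ can thus be evaluated
one factor at a time. -/
theorem sandwichLeft_mul {S : A →ₗ[R] A} (hS : ∀ a b, S (a * b) = S b * S a)
    (c : A) (u v : A ⊗[R] A) :
    sandwichLeft S c (u * v) = sandwichLeft S (sandwichLeft S c u) v := by
  induction v with
  | zero => simp
  | add v w hv hw => rw [mul_add, map_add, hv, hw, map_add]
  | tmul x y =>
    induction u with
    | zero => simp
    | add u w hu hw => rw [add_mul, map_add, hu, hw]; simp [mul_add, add_mul]
    | tmul a b => simp [hS, mul_assoc]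

theorem sandwichRight_mul {S : A →ₗ[R] A} (hS : ∀ a b, S (a * b) = S b * S a)
    (c : A) (u v : A ⊗[R] A) :
    sandwichRight S c (u * v) = sandwichRight S (sandwichRight S c v) u := by
  induction u with
  | zero => simp
  | add v w hv hw => rw [add_mul, map_add, hv, hw, map_add]
  | tmul x y =>
    induction v with
    | zero => simp
    | add u w hu hw => rw [mul_add, map_add, hu, hw]; simp [mul_add, add_mul]
    | tmul a b => simp [hS, mul_assoc]

/-- Conjugation by a unit, as an algebra homomorphism. -/
def conjAlgHom {B : Type*} [Ring B] [Algebra R B] (F : Bˣ) : B →ₐ[R] B :=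
  AlgHom.ofLinearMap (LinearMap.mulLeft R (F : B) ∘ₗ LinearMap.mulRight R (↑F⁻¹ : B))
    (by simp) (fun x y => by simp [mul_assoc])

@[simp] theorem conjAlgHom_apply {B : Type*} [Ring B] [Algebra R B] (F : Bˣ) (x : B) :
    conjAlgHom (R := R) F x = F * x * ↑F⁻¹ := by
  simp [conjAlgHom, mul_assoc]

variable (H : HopfStructure R A)

theorem HopfStructure.sandwichLeft_comul (a : A) :
    sandwichLeft H.antipode 1 (H.comul a) = algebraMap R A (H.counit a) := by
  have := LinearMap.congr_fun H.antipode_left a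
  have h : sandwichLeft H.antipode 1 = LinearMap.mul' R A ∘ₗ H.antipode.rTensor A := by
    ext; simp
  rw [h]; exact this

theorem HopfStructure.sandwichRight_comul (a : A) :
    sandwichRight H.antipode 1 (H.comul a) = algebraMap R A (H.counit a) := by
  have := LinearMap.congr_fun H.antipode_right a
  have h : sandwichRight H.antipode 1 = LinearMap.mul' R A ∘ₗ H.antipode.lTensor A := by
    ext; simp
  rw [h]; exact this

theorem HopfStructure.antipode_one : H.antipode 1 = 1 := by
  simpa [Algebra.TensorProduct.one_def] using H.sandwichLeft_comul 1

theorem map_conj_left (F : (A ⊗[R] A)ˣ) (x : A ⊗[R] A) :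
    Algebra.TensorProduct.map ((conjAlgHom F).comp H.comul) (.id R A) x =
      (F : A ⊗[R] A) ⊗ₜ[R] (1 : A) * Algebra.TensorProduct.map H.comul (.id R A) x *
        (↑F⁻¹ : A ⊗[R] A) ⊗ₜ[R] (1 : A) := by
  induction x with
  | zero => simp
  | add x y hx hy => rw [map_add, hx, hy, map_add, mul_add, add_mul]
  | tmul a b => simp

theorem map_conj_right (F : (A ⊗[R] A)ˣ) (x : A ⊗[R] A) :
    Algebra.TensorProduct.map (.id R A) ((conjAlgHom F).comp H.comul) x =
      (1 : A) ⊗ₜ[R] (F : A ⊗[R] A) * Algebra.TensorProduct.map (.id R A) H.comul x *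
        (1 : A) ⊗ₜ[R] (↑F⁻¹ : A ⊗[R] A) := by
  induction x with
  | zero => simp
  | add x y hx hy => rw [map_add, hx, hy, map_add, mul_add, add_mul]
  | tmul a b => simp

variable {H} in
/-- The inverse form of the cocycle condition. -/
theorem IsDrinfeldTwist.cocycle_inv {F : (A ⊗[R] A)ˣ} (hF : IsDrinfeldTwist H (F : A ⊗[R] A)) :
    Algebra.TensorProduct.assoc R R R A A A
      (Algebra.TensorProduct.map H.comul (.id R A) (↑F⁻¹ : A ⊗[R] A) *
        (↑F⁻¹ : A ⊗[R] A) ⊗ₜ[R] (1 : A)) =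
    Algebra.TensorProduct.map (.id R A) H.comul (↑F⁻¹ : A ⊗[R] A) *
      (1 : A) ⊗ₜ[R] (↑F⁻¹ : A ⊗[R] A) := by
  refine left_inv_eq_right_inv
    (a := Algebra.TensorProduct.assoc R R R A A A ((F : A ⊗[R] A) ⊗ₜ[R] (1 : A) *
      Algebra.TensorProduct.map H.comul (.id R A) (F : A ⊗[R] A))) ?_ ?_
  · rw [← map_mul, mul_assoc, ← mul_assoc (_ ⊗ₜ (1 : A)), Algebra.TensorProduct.tmul_mul_tmul,
      Units.inv_mul, one_mul, ← Algebra.TensorProduct.one_def, one_mul, ← map_mul, Units.inv_mul,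
      map_one, map_one]
  · rw [hF.cocycle, mul_assoc, ← mul_assoc (Algebra.TensorProduct.map _ _ _), ← map_mul]
    simp [← Algebra.TensorProduct.one_def]

/-- The twist of a Hopf algebra structure by a Drinfel'd twist. -/
def HopfStructure.twist (hS : ∀ a b, H.antipode (a * b) = H.antipode b * H.antipode a)
    (F : (A ⊗[R] A)ˣ) (hF : IsDrinfeldTwist H (F : A ⊗[R] A)) (w : Aˣ)
    (hw : sandwichRight H.antipode 1 (F : A ⊗[R] A) = w)
    (hw' : sandwichLeft H.antipode 1 (↑F⁻¹ : A ⊗[R] A) = ↑w⁻¹) : HopfStructure R A where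
  comul := (conjAlgHom F).comp H.comul
  counit := H.counit
  antipode := (conjAlgHom (R := R) w).toLinearMap ∘ₗ H.antipode
  coassoc := by
    refine AlgHom.ext fun a => ?_
    have h := AlgHom.congr_fun H.coassoc a
    simp only [AlgHom.comp_apply, AlgEquiv.toAlgHom_apply] at h ⊢
    rw [map_conj_left, map_conj_right, conjAlgHom_apply]
    simp only [map_mul]
    -- The two sides are the iterated coproducts of the old structure, conjugated by the two sides
    -- of the cocycle identity.
    have h1 := hF.cocycle
    have h2 := hF.cocycle_inv
    rw [map_mul] at h1 h2
    simp only [mul_assoc]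
    rw [h2, ← h]
    simp only [← mul_assoc]
    rw [h1]
  counit_left := by
    refine AlgHom.ext fun a => ?_
    have h := AlgHom.congr_fun H.counit_left a
    set φ : A ⊗[R] A →ₐ[R] A := (Algebra.TensorProduct.lid R A).toAlgHom.comp
      (Algebra.TensorProduct.map H.counit (.id R A)) with hφ
    have h1 : φ (F : A ⊗[R] A) = 1 := hF.counit_left
    have h2 : φ (↑F⁻¹ : A ⊗[R] A) = 1 := by
      have := map_mul φ (F : A ⊗[R] A) (↑F⁻¹ : A ⊗[R] A)
      rwa [h1, one_mul, Units.mul_inv, map_one, eq_comm] at this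
    have h3 : φ (H.comul a) = a := by
      rw [hφ, AlgHom.comp_apply]
      exact (congrArg (Algebra.TensorProduct.lid R A) h).trans
        ((Algebra.TensorProduct.lid R A).apply_symm_apply a)
    apply (Algebra.TensorProduct.lid R A).injective
    refine Eq.trans (b := φ (F * H.comul a * ↑F⁻¹)) (by simp [hφ]) ?_
    rw [map_mul, map_mul, h1, h2, h3, one_mul, mul_one]
    exact ((Algebra.TensorProduct.lid R A).apply_symm_apply a).symm
  counit_right := by
    refine AlgHom.ext fun a => ?_
    have h := AlgHom.congr_fun H.counit_right a
    set φ : A ⊗[R] A →ₐ[R] A := (Algebra.TensorProduct.rid R R A).toAlgHom.comp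
      (Algebra.TensorProduct.map (.id R A) H.counit) with hφ
    have h1 : φ (F : A ⊗[R] A) = 1 := hF.counit_right
    have h2 : φ (↑F⁻¹ : A ⊗[R] A) = 1 := by
      have := map_mul φ (F : A ⊗[R] A) (↑F⁻¹ : A ⊗[R] A)
      rwa [h1, one_mul, Units.mul_inv, map_one, eq_comm] at this
    have h3 : φ (H.comul a) = a := by
      rw [hφ, AlgHom.comp_apply]
      exact (congrArg (Algebra.TensorProduct.rid R R A) h).trans
        ((Algebra.TensorProduct.rid R R A).apply_symm_apply a)
    apply (Algebra.TensorProduct.rid R R A).injective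
    refine Eq.trans (b := φ (F * H.comul a * ↑F⁻¹)) (by simp [hφ]) ?_
    rw [map_mul, map_mul, h1, h2, h3, one_mul, mul_one]
    exact ((Algebra.TensorProduct.rid R R A).apply_symm_apply a).symm
  antipode_left := by
    refine LinearMap.ext fun a => ?_
    have h : LinearMap.mul' R A ∘ₗ
        ((conjAlgHom (R := R) w).toLinearMap ∘ₗ H.antipode).rTensor A =
        LinearMap.mulLeft R (w : A) ∘ₗ sandwichLeft H.antipode (↑w⁻¹ : A) := by
      ext; simp [mul_assoc]
    -- w⁻¹ is the result of F⁻¹ acting on 1, so the further action of F gives back 1. Then Δ(a) and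
    -- F⁻¹ lead to ε(a) w⁻¹, and the outer factor w cancels.
    have h1 : sandwichLeft H.antipode (↑w⁻¹ : A) (F : A ⊗[R] A) = 1 := by
      rw [← hw', ← sandwichLeft_mul hS]
      simp [Algebra.TensorProduct.one_def, H.antipode_one]
    rw [← LinearMap.comp_assoc, h]
    simp only [LinearMap.comp_apply, AlgHom.toLinearMap_apply, AlgHom.comp_apply,
      conjAlgHom_apply, LinearMap.mulLeft_apply, Algebra.linearMap_apply]
    rw [sandwichLeft_mul hS, sandwichLeft_mul hS, h1, H.sandwichLeft_comul,
      Algebra.algebraMap_eq_smul_one, sandwichLeft_smul, hw', mul_smul_comm, Units.mul_inv]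
  antipode_right := by
    refine LinearMap.ext fun a => ?_
    have h : LinearMap.mul' R A ∘ₗ
        ((conjAlgHom (R := R) w).toLinearMap ∘ₗ H.antipode).lTensor A =
        LinearMap.mulRight R (↑w⁻¹ : A) ∘ₗ sandwichRight H.antipode (w : A) := by
      ext; simp [mul_assoc]
    have h1 : sandwichRight H.antipode (w : A) (↑F⁻¹ : A ⊗[R] A) = 1 := by
      rw [← hw, ← sandwichRight_mul hS]
      simp [Algebra.TensorProduct.one_def, H.antipode_one]
    rw [← LinearMap.comp_assoc, h]
    simp only [LinearMap.comp_apply, AlgHom.toLinearMap_apply, AlgHom.comp_apply,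
      conjAlgHom_apply, LinearMap.mulRight_apply, Algebra.linearMap_apply]
    rw [sandwichRight_mul hS, h1, sandwichRight_mul hS, H.sandwichRight_comul,
      Algebra.algebraMap_eq_smul_one, sandwichRight_smul, hw, smul_mul_assoc, Units.mul_inv]

end Twist

/-! ### Products of Drinfel'd twists -/

section DrinfeldProduct
variable {R A : Type*} [CommRing R] [Ring A] [Algebra R A] {H : HopfStructure R A}

/-- In the cocycle expression of F F' the factor F'⊗1 must pass (Δ⊗id)F on one side, and (id⊗Δ)F
must pass 1⊗F' on the other. The two commutation hypotheses are exactly these exchanges. -/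
theorem IsDrinfeldTwist.mul {F F' : A ⊗[R] A} (hF : IsDrinfeldTwist H F)
    (hF' : IsDrinfeldTwist H F')
    (h₁ : Commute (F' ⊗ₜ[R] (1 : A)) (Algebra.TensorProduct.map H.comul (.id R A) F))
    (h₂ : Commute ((1 : A) ⊗ₜ[R] F') (Algebra.TensorProduct.map (.id R A) H.comul F)) :
    IsDrinfeldTwist H (F * F') where
  isUnit := hF.isUnit.mul hF'.isUnit
  cocycle := by
    have e₁ : (F * F') ⊗ₜ[R] (1 : A) = F ⊗ₜ[R] (1 : A) * F' ⊗ₜ[R] (1 : A) := by simp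
    have e₂ : (1 : A) ⊗ₜ[R] (F * F') = (1 : A) ⊗ₜ[R] F * (1 : A) ⊗ₜ[R] F' := by simp
    rw [e₁, e₂, map_mul (Algebra.TensorProduct.map _ _), map_mul (Algebra.TensorProduct.map _ _), mul_assoc (F ⊗ₜ[R] (1 : A)), ← mul_assoc (F' ⊗ₜ[R] (1 : A)),
      h₁.eq, mul_assoc, ← mul_assoc (F ⊗ₜ[R] (1 : A)), map_mul, hF.cocycle, hF'.cocycle,
      mul_assoc, ← mul_assoc _ ((1 : A) ⊗ₜ[R] F'), ← h₂.eq]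
    simp only [mul_assoc]
  counit_left := by rw [map_mul, map_mul, hF.counit_left, hF'.counit_left, one_mul]
  counit_right := by rw [map_mul, map_mul, hF.counit_right, hF'.counit_right, one_mul]

end DrinfeldProduct

/-! ### The twist (1 - 1⊗T)^(h⊗1) attached to one pair (h, T) -/

section Vertical
variable {𝒦 : Type*} [Field 𝒦] {p : ℕ} [Fact p.Prime] [CharP 𝒦 p]
variable {R A : Type*} [CommRing R] [Algebra 𝒦 R] [Ring A] [Algebra R A] [Algebra 𝒦 A]
  [IsScalarTower 𝒦 R A] {H : HopfStructure R A}

/-- Primitive elements `h`, `T` with `[h, T] = T`, `h ^ p = h` and `T ^ p = 0`. -/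
structure VerticalPair (p : ℕ) (H : HopfStructure R A) (h T : A) : Prop where
  comul_h : H.comul h = h ⊗ₜ 1 + 1 ⊗ₜ h
  comul_T : H.comul T = T ⊗ₜ 1 + 1 ⊗ₜ T
  antipode_h : H.antipode h = -h
  antipode_T : H.antipode T = -T
  counit_h : H.counit h = 0
  counit_T : H.counit T = 0
  shift : h * T = T * (h + 1)
  pow_h : h ^ p = h
  pow_T : T ^ p = 0

/-- `(1 - 1 ⊗ T) ^ (h ⊗ 1)`. -/
abbrev vTwist (𝒦 : Type*) [Field 𝒦] (p : ℕ) (R : Type*) [CommRing R] [Algebra 𝒦 R] {A : Type*}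
    [Ring A] [Algebra R A] [Algebra 𝒦 A] [IsScalarTower 𝒦 R A] (h T : A) : A ⊗[R] A :=
  fpow 𝒦 p (h ⊗ₜ[R] 1) (1 ⊗ₜ[R] T)

theorem falling_neg_eq_zero (𝒦 : Type*) [Field 𝒦] (p : ℕ) [Fact p.Prime] [CharP 𝒦 p] {A : Type*}
    [Ring A] [Algebra 𝒦 A] {x : A} (hx : x ^ p = x) : falling (-x) p = 0 := by
  rcases subsingleton_or_nontrivial A with _ | _
  · exact Subsingleton.elim _ _
  have : CharP A p := charP_of_injective_algebraMap (algebraMap 𝒦 A).injective p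
  rw [falling_char 𝒦 p, neg_pow, hx, neg_one_pow_char A p]
  simp

theorem commute_tmul {B C : Type*} [Ring B] [Algebra R B] [Ring C] [Algebra R C] {a b : B} {c d : C}
    (h : Commute a b) (h' : Commute c d) : Commute (a ⊗ₜ[R] c) (b ⊗ₜ[R] d) := by
  rw [commute_iff_eq, Algebra.TensorProduct.tmul_mul_tmul, Algebra.TensorProduct.tmul_mul_tmul,
    h.eq, h'.eq]

theorem commute_vTwist {h T a b : A} (ha : Commute h a) (hb : Commute T b) :
    Commute (vTwist 𝒦 p R h T) (a ⊗ₜ[R] b) :=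
  Commute.fpow_left (commute_tmul ha (Commute.one_left _)) (commute_tmul (Commute.one_left _) hb)

theorem falling_tmul (h : A) (r : ℕ) : falling (h ⊗ₜ[R] (1 : A)) r = falling h r ⊗ₜ[R] (1 : A) :=
  (map_falling (Algebra.TensorProduct.includeLeft : A →ₐ[R] A ⊗[R] A).toRingHom h r).symm

theorem vTwist_eq (h T : A) : vTwist 𝒦 p R h T = ∑ r ∈ Finset.range p,
    ((-1) ^ r * (r.factorial : 𝒦)⁻¹) • (falling h r ⊗ₜ[R] (T ^ r)) := by
  unfold vTwist fpow
  refine Finset.sum_congr rfl fun r _ => ?_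
  rw [falling_tmul, Algebra.TensorProduct.tmul_pow, one_pow, Algebra.TensorProduct.tmul_mul_tmul,
    mul_one, one_mul]

variable {h T : A} (hv : VerticalPair p H h T)
include hv

theorem VerticalPair.pow_one_tmul : ((1 : A) ⊗ₜ[R] T) ^ p = 0 := by
  rw [Algebra.TensorProduct.tmul_pow, hv.pow_T, TensorProduct.tmul_zero]

theorem VerticalPair.inv_mul :
    fpow 𝒦 p (-(h ⊗ₜ[R] (1 : A))) ((1 : A) ⊗ₜ[R] T) * vTwist 𝒦 p R h T = 1 :=
  fpow_neg_mul (commute_tmul (Commute.one_right _) (Commute.one_left _)) hv.pow_one_tmul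

theorem VerticalPair.mul_inv :
    vTwist 𝒦 p R h T * fpow 𝒦 p (-(h ⊗ₜ[R] (1 : A))) ((1 : A) ⊗ₜ[R] T) = 1 :=
  fpow_mul_neg (commute_tmul (Commute.one_right _) (Commute.one_left _)) hv.pow_one_tmul

theorem VerticalPair.map_comul_left : Algebra.TensorProduct.map H.comul (.id R A)
    (vTwist 𝒦 p R h T) =
    fpow 𝒦 p ((h ⊗ₜ[R] (1 : A) + 1 ⊗ₜ[R] h) ⊗ₜ[R] (1 : A)) ((1 : A ⊗[R] A) ⊗ₜ[R] T) := by
  have := map_fpow (p := p)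
    ((Algebra.TensorProduct.map H.comul (.id R A)).restrictScalars 𝒦) (h ⊗ₜ[R] (1 : A)) (1 ⊗ₜ[R] T)
  simpa [hv.comul_h] using this

theorem VerticalPair.map_comul_right : Algebra.TensorProduct.map (.id R A) H.comul
    (vTwist 𝒦 p R h T) =
    fpow 𝒦 p (h ⊗ₜ[R] (1 : A ⊗[R] A)) ((1 : A) ⊗ₜ[R] (T ⊗ₜ[R] (1 : A) + 1 ⊗ₜ[R] T)) := by
  have := map_fpow (p := p)
    ((Algebra.TensorProduct.map (.id R A) H.comul).restrictScalars 𝒦) (h ⊗ₜ[R] (1 : A)) (1 ⊗ₜ[R] T)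
  simpa [hv.comul_T] using this

omit hv in
theorem vTwist_tmul_one : vTwist 𝒦 p R h T ⊗ₜ[R] (1 : A) =
    fpow 𝒦 p ((h ⊗ₜ[R] (1 : A)) ⊗ₜ[R] (1 : A)) (((1 : A) ⊗ₜ[R] T) ⊗ₜ[R] (1 : A)) :=
  map_fpow (p := p) ((Algebra.TensorProduct.includeLeft : A ⊗[R] A →ₐ[R] (A ⊗[R] A) ⊗[R] A).restrictScalars 𝒦)
    (h ⊗ₜ[R] (1 : A)) (1 ⊗ₜ[R] T)

omit hv in
theorem one_tmul_vTwist : (1 : A) ⊗ₜ[R] vTwist 𝒦 p R h T =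
    fpow 𝒦 p ((1 : A) ⊗ₜ[R] (h ⊗ₜ[R] (1 : A))) ((1 : A) ⊗ₜ[R] ((1 : A) ⊗ₜ[R] T)) :=
  map_fpow (p := p) ((Algebra.TensorProduct.includeRight : A ⊗[R] A →ₐ[R] A ⊗[R] (A ⊗[R] A)).restrictScalars 𝒦)
    (h ⊗ₜ[R] (1 : A)) (1 ⊗ₜ[R] T)

theorem VerticalPair.isDrinfeldTwist : IsDrinfeldTwist H (vTwist 𝒦 p R h T) where
  isUnit := ⟨⟨_, _, hv.mul_inv, hv.inv_mul⟩, rfl⟩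
  cocycle := by
    rw [hv.map_comul_left, hv.map_comul_right, vTwist_tmul_one, one_tmul_vTwist]
    have e := map_fpow (p := p) (𝒦 := 𝒦)
      ((Algebra.TensorProduct.assoc R R R A A A).toAlgHom.restrictScalars 𝒦)
    simp only [AlgHom.restrictScalars_apply, AlgEquiv.toAlgHom_apply] at e
    rw [map_mul, e, e]
    simp only [TensorProduct.add_tmul, TensorProduct.tmul_add, map_add,
      Algebra.TensorProduct.assoc_tmul, Algebra.TensorProduct.one_def]
    -- Here X = h⊗1⊗1, Y = 1⊗h⊗1, T₂ = 1⊗T⊗1 and T₃ = 1⊗1⊗T.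
    refine fpow_cocycle ?_ ?_ ?_ ?_ ?_ ?_ ?_
    · simp [commute_iff_eq]
    · simp [commute_iff_eq]
    · simp [commute_iff_eq]
    · simp [commute_iff_eq]
    · simp [mul_add, ← TensorProduct.tmul_add, ← TensorProduct.add_tmul, hv.shift]
    · simp [Algebra.TensorProduct.tmul_pow, hv.pow_T]
    · rw [falling_char 𝒦 p]
      simp [Algebra.TensorProduct.tmul_pow, hv.pow_h]
  counit_left := by
    have := map_fpow (p := p) (((Algebra.TensorProduct.lid R A).toAlgHom.comp
      (Algebra.TensorProduct.map H.counit (.id R A))).restrictScalars 𝒦) (h ⊗ₜ[R] (1 : A)) (1 ⊗ₜ[R] T)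
    refine this.trans ?_
    simp [hv.counit_h, fpow_zero_left]
  counit_right := by
    have := map_fpow (p := p) (((Algebra.TensorProduct.rid R R A).toAlgHom.comp
      (Algebra.TensorProduct.map (.id R A) H.counit)).restrictScalars 𝒦) (h ⊗ₜ[R] (1 : A)) (1 ⊗ₜ[R] T)
    refine this.trans ?_
    simp [hv.counit_T, fpow_zero_right]

theorem VerticalPair.fpow_int_tmul (g : Aˣ) (hg : (g : A) = 1 - T) (z : ℤ) :
    fpow 𝒦 p ((z : A ⊗[R] A)) ((1 : A) ⊗ₜ[R] T) = 1 ⊗ₜ[R] ((g ^ z : Aˣ) : A) := by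
  have := map_fpow (p := p) (𝒦 := 𝒦)
    ((Algebra.TensorProduct.includeRight : A →ₐ[R] A ⊗[R] A).restrictScalars 𝒦) (z : A) T
  rw [fpow_int hv.pow_T g hg, map_intCast] at this
  exact this.symm

/-- The element a⊗1 shifts the exponent h⊗1 by the weight z of a, and the surplus (1 - 1⊗T)^z is an
integer power. This yields the first summand of the coproduct. -/
theorem VerticalPair.mul_tmul_one (g : Aˣ) (hg : (g : A) = 1 - T) {a : A} {z : ℤ}
    (ha : h * a = a * (h + z)) : vTwist 𝒦 p R h T * (a ⊗ₜ[R] 1) =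
      (a ⊗ₜ[R] ((g ^ z : Aˣ) : A)) * vTwist 𝒦 p R h T := by
  rw [vTwist, fpow_mul_weight (l := (z : A ⊗[R] A)), hv.fpow_int_tmul g hg,
    Algebra.TensorProduct.tmul_mul_tmul, mul_one, one_mul]
  · rw [mul_add, ← (Int.cast_commute z _).eq, ← zsmul_eq_mul]
    simp [ha, mul_add, TensorProduct.add_tmul, ← (Int.cast_commute z a).eq, ← zsmul_eq_mul,
      TensorProduct.smul_tmul']
  · simp [commute_iff_eq]
  · simp [commute_iff_eq]
  · exact (Int.cast_commute z _).symm
  · exact hv.pow_one_tmul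

omit hv in
theorem divAd_one_tmul (T b : A) (m : ℕ) :
    divAd 𝒦 ((1 : A) ⊗ₜ[R] T) m (1 ⊗ₜ[R] b) = 1 ⊗ₜ[R] divAd 𝒦 T m b := by
  unfold divAd
  rw [← algebraMap_smul R ((m.factorial : 𝒦)⁻¹), ← algebraMap_smul R ((m.factorial : 𝒦)⁻¹),
    TensorProduct.tmul_smul]
  congr 1
  induction m with
  | zero => rfl
  | succ m ih =>
    rw [Function.iterate_succ_apply', Function.iterate_succ_apply', ih]
    simp [TensorProduct.tmul_sub]

omit hv in
theorem divAd_smul (t : R) (e b : A) (m : ℕ) : divAd 𝒦 (t • e) m b = t ^ m • divAd 𝒦 e m b := by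
  unfold divAd
  rw [← algebraMap_smul R ((m.factorial : 𝒦)⁻¹), ← algebraMap_smul R ((m.factorial : 𝒦)⁻¹),
    smul_comm]
  congr 1
  induction m with
  | zero => simp
  | succ m ih =>
    rw [Function.iterate_succ_apply', Function.iterate_succ_apply', ih]
    simp [smul_sub, smul_smul, pow_succ, mul_comm]

/-- The case X = h⊗1, E = 1⊗T of `fpow_mul_eq_sum`. The rising factorials and signs of the coproduct
formula come from (-h)^[m] = (-1)^m h^⟨m⟩. -/
theorem VerticalPair.mul_one_tmul (g : Aˣ) (hg : (g : A) = 1 - T) (b : A) :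
    vTwist 𝒦 p R h T * (1 ⊗ₜ[R] b) =
      (∑ m ∈ Finset.range p, (-1 : R) ^ m •
        (rising h m ⊗ₜ[R] (((g ^ (-(m : ℤ)) : Aˣ) : A) * divAd 𝒦 T m b))) *
        vTwist 𝒦 p R h T := by
  have h1 : (h ⊗ₜ[R] (1 : A)) ^ p = h ⊗ₜ[R] (1 : A) := by
    rw [Algebra.TensorProduct.tmul_pow, hv.pow_h, one_pow]
  rw [vTwist, fpow_mul_eq_sum (commute_tmul (Commute.one_right _) (Commute.one_left _))
    (commute_tmul (Commute.one_right _) (Commute.one_left _)) hv.pow_one_tmul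
    (falling_neg_eq_zero 𝒦 p h1)]
  congr 1
  refine Finset.sum_congr rfl fun m _ => ?_
  have h2 := hv.fpow_int_tmul (𝒦 := 𝒦) g hg (-(m : ℤ))
  rw [Int.cast_neg, Int.cast_natCast] at h2
  have h3 : falling (-(h ⊗ₜ[R] (1 : A))) m = (-1 : R) ^ m • (rising h m ⊗ₜ[R] (1 : A)) := by
    rw [rising_eq_falling, ← TensorProduct.neg_tmul, falling_tmul, TensorProduct.smul_tmul']
    congr 1
    rcases Nat.even_or_odd m with hm | hm <;> simp [hm.neg_one_pow]
  rw [h2, divAd_one_tmul, h3, smul_mul_assoc]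
  simp

theorem VerticalPair.antipode_pow (hS : ∀ a b, H.antipode (a * b) = H.antipode b * H.antipode a)
    (r : ℕ) : H.antipode (T ^ r) = (-T) ^ r := by
  induction r with
  | zero => simpa using H.antipode_one
  | succ r ih => rw [pow_succ, hS, ih, hv.antipode_T, pow_succ']

theorem VerticalPair.antipode_falling_neg
    (hS : ∀ a b, H.antipode (a * b) = H.antipode b * H.antipode a)
    (r : ℕ) : H.antipode (falling (-h) r) = falling h r := by
  have hc : ∀ m : ℕ, H.antipode (m : A) = m := fun m => by
    rw [← nsmul_one, map_nsmul, H.antipode_one]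
  induction r with
  | zero => simpa [falling] using H.antipode_one
  | succ r ih =>
    rw [falling, hS, ih, map_sub, map_neg, hv.antipode_h, neg_neg, hc, falling]
    exact (Commute.falling_left ((Commute.refl h).sub_right (Nat.cast_commute r h).symm) r).symm

/-- The antipode replaces T^r by (-T)^r, so c = 1 gives w = m(id⊗S)F. Allowing c different from 1
makes it possible to apply the statement to two twists in succession. -/
theorem VerticalPair.sandwichRight
    (hS : ∀ a b, H.antipode (a * b) = H.antipode b * H.antipode a) {c : A} (hc : Commute c T) :
    ContactHopf.sandwichRight H.antipode c (vTwist 𝒦 p R h T) = fpow 𝒦 p h (-T) * c := by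
  rw [vTwist_eq, map_sum, fpow, Finset.sum_mul]
  refine Finset.sum_congr rfl fun r _ => ?_
  rw [← algebraMap_smul R ((-1 : 𝒦) ^ r * _), ← algebraMap_smul R ((-1 : 𝒦) ^ r * _), map_smul,
    sandwichRight_tmul, hv.antipode_pow hS, smul_mul_assoc, mul_assoc, mul_assoc,
    (hc.neg_right.pow_right r).eq]

theorem VerticalPair.sandwichLeft
    (hS : ∀ a b, H.antipode (a * b) = H.antipode b * H.antipode a) {c : A} (hc : Commute c T) :
    ContactHopf.sandwichLeft H.antipode c
      (fpow 𝒦 p (-(h ⊗ₜ[R] (1 : A))) ((1 : A) ⊗ₜ[R] T)) = fpow 𝒦 p h T * c := by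
  rw [← TensorProduct.neg_tmul, ← vTwist, vTwist_eq, map_sum, fpow, Finset.sum_mul]
  refine Finset.sum_congr rfl fun r _ => ?_
  rw [← algebraMap_smul R ((-1 : 𝒦) ^ r * _), ← algebraMap_smul R ((-1 : 𝒦) ^ r * _), map_smul,
    sandwichLeft_tmul, hv.antipode_falling_neg hS, smul_mul_assoc, mul_assoc, mul_assoc,
    (hc.pow_right r).eq]

theorem VerticalPair.w_mul : fpow 𝒦 p h (-T) * fpow 𝒦 p h T = 1 :=
  fpow_neg_mul_fpow hv.shift hv.pow_T

/-- The relation h T = T (h + 1) and the nilpotency of T are unchanged under T ↦ -T, so the other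
one-sided inverse comes from the same lemma. -/
theorem VerticalPair.mul_w : fpow 𝒦 p h T * fpow 𝒦 p h (-T) = 1 := by
  have := fpow_neg_mul_fpow (𝒦 := 𝒦) (p := p) (h := h) (T := -T)
    (by rw [mul_neg, hv.shift, neg_mul]) (by rw [neg_pow, hv.pow_T, mul_zero])
  rwa [neg_neg] at this

/-- The sum formula applies to the exponent h - z instead of h. The difference is a factor (1 - T)^z
on the left by `zpow_mul_fpow`, and it is moved to the other side. -/
theorem VerticalPair.w_mul_eq (g : Aˣ) (hg : (g : A) = 1 - T) {a : A} {z : ℤ}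
    (ha : h * a = a * (h + z)) :
    fpow 𝒦 p h (-T) * a = ((g ^ (-z) : Aˣ) : A) *
      (∑ m ∈ Finset.range p, divAd 𝒦 T m a * rising (h + 1) m) * fpow 𝒦 p h (-T) := by
  have h1 := fpow_sub_mul_eq_sum (𝒦 := 𝒦) (p := p) hv.shift ha (fun b => Int.cast_commute z b)
    (falling_sub_int 𝒦 p hv.pow_h z)
  rw [← zpow_mul_fpow hv.shift hv.pow_T g hg z] at h1
  rw [mul_assoc, ← h1, zpow_neg, mul_assoc, Units.inv_mul_cancel_left]

end Vertical

/-! ### Two commuting vertical twists: coproduct and antipode formulas -/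

section TwoTwists
variable {𝒦 : Type*} [Field 𝒦] {p : ℕ} [Fact p.Prime] [CharP 𝒦 p]
variable {R A : Type*} [CommRing R] [Algebra 𝒦 R] [Ring A] [Algebra R A] [Algebra 𝒦 A]
  [IsScalarTower 𝒦 R A] {H : HopfStructure R A} {h T h' T' : A}

/-- T has weight 0 for h here, so its divided adjoint powers preserve the weight. This is what
allows the twist of the first pair to be moved across the terms created by the second. -/
theorem mul_divAd_of_commute {a l : A} (hT : Commute h T) (ha : h * a = a * (h + l))
    (hlT : Commute l T) (m : ℕ) : h * divAd 𝒦 T m a = divAd 𝒦 T m a * (h + l) := by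
  unfold divAd
  rw [mul_smul_comm, smul_mul_assoc]
  congr 1
  induction m with
  | zero => simpa using ha
  | succ m ih =>
    rw [Function.iterate_succ_apply']
    generalize (fun y => T * y - y * T)^[m] a = d at ih ⊢
    rw [mul_sub, sub_mul, ← mul_assoc, hT.eq, mul_assoc, ih, ← mul_assoc h, ih, mul_assoc d,
      (hT.add_left hlT).eq]
    simp only [mul_assoc]

theorem commute_vTwist_vTwist (hh : Commute h h') (hT : Commute T T') :
    Commute (vTwist 𝒦 p R h T) (vTwist 𝒦 p R h' T') :=
  (Commute.fpow_left (commute_vTwist hh (Commute.one_right _)).symm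
    (commute_vTwist (Commute.one_right _) hT).symm).symm

variable (hv : VerticalPair p H h T) (hv' : VerticalPair p H h' T')
  (hh : Commute h h') (hT : Commute T T') (h₁ : Commute h T') (h₂ : Commute T h')
include hv hv' hh hT h₁ h₂

theorem isDrinfeldTwist_mul :
    IsDrinfeldTwist H (vTwist 𝒦 p R h T * vTwist 𝒦 p R h' T') := by
  refine hv.isDrinfeldTwist.mul hv'.isDrinfeldTwist ?_ ?_
  · rw [hv.map_comul_left, vTwist_tmul_one]
    refine Commute.fpow_left (Commute.fpow_left ?_ ?_).symm (Commute.fpow_left ?_ ?_).symm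
    all_goals simp [commute_iff_eq, TensorProduct.add_tmul, add_mul, mul_add, hh.eq, h₁.eq]
  · rw [hv.map_comul_right, one_tmul_vTwist]
    refine Commute.fpow_left (Commute.fpow_left ?_ ?_).symm (Commute.fpow_left ?_ ?_).symm
    all_goals simp [commute_iff_eq, TensorProduct.tmul_add, add_mul, mul_add, hT.eq, h₂.eq]

/-- The two twists as a unit. -/
def vTwistUnit : (A ⊗[R] A)ˣ where
  val := vTwist 𝒦 p R h T * vTwist 𝒦 p R h' T'
  inv := fpow 𝒦 p (-(h' ⊗ₜ[R] (1 : A))) ((1 : A) ⊗ₜ[R] T') *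
    fpow 𝒦 p (-(h ⊗ₜ[R] (1 : A))) ((1 : A) ⊗ₜ[R] T)
  val_inv := by
    rw [mul_assoc, ← mul_assoc (vTwist 𝒦 p R h' T'), hv'.mul_inv, one_mul, hv.mul_inv]
  inv_val := by
    rw [mul_assoc, ← mul_assoc _ (vTwist 𝒦 p R h T), hv.inv_mul, one_mul, hv'.inv_mul]

/-- The element `m (id ⊗ S) F` of the two twists. -/
def antipodeUnit : Aˣ where
  val := fpow 𝒦 p h (-T) * fpow 𝒦 p h' (-T')
  inv := fpow 𝒦 p h T * fpow 𝒦 p h' T'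
  val_inv := by
    have : Commute (fpow 𝒦 p h' (-T')) (fpow 𝒦 p h T) :=
      Commute.fpow_left (Commute.fpow_left hh h₂).symm (Commute.fpow_left h₁ hT).neg_right.symm
    rw [mul_assoc, ← mul_assoc (fpow 𝒦 p h' (-T')), this.eq, mul_assoc, hv'.w_mul, mul_one,
      hv.w_mul]
  inv_val := by
    have : Commute (fpow 𝒦 p h' T') (fpow 𝒦 p h (-T)) :=
      Commute.fpow_left (Commute.fpow_left hh h₂.neg_left).symm
        (Commute.fpow_left h₁ hT.neg_left).symm
    rw [mul_assoc, ← mul_assoc (fpow 𝒦 p h' T'), this.eq, mul_assoc, hv'.mul_w, mul_one,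
      hv.mul_w]

variable (hS : ∀ a b, H.antipode (a * b) = H.antipode b * H.antipode a)
include hS

/-- The twist of `H` by two commuting vertical twists. -/
def verticalHopf : HopfStructure R A :=
  H.twist hS (vTwistUnit (𝒦 := 𝒦) hv hv') (isDrinfeldTwist_mul hv hv' hh hT h₁ h₂)
    (antipodeUnit (𝒦 := 𝒦) hv hv' hh hT h₁ h₂)
    (by
      simp only [vTwistUnit, antipodeUnit]
      rw [sandwichRight_mul hS, hv'.sandwichRight hS (Commute.one_left _), mul_one, hv.sandwichRight hS]
      exact Commute.fpow_left h₂.symm hT.symm.neg_left)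
    (by
      simp only [vTwistUnit, antipodeUnit, Units.inv_mk]
      rw [sandwichLeft_mul hS, hv'.sandwichLeft hS (Commute.one_left _), mul_one, hv.sandwichLeft hS]
      exact Commute.fpow_left h₂.symm hT.symm)

theorem verticalHopf_comul_mul (a : A) :
    (verticalHopf (𝒦 := 𝒦) hv hv' hh hT h₁ h₂ hS).comul a *
      (vTwist 𝒦 p R h T * vTwist 𝒦 p R h' T') =
      (vTwist 𝒦 p R h T * vTwist 𝒦 p R h' T') * H.comul a := by
  change conjAlgHom (R := R) (vTwistUnit (𝒦 := 𝒦) hv hv') (H.comul a) *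
    ((vTwistUnit (𝒦 := 𝒦) hv hv' : (A ⊗[R] A)ˣ) : A ⊗[R] A) = _
  rw [conjAlgHom_apply, Units.inv_mul_cancel_right]
  rfl

variable (g g' : Aˣ) (hg : (g : A) = 1 - T) (hg' : (g' : A) = 1 - T')
include hg hg'

theorem verticalHopf_comul {a : A} {z z' : ℤ} (ha : h * a = a * (h + z))
    (ha' : h' * a = a * (h' + z')) (hΔ : H.comul a = a ⊗ₜ 1 + 1 ⊗ₜ a) :
    (verticalHopf (𝒦 := 𝒦) hv hv' hh hT h₁ h₂ hS).comul a =
      a ⊗ₜ (((g ^ z : Aˣ) : A) * ((g' ^ z' : Aˣ) : A)) +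
      ∑ m ∈ Finset.range p, ∑ l ∈ Finset.range p, (-1 : R) ^ (l + m) •
        ((rising h' l * rising h m) ⊗ₜ (((g' ^ (-(l : ℤ)) : Aˣ) : A) *
          ((g ^ (-(m : ℤ)) : Aˣ) : A) * divAd 𝒦 T m (divAd 𝒦 T' l a))) := by
  have hunit : IsUnit (vTwist 𝒦 p R h T * vTwist 𝒦 p R h' T') :=
    (isDrinfeldTwist_mul hv hv' hh hT h₁ h₂).isUnit
  -- After cancelling the unit F F' on the right, it remains to move F' and then F across a⊗1 and
  -- 1⊗a; the inverse of F F' never has to be expanded.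
  apply hunit.mul_left_injective
  dsimp only
  rw [verticalHopf_comul_mul, hΔ, mul_add, add_mul]
  have hTg' : ∀ z : ℤ, Commute T ((g' ^ z : Aˣ) : A) :=
    fun z => Commute.units_zpow_right (by rw [hg']; exact (Commute.one_right T).sub_right hT) z
  congr 1
  · have e : (a ⊗ₜ[R] ((g' ^ z' : Aˣ) : A)) = (a ⊗ₜ[R] (1 : A)) * (1 ⊗ₜ[R] ((g' ^ z' : Aˣ) : A)) := by
      simp
    rw [mul_assoc, hv'.mul_tmul_one g' hg' ha', e, mul_assoc, ← mul_assoc,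
      hv.mul_tmul_one g hg ha, mul_assoc, ← mul_assoc _ (1 ⊗ₜ[R] ((g' ^ z' : Aˣ) : A)),
      (commute_vTwist (Commute.one_right h) (hTg' z')).eq, mul_assoc, ← mul_assoc,
      Algebra.TensorProduct.tmul_mul_tmul, mul_one]
  · rw [mul_assoc, hv'.mul_one_tmul g' hg' a, ← mul_assoc, Finset.mul_sum, Finset.sum_comm,
      ← mul_assoc]
    congr 1
    rw [Finset.sum_mul]
    refine Finset.sum_congr rfl fun l _ => ?_
    have e : rising h' l ⊗ₜ[R] (((g' ^ (-(l : ℤ)) : Aˣ) : A) * divAd 𝒦 T' l a) =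
      (rising h' l ⊗ₜ[R] ((g' ^ (-(l : ℤ)) : Aˣ) : A)) * ((1 : A) ⊗ₜ[R] divAd 𝒦 T' l a) := by simp
    rw [mul_smul_comm, e, ← mul_assoc,
      (commute_vTwist (Commute.rising_left hh.symm l).symm (hTg' _)).eq, mul_assoc,
      hv.mul_one_tmul g hg, ← mul_assoc, ← smul_mul_assoc]
    congr 1
    rw [Finset.mul_sum, Finset.smul_sum]
    refine Finset.sum_congr rfl fun m _ => ?_
    rw [mul_smul_comm, smul_smul, Algebra.TensorProduct.tmul_mul_tmul, mul_assoc, pow_add]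

theorem verticalHopf_antipode {a : A} {z z' : ℤ} (ha : h * a = a * (h + z))
    (ha' : h' * a = a * (h' + z')) (hSa : H.antipode a = -a) :
    (verticalHopf (𝒦 := 𝒦) hv hv' hh hT h₁ h₂ hS).antipode a =
      -(((g' ^ (-z') : Aˣ) : A) * ((g ^ (-z) : Aˣ) : A) *
        ∑ m ∈ Finset.range p, ∑ l ∈ Finset.range p,
          (divAd 𝒦 T m (divAd 𝒦 T' l a) * rising (h + 1) m * rising (h' + 1) l)) := by
  change conjAlgHom (R := R) (antipodeUnit (𝒦 := 𝒦) hv hv' hh hT h₁ h₂) (H.antipode a) = _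
  rw [conjAlgHom_apply, hSa, mul_neg, neg_mul]
  congr 1
  rw [Units.mul_inv_eq_iff_eq_mul]
  change fpow 𝒦 p h (-T) * fpow 𝒦 p h' (-T') * a = _ * (fpow 𝒦 p h (-T) * fpow 𝒦 p h' (-T'))
  have hw : ∀ b, Commute h b → Commute T b → Commute (fpow 𝒦 p h (-T)) b :=
    fun b hb hb' => Commute.fpow_left hb hb'.neg_left
  have hwg : Commute (fpow 𝒦 p h (-T)) ((g' ^ (-z') : Aˣ) : A) := by
    refine Commute.units_zpow_right ?_ _
    rw [hg']
    exact (Commute.one_right _).sub_right (hw _ h₁ hT)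
  -- The second twist has already replaced a by the sum over l. Each of its terms still has h-weight
  -- z, and its rising factorial in h' commutes with (1 + T)^h.
  have key : fpow 𝒦 p h (-T) *
      ∑ l ∈ Finset.range p, divAd 𝒦 T' l a * rising (h' + 1) l =
      ((g ^ (-z) : Aˣ) : A) * (∑ m ∈ Finset.range p, ∑ l ∈ Finset.range p,
          (divAd 𝒦 T m (divAd 𝒦 T' l a) * rising (h + 1) m * rising (h' + 1) l)) *
        fpow 𝒦 p h (-T) := by
    rw [Finset.sum_comm, Finset.mul_sum, Finset.mul_sum, Finset.sum_mul]
    refine Finset.sum_congr rfl fun l _ => ?_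
    rw [← mul_assoc, hv.w_mul_eq g hg (mul_divAd_of_commute h₁ ha (Int.cast_commute z T') l),
      mul_assoc _ (fpow 𝒦 p h (-T)),
      (hw _ (Commute.rising_left (hh.symm.add_left (Commute.one_left _)) l).symm
      (Commute.rising_left (h₂.symm.add_left (Commute.one_left _)) l).symm).eq]
    simp only [Finset.sum_mul, mul_assoc]
  rw [mul_assoc, hv'.w_mul_eq g' hg' ha', ← mul_assoc, ← mul_assoc, hwg.eq,
    mul_assoc _ (fpow 𝒦 p h (-T)), key]
  simp only [mul_assoc]

end TwoTwists

/-! ### Poincaré-Birkhoff-Witt: ordered monomials span -/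

section OrderedMonomials
variable {𝒦 : Type*} [Field 𝒦] {U : Type*} [Ring U] [Algebra 𝒦 U] {ι : Type*}

/-- The ordered monomial `∏ bᵢ ^ cᵢ`, the product being taken in the order of the list `l`. -/
def orderedMonomial (b : ι → U) (l : List ι) (c : ι → ℕ) : U := (l.map fun i => b i ^ c i).prod

variable (V : Submodule 𝒦 U)

/-- The filtration by degree of the subalgebra generated by `V`. -/
def degreeFiltration (s : ℕ) : Submodule 𝒦 U := (1 ⊔ V) ^ s

theorem degreeFiltration_mul (s t : ℕ) :
    degreeFiltration V s * degreeFiltration V t = degreeFiltration V (s + t) :=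
  (pow_add _ _ _).symm

theorem degreeFiltration_mono {s t : ℕ} (h : s ≤ t) : degreeFiltration V s ≤ degreeFiltration V t :=
  pow_le_pow_right₀ le_sup_left h

theorem le_degreeFiltration_one : V ≤ degreeFiltration V 1 := by
  rw [degreeFiltration, pow_one]; exact le_sup_right

theorem one_mem_degreeFiltration (s : ℕ) : (1 : U) ∈ degreeFiltration V s :=
  degreeFiltration_mono V (Nat.zero_le s) (by
    rw [degreeFiltration, pow_zero]; exact Submodule.one_le.1 le_rfl)

theorem mul_mem_degreeFiltration {s t : ℕ} {x y : U} (hx : x ∈ degreeFiltration V s)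
    (hy : y ∈ degreeFiltration V t) : x * y ∈ degreeFiltration V (s + t) := by
  rw [← degreeFiltration_mul]; exact Submodule.mul_mem_mul hx hy

theorem pow_mem_degreeFiltration {x : U} (hx : x ∈ V) (s : ℕ) : x ^ s ∈ degreeFiltration V s := by
  rw [degreeFiltration]; exact Submodule.pow_mem_pow _ (Submodule.mem_sup_right hx) s

variable {V}

theorem commutator_mem_degreeFiltration (hV : ∀ x ∈ V, ∀ y ∈ V, x * y - y * x ∈ V) {x : U}
    (hx : x ∈ V) (t : ℕ) {y : U} (hy : y ∈ degreeFiltration V t) :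
    x * y - y * x ∈ degreeFiltration V t := by
  induction t generalizing y with
  | zero =>
    rw [degreeFiltration, pow_zero] at hy
    obtain ⟨r, rfl⟩ := Submodule.mem_one.1 hy
    rw [Algebra.commutes, sub_self]
    exact Submodule.zero_mem _
  | succ t ih =>
    rw [degreeFiltration, pow_succ] at hy
    refine Submodule.mul_induction_on hy (fun a ha c hc => ?_) fun a c ha hc => ?_
    · have e : x * (a * c) - a * c * x = (x * a - a * x) * c + a * (x * c - c * x) := by noncomm_ring
      have hc' : x * c - c * x ∈ degreeFiltration V 1 := by
        obtain ⟨r, hr, v, hv, rfl⟩ := Submodule.mem_sup.1 hc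
        obtain ⟨r, rfl⟩ := Submodule.mem_one.1 hr
        have : x * (algebraMap 𝒦 U r + v) - (algebraMap 𝒦 U r + v) * x = x * v - v * x := by
          rw [mul_add, add_mul, Algebra.commutes]; abel
        rw [this]
        exact le_degreeFiltration_one V (hV x hx v hv)
      rw [e]
      exact Submodule.add_mem _
        (mul_mem_degreeFiltration V (ih ha) (by rw [degreeFiltration, pow_one]; exact hc))
        (mul_mem_degreeFiltration V ha hc')
    · have e : x * (a + c) - (a + c) * x = (x * a - a * x) + (x * c - c * x) := by noncomm_ring
      rw [e]; exact Submodule.add_mem _ ha hc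

theorem orderedMonomial_mem {b : ι → U} (hb : ∀ i, b i ∈ V) (l : List ι) (c : ι → ℕ) :
    orderedMonomial b l c ∈ degreeFiltration V (l.map c).sum := by
  induction l with
  | nil => exact one_mem_degreeFiltration V 0
  | cons i l ih => exact mul_mem_degreeFiltration V (pow_mem_degreeFiltration V (hb i) _) ih

theorem orderedMonomial_congr (b : ι → U) {l : List ι} {c d : ι → ℕ} (h : ∀ i ∈ l, c i = d i) :
    orderedMonomial b l c = orderedMonomial b l d := by
  unfold orderedMonomial
  rw [List.map_congr_left fun i hi => by rw [h i hi]]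

/-- Straightening by induction on the degree. A monomial P b_j^c Q times b_j is rewritten as P
b_j^(c+1) Q minus P b_j^c [b_j, Q]. The commutator does not raise the degree of Q, so the second
term lies one step lower in the filtration. -/
theorem degreeFiltration_le_span {p : ℕ} (hp : 2 ≤ p)
    (hV : ∀ x ∈ V, ∀ y ∈ V, x * y - y * x ∈ V) {b : ι → U}
    (hb : Submodule.span 𝒦 (Set.range b) = V) (hbp : ∀ i, b i ^ p ∈ V) {l : List ι}
    (hl : l.Nodup) (hmem : ∀ i, i ∈ l) (s : ℕ) :
    degreeFiltration V s ≤ Submodule.span 𝒦 (orderedMonomial b l ''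
      {c | (∀ i, c i < p) ∧ (l.map c).sum ≤ s}) := by
  classical
  have hbV : ∀ i, b i ∈ V := fun i => hb ▸ Submodule.subset_span ⟨i, rfl⟩
  induction s with
  | zero =>
    rw [degreeFiltration, pow_zero, Submodule.one_le]
    refine Submodule.subset_span ⟨fun _ => 0, ⟨fun _ => by dsimp only; omega, by simp⟩, ?_⟩
    simp [orderedMonomial]
  | succ s ih =>
    have hmono : Submodule.span 𝒦 (orderedMonomial b l ''
        {c | (∀ i, c i < p) ∧ (l.map c).sum ≤ s}) ≤ Submodule.span 𝒦 (orderedMonomial b l ''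
        {c | (∀ i, c i < p) ∧ (l.map c).sum ≤ s + 1}) :=
      Submodule.span_mono (Set.image_mono fun c hc => ⟨hc.1, hc.2.trans (Nat.le_succ s)⟩)
    have h1 : (1 ⊔ V : Submodule 𝒦 U) = Submodule.span 𝒦 ({1} ∪ Set.range b) := by
      rw [Submodule.span_union, hb, Submodule.one_eq_span]
    rw [degreeFiltration, pow_succ, ← degreeFiltration, h1]
    refine (mul_le_mul' ih le_rfl).trans ?_
    rw [Submodule.span_mul_span, Submodule.span_le]
    rintro _ ⟨_, ⟨c, ⟨hc, hcs⟩, rfl⟩, y, hy, rfl⟩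
    rcases hy with rfl | ⟨j, rfl⟩
    · dsimp only
      rw [mul_one]
      exact hmono (Submodule.subset_span ⟨c, ⟨hc, hcs⟩, rfl⟩)
    · obtain ⟨l₁, l₂, rfl⟩ := List.append_of_mem (hmem j)
      have hj₁ : j ∉ l₁ := fun h => by
        have := List.nodup_append.1 hl
        exact this.2.2 j h j (List.mem_cons_self) rfl
      have hj₂ : j ∉ l₂ := by
        have := (List.nodup_append.1 hl).2.1
        exact (List.nodup_cons.1 this).1
      have hprod : ∀ d, orderedMonomial b (l₁ ++ j :: l₂) d =
          orderedMonomial b l₁ d * (b j ^ d j * orderedMonomial b l₂ d) := by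
        intro d; simp [orderedMonomial]
      have hdeg : ∀ d : ι → ℕ, ((l₁ ++ j :: l₂).map d).sum =
          (l₁.map d).sum + (d j + (l₂.map d).sum) := by intro d; simp
      set P := orderedMonomial b l₁ c with hP
      set Q := orderedMonomial b l₂ c with hQ
      rw [hdeg] at hcs
      have hPm := orderedMonomial_mem hbV l₁ c
      have hQm := orderedMonomial_mem hbV l₂ c
      have e : orderedMonomial b (l₁ ++ j :: l₂) c * b j = P * (b j ^ (c j + 1) * Q) -
          P * (b j ^ c j * (b j * Q - Q * b j)) := by
        rw [hprod, ← hP, ← hQ, pow_succ]; noncomm_ring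
      dsimp only
      rw [e]
      refine Submodule.sub_mem _ ?_ ?_
      · by_cases hcj : c j + 1 < p
        · have hu₁ : ∀ i ∈ l₁, Function.update c j (c j + 1) i = c i := fun i hi =>
            Function.update_of_ne (fun h => hj₁ (by rwa [← h])) _ _
          have hu₂ : ∀ i ∈ l₂, Function.update c j (c j + 1) i = c i := fun i hi =>
            Function.update_of_ne (fun h => hj₂ (by rwa [← h])) _ _
          refine Submodule.subset_span ⟨Function.update c j (c j + 1), ⟨fun i => ?_, ?_⟩, ?_⟩
          · by_cases hij : i = j
            · subst hij; simpa using hcj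
            · rw [Function.update_of_ne hij]; exact hc i
          · rw [hdeg, Function.update_self, List.map_congr_left hu₁, List.map_congr_left hu₂]
            omega
          · rw [hprod, Function.update_self, orderedMonomial_congr b hu₁,
              orderedMonomial_congr b hu₂]
        · have hcj' : c j + 1 = p := by have := hc j; omega
          -- The exponent has reached p. Since b_j^p lies in V it counts with degree 1 instead of p
          -- ≥ 2, so the product falls into the previous filtration step.
          refine hmono (ih ?_)
          rw [hcj']
          refine degreeFiltration_mono V ?_ (mul_mem_degreeFiltration V hPm
            (mul_mem_degreeFiltration V (le_degreeFiltration_one V (hbp j)) hQm))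
          omega
      · refine hmono (ih ?_)
        refine degreeFiltration_mono V ?_ (mul_mem_degreeFiltration V hPm
            (mul_mem_degreeFiltration V (pow_mem_degreeFiltration V (hbV j) (c j))
              (commutator_mem_degreeFiltration hV (hbV j) _ hQm)))
        omega

theorem span_orderedMonomial {p : ℕ} (hp : 2 ≤ p)
    (hV : ∀ x ∈ V, ∀ y ∈ V, x * y - y * x ∈ V) {b : ι → U}
    (hb : Submodule.span 𝒦 (Set.range b) = V) (hbp : ∀ i, b i ^ p ∈ V) {l : List ι}
    (hl : l.Nodup) (hmem : ∀ i, i ∈ l) (hgen : Algebra.adjoin 𝒦 (V : Set U) = ⊤) :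
    Submodule.span 𝒦 (Set.range fun c : ι → Fin p => orderedMonomial b l fun i => c i) = ⊤ := by
  rw [eq_top_iff]
  intro x hx
  replace hx : x ∈ Algebra.adjoin 𝒦 (V : Set U) := hgen ▸ Algebra.mem_top
  obtain ⟨s, hs⟩ : ∃ s, x ∈ degreeFiltration V s := by
    induction hx using Algebra.adjoin_induction with
    | mem x hx => exact ⟨1, le_degreeFiltration_one V hx⟩
    | algebraMap r =>
      refine ⟨0, ?_⟩
      rw [degreeFiltration, pow_zero]
      exact Submodule.mem_one.2 ⟨r, rfl⟩
    | add x y _ _ hx hy =>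
      obtain ⟨s, hs⟩ := hx
      obtain ⟨t, ht⟩ := hy
      exact ⟨max s t, Submodule.add_mem _ (degreeFiltration_mono V (le_max_left s t) hs)
        (degreeFiltration_mono V (le_max_right s t) ht)⟩
    | mul x y _ _ hx hy =>
      obtain ⟨s, hs⟩ := hx
      obtain ⟨t, ht⟩ := hy
      exact ⟨s + t, mul_mem_degreeFiltration V hs ht⟩
  refine Submodule.span_mono ?_ (degreeFiltration_le_span hp hV hb hbp hl hmem s hs)
  rintro _ ⟨c, ⟨hc, _⟩, rfl⟩
  exact ⟨fun i => ⟨c i, hc i⟩, rfl⟩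

end OrderedMonomials

/-! ### Poincaré-Birkhoff-Witt: independence by leading terms of differential operators -/

section Independence
variable {𝒦 : Type*} [Field 𝒦] {A : Type*} [CommRing A] [Algebra 𝒦 A] {ι : Type*}

theorem derivation_mem_pow (D : Derivation 𝒦 A A) (I : Ideal A) (s : ℕ) {f : A}
    (hf : f ∈ I ^ (s + 1)) : D f ∈ I ^ s := by
  induction s generalizing f with
  | zero => simp
  | succ s ih =>
    rw [pow_succ] at hf
    refine Submodule.mul_induction_on hf (fun a ha c hc => ?_) fun a c ha hc => ?_
    · rw [D.leibniz, smul_eq_mul, smul_eq_mul]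
      refine Ideal.add_mem _ (Ideal.mul_mem_right _ _ ha) ?_
      rw [pow_succ']
      exact Ideal.mul_mem_mul hc (ih ha)
    · rw [map_add]; exact Ideal.add_mem _ ha hc

/-- The differential operator `D_{w₁} ⋯ D_{w_r}`. -/
def wordOp (D : ι → Derivation 𝒦 A A) (w : List ι) : Module.End 𝒦 A :=
  (w.map fun i => (D i : A →ₗ[𝒦] A)).prod

theorem wordOp_mem_pow (D : ι → Derivation 𝒦 A A) (I : Ideal A) (w : List ι) (s : ℕ) {f : A}
    (hf : f ∈ I ^ (s + w.length)) : wordOp D w f ∈ I ^ s := by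
  induction w generalizing s with
  | nil => simpa [wordOp] using hf
  | cons j w ih =>
    have : wordOp D (j :: w) f = D j (wordOp D w f) := by simp [wordOp]
    rw [this]
    refine derivation_mem_pow _ _ _ (ih (s + 1) ?_)
    rwa [List.length_cons, add_comm w.length, ← add_assoc] at hf

variable [Fintype ι] [DecidableEq ι] (D : ι → Derivation 𝒦 A A) (ε : A →ₐ[𝒦] 𝒦) (ξ : ι → A)

theorem prod_pow_mem (hξ : ∀ i, ε (ξ i) = 0) (s : Finset ι) (a : ι → ℕ) :
    ∏ i ∈ s, ξ i ^ a i ∈ RingHom.ker ε ^ (∑ i ∈ s, a i) := by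
  induction s using Finset.induction_on with
  | empty => simp
  | insert i s hi ih =>
    rw [Finset.prod_insert hi, Finset.sum_insert hi, pow_add]
    exact Ideal.mul_mem_mul (Ideal.pow_mem_pow (hξ i) _) ih

theorem derivation_prod_mem (hξ : ∀ i, ε (ξ i) = 0)
    (hD : ∀ i j, ε (D j (ξ i)) = if i = j then 1 else 0) (j : ι) (s : Finset ι) (hj : j ∉ s)
    (a : ι → ℕ) : D j (∏ i ∈ s, ξ i ^ a i) ∈ RingHom.ker ε ^ (∑ i ∈ s, a i) := by
  induction s using Finset.induction_on with
  | empty => simp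
  | insert i s hi ih =>
    rw [Finset.mem_insert, not_or] at hj
    rw [Finset.prod_insert hi, Finset.sum_insert hi, pow_add, Derivation.leibniz, smul_eq_mul,
      smul_eq_mul]
    refine Ideal.add_mem _ (Ideal.mul_mem_mul (Ideal.pow_mem_pow (hξ i) _) (ih hj.2)) ?_
    rw [mul_comm]
    refine Ideal.mul_mem_mul (prod_pow_mem ε ξ hξ s a) ?_
    rw [Derivation.leibniz_pow]
    rcases Nat.eq_zero_or_pos (a i) with h | h
    · simp [h]
    · refine Submodule.smul_of_tower_mem _ _ ?_
      have e : a i = (a i - 1) + 1 := by omega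
      have hk : RingHom.ker ε ^ a i = RingHom.ker ε ^ (a i - 1) * RingHom.ker ε := by
        rw [← pow_succ, ← e]
      rw [smul_eq_mul, hk]
      refine Ideal.mul_mem_mul (Ideal.pow_mem_pow (hξ i) _) ?_
      rw [RingHom.mem_ker, hD, if_neg (Ne.symm hj.1)]

/-- Modulo the power |a| of the ideal of the point, only differentiating a factor ξ_j counts, and
D_j ξ_j may be replaced by its value 1. If a_j = 0 the truncated subtraction is harmless, since the
coefficient a_j vanishes. -/
theorem derivation_monomial_sub_mem (hξ : ∀ i, ε (ξ i) = 0)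
    (hD : ∀ i j, ε (D j (ξ i)) = if i = j then 1 else 0) (j : ι) (a : ι → ℕ) :
    D j (∏ i, ξ i ^ a i) - (a j : 𝒦) • ∏ i, ξ i ^ (a - Pi.single j 1 : ι → ℕ) i ∈
      RingHom.ker ε ^ (∑ i, a i) := by
  set d : ι → ℕ := a - Pi.single j 1 with hd
  rw [← Finset.mul_prod_erase Finset.univ _ (Finset.mem_univ j),
    ← Finset.add_sum_erase Finset.univ _ (Finset.mem_univ j),
    ← Finset.mul_prod_erase Finset.univ (fun i => ξ i ^ d i) (Finset.mem_univ j)]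
  have e : ∏ i ∈ Finset.univ.erase j, ξ i ^ d i =
      ∏ i ∈ Finset.univ.erase j, ξ i ^ a i := by
    refine Finset.prod_congr rfl fun i hi => ?_
    rw [hd, Pi.sub_apply, Pi.single_eq_of_ne (Finset.ne_of_mem_erase hi), Nat.sub_zero]
  rw [e, Derivation.leibniz, smul_eq_mul, smul_eq_mul, Derivation.leibniz_pow, add_sub_assoc, pow_add]
  refine Ideal.add_mem _ (Ideal.mul_mem_mul (Ideal.pow_mem_pow (hξ j) _)
    (derivation_prod_mem D ε ξ hξ hD j _ (Finset.notMem_erase j _) a)) ?_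
  rw [mul_comm (ξ j ^ _), ← mul_smul_comm, ← mul_sub, mul_comm (RingHom.ker ε ^ a j)]
  refine Ideal.mul_mem_mul (prod_pow_mem ε ξ hξ _ a) ?_
  rcases Nat.eq_zero_or_pos (a j) with h | h
  · simp [h]
  · rw [hd, Pi.sub_apply, Pi.single_eq_same, ← Nat.cast_smul_eq_nsmul 𝒦, ← smul_sub]
    refine Submodule.smul_of_tower_mem _ _ ?_
    have e' : a j = (a j - 1) + 1 := by omega
    have hk : RingHom.ker ε ^ a j = RingHom.ker ε ^ (a j - 1) * RingHom.ker ε := by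
      rw [← pow_succ, ← e']
    rw [smul_eq_mul, ← mul_sub_one, hk]
    refine Ideal.mul_mem_mul (Ideal.pow_mem_pow (hξ j) _) ?_
    rw [RingHom.mem_ker, map_sub, hD, if_pos rfl, map_one, sub_self]

/-- The last letter acts first and replaces the monomial by its leading term. The error lies in the
|a|-th power of the ideal, so the remaining |a| - 1 derivations leave it vanishing at the point.
Hence only the content of the word matters, although the derivations need not commute. -/
theorem wordOp_monomial (hξ : ∀ i, ε (ξ i) = 0)
    (hD : ∀ i j, ε (D j (ξ i)) = if i = j then 1 else 0) (w : List ι) (a : ι → ℕ)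
    (hw : w.length = ∑ i, a i) : ε (wordOp D w (∏ i, ξ i ^ a i)) =
      if (fun i => w.count i) = a then ∏ i, ((a i).factorial : 𝒦) else 0 := by
  induction w using List.reverseRecOn generalizing a with
  | nil =>
    have ha : a = 0 := by
      funext i
      exact (Finset.sum_eq_zero_iff.1 hw.symm) i (Finset.mem_univ i)
    subst ha
    rw [if_pos (by ext; simp)]
    simp [wordOp]
  | append_singleton w j ih =>
    have e : ∀ f, wordOp D (w ++ [j]) f = wordOp D w (D j f) := fun f => by simp [wordOp]
    rw [List.length_append, List.length_singleton] at hw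
    have h0 := derivation_monomial_sub_mem D ε ξ hξ hD j a
    rw [← hw, add_comm] at h0
    have h1 := wordOp_mem_pow D _ w 1 h0
    rw [pow_one, RingHom.mem_ker, map_sub, map_sub, sub_eq_zero, map_smul, map_smul] at h1
    rw [e, h1]
    rcases Nat.eq_zero_or_pos (a j) with h | h
    · rw [h, Nat.cast_zero, zero_smul, if_neg]
      intro hc
      have := congrFun hc j
      simp [h] at this
    · have hsum : ∑ i, (a - Pi.single j 1 : ι → ℕ) i = (∑ i, a i) - 1 := by
        rw [← Finset.add_sum_erase Finset.univ _ (Finset.mem_univ j),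
          ← Finset.add_sum_erase Finset.univ a (Finset.mem_univ j),
          Finset.sum_congr (s₁ := Finset.univ.erase j) (g := fun i => a i) rfl fun i hi => by
            rw [Pi.sub_apply, Pi.single_eq_of_ne (Finset.ne_of_mem_erase hi), Nat.sub_zero]]
        simp only [Pi.sub_apply, Pi.single_eq_same]
        omega
      rw [ih (a - Pi.single j 1) (by omega)]
      have hiff : (fun i => w.count i) = a - Pi.single j 1 ↔ (fun i => (w ++ [j]).count i) = a := by
        rw [funext_iff, funext_iff]
        refine forall_congr' fun i => ?_
        rw [List.count_append, Pi.sub_apply]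
        by_cases hij : i = j
        · subst hij; simp; omega
        · rw [Pi.single_eq_of_ne hij, List.count_singleton]
          simp [Ne.symm hij]
      by_cases hc : (fun i => (w ++ [j]).count i) = a
      · rw [if_pos hc, if_pos (hiff.2 hc), smul_eq_mul,
          ← Finset.mul_prod_erase Finset.univ _ (Finset.mem_univ j),
          ← Finset.mul_prod_erase Finset.univ (fun i => ((a i).factorial : 𝒦)) (Finset.mem_univ j),
          Finset.prod_congr (s₁ := Finset.univ.erase j) (g := fun i => ((a i).factorial : 𝒦))
            rfl fun i hi => by
            rw [Pi.sub_apply, Pi.single_eq_of_ne (Finset.ne_of_mem_erase hi), Nat.sub_zero],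
          ← mul_assoc]
        congr 1
        rw [Pi.sub_apply, Pi.single_eq_same, ← Nat.cast_mul, Nat.mul_factorial_pred h.ne']
      · rw [if_neg hc, if_neg (fun h => hc (hiff.1 h)), smul_zero]

variable {U : Type*} [Ring U] [Algebra 𝒦 U]

/-- A relation is tested on the monomial ξ^(c₀), where c₀ has maximal degree among the nonzero
coefficients, and evaluated at the point. Shorter words give 0, and among words of equal length only
c₀ contributes, with the factor ∏ c₀ᵢ!, which is nonzero because all exponents are below p. -/
theorem linearIndependent_orderedMonomial {p : ℕ} [Fact p.Prime] [CharP 𝒦 p]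
    (hξ : ∀ i, ε (ξ i) = 0)
    (hD : ∀ i j, ε (D j (ξ i)) = if i = j then 1 else 0)
    (ρ : U →ₐ[𝒦] Module.End 𝒦 A) (b : ι → U) (hρ : ∀ i, ρ (b i) = (D i : A →ₗ[𝒦] A))
    {l : List ι} (hl : l.Nodup) (hmem : ∀ i, i ∈ l) :
    LinearIndependent 𝒦 (fun c : ι → Fin p => orderedMonomial b l fun i => c i) := by
  let word : (ι → ℕ) → List ι := fun c => l.flatMap fun i => List.replicate (c i) i
  have hword : ∀ c : ι → ℕ, ρ (orderedMonomial b l c) = wordOp D (word c) := by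
    intro c
    simp only [orderedMonomial, wordOp, word]
    clear hl hmem
    induction l with
    | nil => simp
    | cons i l ih =>
      rw [List.map_cons, List.prod_cons, map_mul, ih, List.flatMap_cons, List.map_append,
        List.prod_append, map_pow, hρ, List.map_replicate, List.prod_replicate]
  have hsum : ∀ f : ι → ℕ, (l.map f).sum = ∑ i, f i := by
    intro f
    rw [← List.sum_toFinset f hl]
    exact Finset.sum_congr (by ext i; simp [hmem i]) fun _ _ => rfl
  have hcount : ∀ (c : ι → ℕ) i, (word c).count i = c i := by
    intro c i
    simp only [word, List.count_flatMap, Function.comp_def]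
    rw [hsum]
    simp [List.count_replicate]
  have hlen : ∀ c : ι → ℕ, (word c).length = ∑ i, c i := by
    intro c
    simp only [word, List.length_flatMap, List.length_replicate]
    exact hsum c
  rw [Fintype.linearIndependent_iff]
  intro g hg
  classical
  by_contra hne
  push Not at hne
  obtain ⟨c₀, hc₀, hmax⟩ := Finset.exists_max_image (Finset.univ.filter fun c => g c ≠ 0)
    (fun c : ι → Fin p => ∑ i, (c i : ℕ)) (by
      obtain ⟨c, hc⟩ := hne
      exact ⟨c, by simpa using hc⟩)
  have hgc₀ : g c₀ ≠ 0 := by simpa using hc₀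
  have h1 := congrArg (fun u => ε (ρ u (∏ i, ξ i ^ (c₀ i : ℕ)))) hg
  simp only [map_sum, map_smul, hword, LinearMap.sum_apply, LinearMap.smul_apply, map_zero,
    LinearMap.zero_apply] at h1
  rw [Finset.sum_eq_single c₀] at h1
  · rw [wordOp_monomial D ε ξ hξ hD _ _ (hlen _), if_pos (funext (hcount _)), smul_eq_mul] at h1
    refine (mul_ne_zero hgc₀ (Finset.prod_ne_zero_iff.2 fun i _ => ?_)) h1
    exact factorial_cast_ne_zero 𝒦 p (c₀ i).2
  · intro c _ hc
    by_cases hgc : g c = 0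
    · rw [hgc, zero_smul]
    · have hle := hmax c (by simpa using hgc)
      rcases hle.lt_or_eq with h | h
      · have := wordOp_mem_pow D (RingHom.ker ε) (word fun i => c i) 1
          (f := ∏ i, ξ i ^ (c₀ i : ℕ))
          (Ideal.pow_le_pow_right (by rw [hlen]; omega) (prod_pow_mem ε ξ hξ Finset.univ fun i => (c₀ i : ℕ)))
        rw [pow_one, RingHom.mem_ker] at this
        rw [this, smul_zero]
      · rw [wordOp_monomial D ε ξ hξ hD _ _ ((hlen _).trans h), if_neg, smul_zero]
        intro hcc
        refine hc (funext fun i => Fin.ext ?_)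
        rw [← hcount (fun i => c i) i]
        exact congrFun hcc i
  · intro h; exact absurd (Finset.mem_univ _) h

end Independence

/-! ### p-th powers of derivations -/

section DerivationPow
variable {𝒦 : Type*} [Field 𝒦] {A : Type*} [CommRing A] [Algebra 𝒦 A]

/-- In characteristic `p` the `p`-th power of a derivation is a derivation. -/
theorem derivation_pow_char (p : ℕ) [Fact p.Prime] [CharP 𝒦 p] (D : Derivation 𝒦 A A) (a b : A) :
    ((D : A →ₗ[𝒦] A) ^ p : Module.End 𝒦 A) (a * b) =
      a * ((D : A →ₗ[𝒦] A) ^ p : Module.End 𝒦 A) b +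
        b * ((D : A →ₗ[𝒦] A) ^ p : Module.End 𝒦 A) a := by
  rcases subsingleton_or_nontrivial A with _ | _
  · exact Subsingleton.elim _ _
  set T : Module.End 𝒦 A := (D : A →ₗ[𝒦] A) with hT
  set L : Module.End 𝒦 (Module.End 𝒦 A) := LinearMap.mulLeft 𝒦 T
  set R : Module.End 𝒦 (Module.End 𝒦 A) := LinearMap.mulRight 𝒦 T
  have : CharP (Module.End 𝒦 (Module.End 𝒦 A)) p :=
    charP_of_injective_algebraMap (algebraMap 𝒦 _).injective p
  -- The commutator of T with multiplication by a is multiplication by T a. Since L and R commute,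
  -- (L - R)^p = L^p - R^p, and so the commutator with T^p obeys the same rule.
  have h1 : ∀ m : ℕ, ((L - R) ^ m) (LinearMap.mulLeft 𝒦 a) = LinearMap.mulLeft 𝒦 ((T ^ m) a) := by
    intro m
    induction m with
    | zero => simp
    | succ m ih =>
      rw [pow_succ', Module.End.mul_apply, ih, pow_succ', Module.End.mul_apply]
      generalize (T ^ m) a = c
      refine LinearMap.ext fun x => ?_
      simp [L, R, hT, LinearMap.sub_apply, mul_comm]
  have h2 := h1 p
  have h0 : (L - R) ^ p = L ^ p - R ^ p :=
    sub_pow_char_of_commute (R := Module.End 𝒦 (Module.End 𝒦 A)) p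
      (LinearMap.commute_mulLeft_right T T)
  rw [h0, LinearMap.pow_mulLeft, LinearMap.pow_mulRight, LinearMap.sub_apply, LinearMap.mulLeft_apply,
    LinearMap.mulRight_apply] at h2
  have h3 := LinearMap.congr_fun h2 b
  simp only [LinearMap.sub_apply, Module.End.mul_apply, LinearMap.mulLeft_apply] at h3
  rw [sub_eq_iff_eq_add] at h3
  rw [h3]; ring

/-- In characteristic `p` the `p`-th power of a derivation, as a derivation. -/
def derivationPow (p : ℕ) [Fact p.Prime] [CharP 𝒦 p] (D : Derivation 𝒦 A A) : Derivation 𝒦 A A :=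
  Derivation.mk' ((D : A →ₗ[𝒦] A) ^ p : Module.End 𝒦 A) fun a b => by
    rw [derivation_pow_char p D a b, smul_eq_mul, smul_eq_mul]

theorem derivationPow_apply (p : ℕ) [Fact p.Prime] [CharP 𝒦 p] (D : Derivation 𝒦 A A) (a : A) :
    derivationPow p D a = ((D : A →ₗ[𝒦] A) ^ p : Module.End 𝒦 A) a := rfl

end DerivationPow

/-! ### Endomorphisms as vector fields on the space of matrices -/

section GenericMatrix
variable {𝒦 : Type*} [Field 𝒦] {O : Type*} [AddCommGroup O] [Module 𝒦 O] {B : Type*} [Fintype B]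
  [DecidableEq B] (β : Module.Basis B 𝒦 O)

/-- The linear embedding of `O` as the `k`-th column of the generic matrix. -/
def genericColumn (k : B) : O →ₗ[𝒦] MvPolynomial (B × B) 𝒦 :=
  β.constr 𝒦 fun v => MvPolynomial.X (v, k)

theorem genericColumn_basis (k v : B) : genericColumn β k (β v) = MvPolynomial.X (v, k) := by
  simp [genericColumn]

/-- The derivation of the polynomial functions on matrices given by an endomorphism. -/
def matrixDerivation : Module.End 𝒦 O →ₗ[𝒦]
    Derivation 𝒦 (MvPolynomial (B × B) 𝒦) (MvPolynomial (B × B) 𝒦) where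
  toFun T := MvPolynomial.mkDerivation 𝒦 fun i => genericColumn β i.2 (T (β i.1))
  map_add' S T := by
    refine MvPolynomial.derivation_ext fun i => ?_
    simp [MvPolynomial.mkDerivation_X]
  map_smul' c T := by
    refine MvPolynomial.derivation_ext fun i => ?_
    simp [MvPolynomial.mkDerivation_X]

theorem matrixDerivation_X (T : Module.End 𝒦 O) (i : B × B) :
    matrixDerivation β T (MvPolynomial.X i) = genericColumn β i.2 (T (β i.1)) :=
  MvPolynomial.mkDerivation_X _ _ _

theorem matrixDerivation_genericColumn (T : Module.End 𝒦 O) (k : B) (y : O) :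
    matrixDerivation β T (genericColumn β k y) = genericColumn β k (T y) := by
  have : (matrixDerivation β T : _ →ₗ[𝒦] _) ∘ₗ genericColumn β k = genericColumn β k ∘ₗ T := by
    refine β.ext fun v => ?_
    simp [genericColumn_basis, matrixDerivation_X]
  exact LinearMap.congr_fun this y

theorem matrixDerivation_lie (S T : Module.End 𝒦 O) :
    matrixDerivation β (S * T - T * S) = ⁅matrixDerivation β S, matrixDerivation β T⁆ := by
  refine MvPolynomial.derivation_ext fun i => ?_
  rw [Derivation.commutator_apply]
  simp [matrixDerivation_X, matrixDerivation_genericColumn]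

theorem matrixDerivation_pow_genericColumn (T : Module.End 𝒦 O) (m : ℕ) (k : B) (y : O) :
    ((matrixDerivation β T : _ →ₗ[𝒦] _) ^ m : Module.End 𝒦 (MvPolynomial (B × B) 𝒦))
      (genericColumn β k y) = genericColumn β k ((T ^ m) y) := by
  induction m with
  | zero => simp
  | succ m ih =>
    rw [pow_succ', pow_succ', Module.End.mul_apply, ih, Module.End.mul_apply]
    exact matrixDerivation_genericColumn β T k _

/-- Both sides are derivations, so they need only be compared on matrix entries. There the field
attached to T acts on a generic column as T itself. -/
theorem matrixDerivation_pow (p : ℕ) [Fact p.Prime] [CharP 𝒦 p] (T : Module.End 𝒦 O) :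
    ((matrixDerivation β T : _ →ₗ[𝒦] _) ^ p : Module.End 𝒦 (MvPolynomial (B × B) 𝒦)) =
      (matrixDerivation β (T ^ p) : _ →ₗ[𝒦] _) := by
  have : derivationPow p (matrixDerivation β T) = matrixDerivation β (T ^ p) := by
    refine MvPolynomial.derivation_ext fun i => ?_
    obtain ⟨v, k⟩ := i
    rw [derivationPow_apply, ← genericColumn_basis β k v, matrixDerivation_pow_genericColumn,
      matrixDerivation_genericColumn]
  rw [← this]; rfl

/-- Evaluation at the identity matrix. -/
def evalIdentity (𝒦 : Type*) [Field 𝒦] (B : Type*) [DecidableEq B] :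
    MvPolynomial (B × B) 𝒦 →ₐ[𝒦] 𝒦 :=
  MvPolynomial.aeval fun i => if i.1 = i.2 then 1 else 0

theorem evalIdentity_genericColumn (k : B) (y : O) :
    evalIdentity 𝒦 B (genericColumn β k y) = β.repr y k := by
  have : (evalIdentity 𝒦 B).toLinearMap ∘ₗ genericColumn β k =
      Finsupp.lapply k ∘ₗ β.repr.toLinearMap := by
    refine β.ext fun v => ?_
    simp [genericColumn_basis, evalIdentity, Finsupp.single_apply]
  exact LinearMap.congr_fun this y

/-- The function on matrices, vanishing at the identity, whose differential there is `f`. -/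
def cotangent (f : Module.End 𝒦 O →ₗ[𝒦] 𝒦) : MvPolynomial (B × B) 𝒦 :=
  ∑ v, ∑ k, f (Matrix.toLin β β (Matrix.single k v 1)) •
    (MvPolynomial.X (v, k) - MvPolynomial.C (if v = k then 1 else 0))

theorem evalIdentity_cotangent (f : Module.End 𝒦 O →ₗ[𝒦] 𝒦) :
    evalIdentity 𝒦 B (cotangent β f) = 0 := by
  simp [cotangent, evalIdentity]

/-- At the identity matrix the vector field of T has the entries of T as components, so any linear
form on endomorphisms is the differential of a function there. This supplies functions dual to
linearly independent fields. -/
theorem evalIdentity_matrixDerivation_cotangent (f : Module.End 𝒦 O →ₗ[𝒦] 𝒦)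
    (T : Module.End 𝒦 O) :
    evalIdentity 𝒦 B (matrixDerivation β T (cotangent β f)) = f T := by
  have h1 : f T = ∑ v, ∑ k, f (Matrix.toLin β β (Matrix.single k v 1)) * β.repr (T (β v)) k := by
    conv_lhs => rw [← Matrix.toLin_toMatrix β β T,
      Matrix.matrix_eq_sum_single (LinearMap.toMatrix β β T)]
    rw [Finset.sum_comm]
    simp only [map_sum]
    refine Finset.sum_congr rfl fun v _ => Finset.sum_congr rfl fun k _ => ?_
    have : Matrix.single k v (LinearMap.toMatrix β β T k v) =
        (LinearMap.toMatrix β β T k v) • Matrix.single k v (1 : 𝒦) := by simp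
    rw [this, map_smul, map_smul, LinearMap.toMatrix_apply, smul_eq_mul, mul_comm]
  rw [h1, cotangent]
  simp only [map_sum, Derivation.map_smul, map_sub, matrixDerivation_X,
    MvPolynomial.derivation_C, sub_zero, map_smul, evalIdentity_genericColumn, smul_eq_mul]

end GenericMatrix

/-! ### The divided power basis of O(2n+1) -/

section TruncBasis
variable (𝒦 : Type*) [Field 𝒦] (p n : ℕ)

theorem divPow_eq_mk (α : Idx n → ℕ) : divPow 𝒦 p n α = TruncPoly.mk 𝒦 p n
    (MvPolynomial.monomial (Finsupp.equivFunOnFinite.symm α) (∏ i, ((α i).factorial : 𝒦)⁻¹)) := by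
  rw [MvPolynomial.monomial_eq, map_mul, Finsupp.prod_fintype _ _ (fun i => by simp), map_prod]
  simp only [divPow, Algebra.smul_def, Finset.prod_mul_distrib]
  congr 1
  · rw [← map_prod, ← map_prod]
    exact ((TruncPoly.mk 𝒦 p n).commutes _).symm
  · simp [map_prod, xvar]

theorem truncIdeal_eq : truncIdeal 𝒦 p n = Ideal.span ((fun s => MvPolynomial.monomial s (1 : 𝒦)) ''
    Set.range fun i : Idx n => Finsupp.single i p) := by
  rw [truncIdeal, ← Set.range_comp]
  congr 2
  ext1 i
  simp [MvPolynomial.X_pow_eq_monomial]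

variable [Fact p.Prime] [CharP 𝒦 p]

theorem prod_inv_factorial_ne_zero {α : Idx n → ℕ} (hα : ∀ i, α i < p) :
    ∏ i, ((α i).factorial : 𝒦)⁻¹ ≠ 0 :=
  Finset.prod_ne_zero_iff.2 fun i _ => inv_ne_zero (factorial_cast_ne_zero 𝒦 p (hα i))

theorem linearIndependent_divPow :
    LinearIndependent 𝒦 fun α : Idx n → Fin p => divPow 𝒦 p n fun i => α i := by
  rw [Fintype.linearIndependent_iff]
  intro g hg α
  replace hg : TruncPoly.mk 𝒦 p n (∑ x : Idx n → Fin p, g x • MvPolynomial.monomial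
      (Finsupp.equivFunOnFinite.symm fun i => (x i : ℕ))
        (∏ i, (((x i : ℕ)).factorial : 𝒦)⁻¹)) = 0 := by
    rw [map_sum, ← hg]
    exact Finset.sum_congr rfl fun x _ => by rw [map_smul, divPow_eq_mk]
  rw [TruncPoly.mk_eq_zero, truncIdeal_eq, MvPolynomial.mem_ideal_span_monomial_image] at hg
  by_contra hne
  have hc : MvPolynomial.coeff (Finsupp.equivFunOnFinite.symm fun i => (α i : ℕ))
      (∑ x : Idx n → Fin p, g x • MvPolynomial.monomial (Finsupp.equivFunOnFinite.symm fun i => (x i : ℕ))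
        (∏ i, (((x i : ℕ)).factorial : 𝒦)⁻¹)) = g α * ∏ i, (((α i : ℕ)).factorial : 𝒦)⁻¹ := by
    rw [MvPolynomial.coeff_sum, Finset.sum_eq_single α]
    · simp
    · intro β _ hβ
      rw [MvPolynomial.coeff_smul, MvPolynomial.coeff_monomial, if_neg, smul_zero]
      intro h
      refine hβ (funext fun i => Fin.ext ?_)
      exact congrFun (Finsupp.equivFunOnFinite.symm.injective h) i
    · intro h; exact absurd (Finset.mem_univ _) h
  obtain ⟨_, ⟨i, rfl⟩, hi⟩ := hg (Finsupp.equivFunOnFinite.symm fun i => (α i : ℕ)) (by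
    rw [MvPolynomial.mem_support_iff, hc]
    exact mul_ne_zero hne (prod_inv_factorial_ne_zero 𝒦 p n fun i => (α i).2))
  have := hi i
  simp only [Finsupp.single_eq_same, Finsupp.equivFunOnFinite_symm_apply_apply] at this
  exact absurd this (not_le.2 (α i).2)

theorem span_divPow :
    Submodule.span 𝒦 (Set.range fun α : Idx n → Fin p => divPow 𝒦 p n fun i => α i) = ⊤ := by
  rw [eq_top_iff]
  rintro f -
  obtain ⟨f, rfl⟩ := TruncPoly.mk_surjective 𝒦 p n f
  induction f using MvPolynomial.induction_on' with
  | add f g hf hg => rw [map_add]; exact Submodule.add_mem _ hf hg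
  | monomial s a =>
    by_cases hs : ∀ i, s i < p
    · have h0 := prod_inv_factorial_ne_zero 𝒦 p n hs
      have : TruncPoly.mk 𝒦 p n (MvPolynomial.monomial s a) =
          (a * (∏ i, ((s i).factorial : 𝒦)⁻¹)⁻¹) • divPow 𝒦 p n s := by
        rw [divPow_eq_mk, ← map_smul, MvPolynomial.smul_monomial, smul_eq_mul, mul_assoc,
          inv_mul_cancel₀ h0, mul_one]
        congr 2
        ext; simp
      rw [this]
      exact Submodule.smul_mem _ _ (Submodule.subset_span ⟨fun i => ⟨s i, hs i⟩, rfl⟩)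
    · push Not at hs
      obtain ⟨i, hi⟩ := hs
      have : TruncPoly.mk 𝒦 p n (MvPolynomial.monomial s a) = 0 := by
        rw [TruncPoly.mk_eq_zero, truncIdeal_eq, MvPolynomial.mem_ideal_span_monomial_image]
        intro t ht
        have := MvPolynomial.support_monomial_subset ht
        rw [Finset.mem_singleton] at this
        subst this
        exact ⟨_, ⟨i, rfl⟩, by rwa [Finsupp.single_le_iff]⟩
      rw [this]
      exact Submodule.zero_mem _

/-- The basis of divided power monomials of `O(2n+1; 1)`. -/
def divPowBasis : Module.Basis (Idx n → Fin p) 𝒦 (TruncPoly 𝒦 p n) :=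
  Module.Basis.mk (linearIndependent_divPow 𝒦 p n) (span_divPow 𝒦 p n).ge

theorem divPowBasis_apply (α : Idx n → Fin p) :
    divPowBasis 𝒦 p n α = divPow 𝒦 p n fun i => α i := by
  simp [divPowBasis]

theorem cast_ne_zero_of_pos {m : ℕ} (h0 : 0 < m) (hm : m < p) : (m : 𝒦) ≠ 0 := by
  rw [Ne, CharP.cast_eq_zero_iff 𝒦 p]
  intro h; have := Nat.le_of_dvd h0 h; omega

theorem pd_divPow_of_pos {α : Idx n → ℕ} {j : Idx n} (h0 : 0 < α j) (hp : α j < p) :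
    pd 𝒦 p n j (divPow 𝒦 p n α) = divPow 𝒦 p n (α - Pi.single j 1) := by
  have e : α = (α - Pi.single j 1) + Pi.single j 1 := by
    funext i
    by_cases hi : i = j
    · subst hi; simp; omega
    · simp [Pi.single_eq_of_ne hi]
  conv_lhs => rw [e]
  refine pd_divPow 𝒦 p n _ j ?_
  refine cast_ne_zero_of_pos 𝒦 p (Nat.succ_pos _) ?_
  simp; omega

/-- A divided power monomial as the product of its part in `x_j` and the rest. -/
theorem exists_divPow_eq_mul (j : Idx n) (a : ℕ) : ∃ X X' : TruncPoly 𝒦 p n,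
    ∀ α : Idx n → ℕ, α j = a → ∃ R, divPow 𝒦 p n α = X * R ∧ pd 𝒦 p n j (divPow 𝒦 p n α) = X' * R := by
  refine ⟨(a.factorial : 𝒦)⁻¹ • xvar 𝒦 p n j ^ a,
    pd 𝒦 p n j ((a.factorial : 𝒦)⁻¹ • xvar 𝒦 p n j ^ a), fun α hα => ?_⟩
  refine ⟨∏ i ∈ Finset.univ.erase j, ((α i).factorial : 𝒦)⁻¹ • xvar 𝒦 p n i ^ α i, ?_, ?_⟩
  · rw [divPow, ← Finset.mul_prod_erase Finset.univ _ (Finset.mem_univ j), hα]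
  · have h0 : ∀ s : Finset (Idx n), j ∉ s →
        pd 𝒦 p n j (∏ i ∈ s, ((α i).factorial : 𝒦)⁻¹ • xvar 𝒦 p n i ^ α i) = 0 := by
      intro s
      induction s using Finset.induction_on with
      | empty => simp
      | insert i s hi ih =>
        intro hj
        rw [Finset.mem_insert, not_or] at hj
        rw [Finset.prod_insert hi, Derivation.leibniz, ih hj.2, Derivation.map_smul,
          Derivation.leibniz_pow, pd_xvar, if_neg (Ne.symm hj.1)]
        simp
    rw [divPow, ← Finset.mul_prod_erase Finset.univ _ (Finset.mem_univ j), hα, Derivation.leibniz,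
      h0 _ (Finset.notMem_erase j _), smul_zero, zero_add, smul_eq_mul, mul_comm]

theorem pd_divPow_of_zero {α : Idx n → ℕ} {j : Idx n} (h0 : α j = 0) :
    pd 𝒦 p n j (divPow 𝒦 p n α) = 0 := by
  have h0 : ∀ s : Finset (Idx n),
      pd 𝒦 p n j (∏ i ∈ s, ((α i).factorial : 𝒦)⁻¹ • xvar 𝒦 p n i ^ α i) = 0 := by
    intro s
    induction s using Finset.induction_on with
    | empty => simp
    | insert i s hi ih =>
      rw [Finset.prod_insert hi, Derivation.leibniz, ih, Derivation.map_smul,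
        Derivation.leibniz_pow, pd_xvar]
      by_cases hij : i = j
      · subst hij; simp [h0]
      · simp [hij]
  exact h0 _

/-- If `α` and `β` agree at `j`, the Wronskian of the monomials with respect to `x_j` vanishes. -/
theorem divPow_mul_pd {α β : Idx n → ℕ} {j : Idx n} (h : α j = β j) :
    divPow 𝒦 p n α * pd 𝒦 p n j (divPow 𝒦 p n β) =
      pd 𝒦 p n j (divPow 𝒦 p n α) * divPow 𝒦 p n β := by
  obtain ⟨X, X', hX⟩ := exists_divPow_eq_mul 𝒦 p n j (α j)
  obtain ⟨R, h1, h2⟩ := hX α rfl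
  obtain ⟨S, h3, h4⟩ := hX β h.symm
  rw [h2, h4, h1, h3]; ring

/-- By the vanishing Wronskian in x_i, the left side equals x^(α) · D_i D_j x^(β), which is
symmetric in i and j. Consequently the Poisson terms of two monomials vanish for each pair x_i,
x_{-i} in which they agree. -/
theorem pd_mul_pd {α β : Idx n → ℕ} {i j : Idx n} (hij : i ≠ j) (hi : α i = β i) (hj : α j = β j)
    (hβ : ∀ i, β i < p) :
    pd 𝒦 p n i (divPow 𝒦 p n α) * pd 𝒦 p n j (divPow 𝒦 p n β) =
      pd 𝒦 p n j (divPow 𝒦 p n α) * pd 𝒦 p n i (divPow 𝒦 p n β) := by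
  have key : ∀ {i j : Idx n}, i ≠ j → α i = β i →
      pd 𝒦 p n i (divPow 𝒦 p n α) * pd 𝒦 p n j (divPow 𝒦 p n β) =
        divPow 𝒦 p n α * pd 𝒦 p n i (pd 𝒦 p n j (divPow 𝒦 p n β)) := by
    intro i j hij hi
    rcases Nat.eq_zero_or_pos (β j) with h | h
    · rw [pd_divPow_of_zero 𝒦 p n h]; simp
    · rw [pd_divPow_of_pos 𝒦 p n h (hβ j), divPow_mul_pd]
      rw [hi, Pi.sub_apply, Pi.single_eq_of_ne hij, Nat.sub_zero]
  rw [key hij hi, key hij.symm hj, pd_comm]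

/-- The coefficient of the top monomial `x^(τ)`. -/
def topCoeff : TruncPoly 𝒦 p n →ₗ[𝒦] 𝒦 :=
  (divPowBasis 𝒦 p n).coord fun _ => ⟨p - 1, by have := (Fact.out : p.Prime).pos; omega⟩

/-- Differentiation in x_j brings the exponent of x_j below p - 1 or gives zero. The top coefficient
thus behaves like an integral, and integration by parts is available. -/
theorem topCoeff_pd (j : Idx n) (f : TruncPoly 𝒦 p n) : topCoeff 𝒦 p n (pd 𝒦 p n j f) = 0 := by
  have hp := (Fact.out : p.Prime).pos
  have : topCoeff 𝒦 p n ∘ₗ (pd 𝒦 p n j : TruncPoly 𝒦 p n →ₗ[𝒦] TruncPoly 𝒦 p n) = 0 := by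
    refine (divPowBasis 𝒦 p n).ext fun α => ?_
    rw [divPowBasis_apply, LinearMap.zero_apply, LinearMap.comp_apply]
    change topCoeff 𝒦 p n (pd 𝒦 p n j (divPow 𝒦 p n fun i => α i)) = 0
    rcases Nat.eq_zero_or_pos (α j : ℕ) with h | h
    · rw [pd_divPow_of_zero 𝒦 p n h, map_zero]
    · rw [pd_divPow_of_pos 𝒦 p n h (α j).2]
      have e : divPow 𝒦 p n ((fun i => (α i : ℕ)) - Pi.single j 1) =
          divPowBasis 𝒦 p n fun i => ⟨((fun i => (α i : ℕ)) - Pi.single j 1 : Idx n → ℕ) i,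
            lt_of_le_of_lt (Nat.sub_le _ _) (α i).2⟩ := by
        rw [divPowBasis_apply]
      rw [e, topCoeff, Module.Basis.coord_apply, Module.Basis.repr_self, Finsupp.single_apply, if_neg]
      intro hc
      have := congrArg Fin.val (congrFun hc j)
      simp at this
      have := (α j).2
      omega
  exact LinearMap.congr_fun this f

end TruncBasis

/-! ### A basis of the contact algebra -/

section ContactBasis
variable (𝒦 : Type*) [Field 𝒦] (p n : ℕ) [Fact p.Prime] [CharP 𝒦 p]

theorem euler_eq_pd (f : TruncPoly 𝒦 p n) : euler 𝒦 p n f =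
    ∑ i : Fin n, (pd 𝒦 p n (.pos i) (xvar 𝒦 p n (.pos i) * f) +
      pd 𝒦 p n (.neg i) (xvar 𝒦 p n (.neg i) * f)) - 2 * n * f := by
  have : ∀ i : Fin n, pd 𝒦 p n (.pos i) (xvar 𝒦 p n (.pos i) * f) +
      pd 𝒦 p n (.neg i) (xvar 𝒦 p n (.neg i) * f) =
      (xvar 𝒦 p n (.pos i) * pd 𝒦 p n (.pos i) f + xvar 𝒦 p n (.neg i) * pd 𝒦 p n (.neg i) f) +
        2 * f := fun i => by
    simp only [Derivation.leibniz, pd_xvar, smul_eq_mul, if_true]; ring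
  rw [Finset.sum_congr rfl fun i _ => this i, Finset.sum_add_distrib, euler_apply]
  simp only [Finset.sum_const, Finset.card_univ, Fintype.card_fin, nsmul_eq_mul]
  ring

theorem pois_eq_pd (f g : TruncPoly 𝒦 p n) : pois 𝒦 p n f g =
    ∑ i : Fin n, (pd 𝒦 p n (.neg i) (f * pd 𝒦 p n (.pos i) g) -
      pd 𝒦 p n (.pos i) (f * pd 𝒦 p n (.neg i) g)) := by
  refine Finset.sum_congr rfl fun i _ => ?_
  simp only [Derivation.leibniz, smul_eq_mul]
  rw [pd_comm 𝒦 p n (.neg i) (.pos i)]; ring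

theorem topCoeff_euler (f : TruncPoly 𝒦 p n) :
    topCoeff 𝒦 p n (euler 𝒦 p n f) = -(2 * n : ℕ) * topCoeff 𝒦 p n f := by
  have : (2 * n : TruncPoly 𝒦 p n) * f = ((2 * n : ℕ) : 𝒦) • f := by
    rw [Nat.cast_smul_eq_nsmul, nsmul_eq_mul]; push_cast; rfl
  rw [euler_eq_pd, map_sub, map_sum, this]
  simp only [map_add, topCoeff_pd, map_smul, smul_eq_mul]
  simp

/-- Up to total derivatives the bracket polynomial is -4 D₀f · g + E(D₀f · g), the Poisson part
being itself a divergence. The Euler field contributes the factor -2n, again by integration by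
parts. -/
theorem topCoeff_bracket (f g : TruncPoly 𝒦 p n) :
    topCoeff 𝒦 p n (contactD 𝒦 p n f g - 2 * pd 𝒦 p n .zero f * g) =
      -((2 * n + 4 : ℕ) : 𝒦) * topCoeff 𝒦 p n (pd 𝒦 p n .zero f * g) := by
  have e : contactD 𝒦 p n f g - 2 * pd 𝒦 p n .zero f * g =
      (2 : 𝒦) • pd 𝒦 p n .zero (f * g) - (4 : 𝒦) • (pd 𝒦 p n .zero f * g)
        - pd 𝒦 p n .zero (euler 𝒦 p n f * g) + euler 𝒦 p n (pd 𝒦 p n .zero f * g) +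
        pois 𝒦 p n f g := by
    rw [contactD_apply]
    simp only [Derivation.leibniz, smul_eq_mul, pd_euler_zero, Algebra.smul_def, map_ofNat]
    ring
  rw [e, map_add, map_add, map_sub, map_sub, map_smul, map_smul, topCoeff_pd, topCoeff_pd,
    topCoeff_euler, pois_eq_pd, map_sum]
  simp only [map_sub, topCoeff_pd]
  simp only [smul_eq_mul]
  push_cast
  simp
  ring

theorem two_ne_zero_of_char (hp2 : p ≠ 2) : (2 : 𝒦) ≠ 0 := by
  have hp : p.Prime := Fact.out
  have := cast_ne_zero_of_pos 𝒦 p (m := 2) (by norm_num) (by have := hp.two_le; omega)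
  exact_mod_cast this

/-- The values of D_K f on the x_{±i} determine E f, and its value on x₀ is 2f - E f, so f can be
recovered when 2 is invertible. -/
theorem contactD_injective (hp2 : p ≠ 2) : Function.Injective (contactD 𝒦 p n) := by
  rw [← LinearMap.ker_eq_bot, LinearMap.ker_eq_bot']
  intro f hf
  have h0 := contactD_xzero 𝒦 p n f
  have h1 := contactD_xpos 𝒦 p n f
  have h2 := contactD_xneg 𝒦 p n f
  rw [hf] at h0
  simp only [hf, Derivation.zero_apply] at h0 h1 h2
  have hE : euler 𝒦 p n f = 0 := by
    rw [euler_apply]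
    refine Finset.sum_eq_zero fun i _ => ?_
    linear_combination xvar 𝒦 p n (.pos i) * h2 i - xvar 𝒦 p n (.neg i) * h1 i
  rw [hE, sub_zero] at h0
  have : (2 : 𝒦) • f = 0 := by rw [Algebra.smul_def, map_ofNat]; exact h0.symm
  exact (smul_eq_zero.1 this).resolve_left (two_ne_zero_of_char 𝒦 p hp2)

/-- The admissible multi-indices. -/
abbrev AdmIdx : Type := {α : Idx n → Fin p // Admissible p n fun i => α i}

/-- The condition on the top coefficient is the obstruction that removes τ when p divides 2n + 4: it
holds for all brackets and is linear. -/
theorem exists_contactD_of_mem (x : contactPrime 𝒦 p n) (hx : x ∈ contactIdeal 𝒦 p n) :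
    ∃ f, (x : Witt 𝒦 p n) = contactD 𝒦 p n f ∧ (p ∣ 2 * n + 4 → topCoeff 𝒦 p n f = 0) := by
  have hx' : x ∈ (⁅(⊤ : LieIdeal 𝒦 (contactPrime 𝒦 p n)), (⊤ : LieIdeal 𝒦 (contactPrime 𝒦 p n))⁆ :
    LieIdeal 𝒦 (contactPrime 𝒦 p n)) := hx
  rw [← LieSubmodule.mem_toSubmodule, LieSubmodule.lieIdeal_oper_eq_linear_span] at hx'
  clear hx
  induction hx' using Submodule.span_induction with
  | mem x h =>
    obtain ⟨⟨⟨_, f, rfl⟩, -⟩, ⟨⟨_, g, rfl⟩, -⟩, rfl⟩ := h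
    refine ⟨_, contactD_lie 𝒦 p n f g, fun h => ?_⟩
    rw [topCoeff_bracket, (CharP.cast_eq_zero_iff 𝒦 p _).2 h, neg_zero, zero_mul]
  | zero => exact ⟨0, by simp, by simp⟩
  | add x y _ _ hx hy =>
    obtain ⟨f, hf, hf'⟩ := hx
    obtain ⟨g, hg, hg'⟩ := hy
    exact ⟨f + g, by rw [map_add, ← hf, ← hg]; rfl, fun h => by rw [map_add, hf' h, hg' h, add_zero]⟩
  | smul a x _ hx =>
    obtain ⟨f, hf, hf'⟩ := hx
    exact ⟨a • f, by rw [map_smul, ← hf]; rfl, fun h => by rw [map_smul, hf' h, smul_zero]⟩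

variable {p} in
theorem linearIndependent_contactGen (hp2 : p ≠ 2) :
    LinearIndependent 𝒦 fun α : AdmIdx p n => contactGen 𝒦 p n fun i => α.1 i := by
  refine LinearIndependent.of_comp ((contactPrime 𝒦 p n).toSubmodule.subtype ∘ₗ
    (contactIdeal 𝒦 p n).toSubmodule.subtype) ?_
  have h := ((linearIndependent_divPow 𝒦 p n).map' (contactD 𝒦 p n)
    (LinearMap.ker_eq_bot.2 (contactD_injective 𝒦 p n hp2))).comp
      (fun α : AdmIdx p n => α.1) Subtype.val_injective
  have e : ⇑((contactPrime 𝒦 p n).toSubmodule.subtype ∘ₗ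
      (contactIdeal 𝒦 p n).toSubmodule.subtype) ∘
        (fun α : AdmIdx p n => contactGen 𝒦 p n fun i => α.1 i) =
      (⇑(contactD 𝒦 p n) ∘ fun α : Idx n → Fin p => divPow 𝒦 p n fun i => α i) ∘
        fun α : AdmIdx p n => α.1 :=
    funext fun α => contactGen_coe 𝒦 p n Fact.out hp2 _ α.2
  rw [e]
  exact h

variable {p} in
theorem span_contactGen (hp2 : p ≠ 2) :
    Submodule.span 𝒦 (Set.range fun α : AdmIdx p n => contactGen 𝒦 p n fun i => α.1 i) = ⊤ := by
  rw [eq_top_iff]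
  rintro ⟨x, hx⟩ -
  obtain ⟨f, hf, hf'⟩ := exists_contactD_of_mem 𝒦 p n x hx
  have hp := (Fact.out : p.Prime).pos
  classical
  have e : (⟨x, hx⟩ : ContactAlg 𝒦 p n) = ∑ α : AdmIdx p n,
      (divPowBasis 𝒦 p n).repr f α.1 • contactGen 𝒦 p n fun i => α.1 i := by
    have hinj : Function.Injective ((contactPrime 𝒦 p n).toSubmodule.subtype ∘ₗ
      (contactIdeal 𝒦 p n).toSubmodule.subtype) :=
      Subtype.val_injective.comp Subtype.val_injective
    apply hinj
    rw [map_sum]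
    refine hf.trans ?_
    conv_lhs => rw [← (divPowBasis 𝒦 p n).sum_repr f]
    rw [map_sum]
    have h1 : ∀ α : AdmIdx p n, ((contactPrime 𝒦 p n).toSubmodule.subtype ∘ₗ
        (contactIdeal 𝒦 p n).toSubmodule.subtype)
          ((divPowBasis 𝒦 p n).repr f α.1 • contactGen 𝒦 p n fun i => α.1 i) =
        contactD 𝒦 p n ((divPowBasis 𝒦 p n).repr f α.1 • divPowBasis 𝒦 p n α.1) := fun α => by
      rw [map_smul, map_smul, divPowBasis_apply]
      congr 1
      exact contactGen_coe 𝒦 p n Fact.out hp2 _ α.2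
    rw [Finset.sum_congr rfl fun α _ => h1 α]
    refine (Finset.sum_subset (Finset.subset_univ (Finset.univ.filter fun α : Idx n → Fin p =>
      Admissible p n fun i => α i)) fun α _ hα => ?_).symm.trans ?_
    · have hn : ¬ Admissible p n fun i => α i := by simpa using hα
      -- The only index that can fail to be admissible is τ, and its coefficient is the top
      -- coefficient of f, which vanishes in that case.
      have h2 : (p ∣ 2 * n + 4) ∧ (fun i => (α i : ℕ)) = fun _ => p - 1 := by
        by_contra hc
        exact hn ⟨fun i => Nat.le_sub_one_of_lt (α i).2, fun h h' => hc ⟨h, h'⟩⟩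
      have h3 : (divPowBasis 𝒦 p n).repr f α = 0 := by
        rw [← hf' h2.1, topCoeff, Module.Basis.coord_apply]
        congr 1
        funext i
        exact Fin.ext (congrFun h2.2 i)
      rw [h3, zero_smul, map_zero]
    · exact (Finset.sum_subtype _ (fun α => by simp) fun α =>
        contactD 𝒦 p n ((divPowBasis 𝒦 p n).repr f α • divPowBasis 𝒦 p n α))
  rw [e]
  exact Submodule.sum_mem _ fun α _ => Submodule.smul_mem _ _ (Submodule.subset_span ⟨α, rfl⟩)

theorem card_admIdx_of_not_dvd (h : ¬ p ∣ 2 * n + 4) : Nat.card (AdmIdx p n) = p ^ (2 * n + 1) := by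
  have : ∀ α : Idx n → Fin p, Admissible p n fun i => α i := fun α =>
    ⟨fun i => Nat.le_sub_one_of_lt (α i).2, fun h' => absurd h' h⟩
  rw [Nat.card_congr (Equiv.subtypeUnivEquiv this)]
  simp
  ring

theorem card_admIdx_of_dvd (h : p ∣ 2 * n + 4) : Nat.card (AdmIdx p n) + 1 = p ^ (2 * n + 1) := by
  classical
  have hp := (Fact.out : p.Prime).pos
  have e : ∀ α : Idx n → Fin p, (Admissible p n fun i => α i) ↔
      α ≠ fun _ => ⟨p - 1, by omega⟩ := fun α => by
    refine ⟨fun hα hc => hα.2 h (by rw [hc]), fun hα =>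
      ⟨fun i => Nat.le_sub_one_of_lt (α i).2, fun _ hc => hα (funext fun i => Fin.ext (congrFun hc i))⟩⟩
  rw [Nat.card_congr (Equiv.subtypeEquivRight e), Nat.card_eq_fintype_card,
    Fintype.card_subtype_compl, Fintype.card_subtype_eq]
  simp only [Fintype.card_fun, Fintype.card_sum, Fintype.card_unit, Fintype.card_fin]
  rw [show 1 + (n + n) = 2 * n + 1 by ring]
  exact Nat.sub_add_cancel (Nat.pow_pos hp)

end ContactBasis

/-! ### Criteria for the p-th power of a derivation to kill an element -/

section TwistedDerivation
variable {𝒦 : Type*} [Field 𝒦] {A : Type*} [CommRing A] [Algebra 𝒦 A]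

/-- The operator `D + a` for a derivation `D` and a function `a`. -/
def addMul (D : Derivation 𝒦 A A) (a : A) : Module.End 𝒦 A :=
  (D : A →ₗ[𝒦] A) + LinearMap.mulLeft 𝒦 a

theorem addMul_apply (D : Derivation 𝒦 A A) (a f : A) : addMul D a f = D f + a * f := rfl

/-- Acting on multiples of x, the derivation D becomes D + a on the cofactor. -/
theorem derivation_pow_eq_mul (D : Derivation 𝒦 A A) {a x : A} (h : D x = a * x) (m : ℕ) :
    ((D : A →ₗ[𝒦] A) ^ m : Module.End 𝒦 A) x = x * (addMul D a ^ m) 1 := by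
  induction m with
  | zero => simp
  | succ m ih =>
    rw [pow_succ', Module.End.mul_apply, ih, pow_succ', Module.End.mul_apply, addMul_apply]
    change D _ = _
    rw [D.leibniz, h, smul_eq_mul, smul_eq_mul]; ring

/-- Left multiplication by D + a + b minus right multiplication by D + b sends the multiplication
operator of c to that of (D + a)c. The two multiplications commute, so in characteristic p the p-th
power splits; evaluation at 1 gives the additivity. -/
theorem addMul_add_pow_char (p : ℕ) [Fact p.Prime] [CharP 𝒦 p] (D : Derivation 𝒦 A A) (a b : A) :
    (addMul D (a + b) ^ p) 1 = (addMul D a ^ p) 1 + (addMul D b ^ p) 1 := by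
  rcases subsingleton_or_nontrivial A with _ | _
  · exact Subsingleton.elim _ _
  set L : Module.End 𝒦 (Module.End 𝒦 A) := LinearMap.mulLeft 𝒦 (addMul D (a + b))
  set R : Module.End 𝒦 (Module.End 𝒦 A) := LinearMap.mulRight 𝒦 (addMul D b)
  have : CharP (Module.End 𝒦 (Module.End 𝒦 A)) p :=
    charP_of_injective_algebraMap (algebraMap 𝒦 _).injective p
  have h1 : ∀ m : ℕ, ((L - R) ^ m) (LinearMap.mulLeft 𝒦 1) =
      LinearMap.mulLeft 𝒦 ((addMul D a ^ m) 1) := by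
    intro m
    induction m with
    | zero => simp
    | succ m ih =>
      rw [pow_succ', Module.End.mul_apply, ih, pow_succ', Module.End.mul_apply]
      generalize (addMul D a ^ m) 1 = c
      refine LinearMap.ext fun x => ?_
      simp only [L, R, LinearMap.sub_apply, LinearMap.mulLeft_apply, LinearMap.mulRight_apply,
        Module.End.mul_apply, addMul_apply, D.leibniz, smul_eq_mul]
      ring
  have h2 := h1 p
  have h0 : (L - R) ^ p = L ^ p - R ^ p :=
    sub_pow_char_of_commute (R := Module.End 𝒦 (Module.End 𝒦 A)) p
      (LinearMap.commute_mulLeft_right _ _)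
  rw [h0, LinearMap.pow_mulLeft, LinearMap.pow_mulRight, LinearMap.sub_apply, LinearMap.mulLeft_apply,
    LinearMap.mulRight_apply] at h2
  have h3 := LinearMap.congr_fun h2 1
  simp only [LinearMap.sub_apply, Module.End.mul_apply, LinearMap.mulLeft_apply, one_mul,
    mul_one] at h3
  rw [← h3]; ring

theorem derivation_pow_apply (D : Derivation 𝒦 A A) {v : A} {c : 𝒦} (h : D v = c • v ^ 2) (m : ℕ) :
    D (v ^ m) = (m * c) • v ^ (m + 1) := by
  rw [D.leibniz_pow, h]
  rcases m with _ | m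
  · simp
  · rw [Nat.add_sub_cancel, ← Nat.cast_smul_eq_nsmul 𝒦, smul_eq_mul]
    simp only [Algebra.smul_def, map_mul, map_natCast]
    ring

theorem addMul_pow_one (D : Derivation 𝒦 A A) {v : A} {c : 𝒦} (h : D v = c • v ^ 2) (m : ℕ) :
    (addMul D v ^ m) 1 = (∏ r ∈ Finset.range m, (1 + r * c)) • v ^ m := by
  induction m with
  | zero => simp
  | succ m ih =>
    rw [pow_succ', Module.End.mul_apply, ih, addMul_apply, D.map_smul, derivation_pow_apply D h,
      Finset.prod_range_succ, mul_smul, smul_comm]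
    simp only [Algebra.smul_def, map_add, map_mul, map_one, map_prod, map_natCast]
    ring

variable (p : ℕ) [Fact p.Prime] [CharP 𝒦 p]

theorem derivation_pow_eq_zero_of_eq_add (D : Derivation 𝒦 A A) {v y x : A} {c d : 𝒦}
    (hv : D v = c • v ^ 2) (hy : D y = d • y ^ 2) (hx : D x = (v + y) * x) (hvp : v ^ p = 0)
    (hyp : y ^ p = 0) : ((D : A →ₗ[𝒦] A) ^ p : Module.End 𝒦 A) x = 0 := by
  rw [derivation_pow_eq_mul D hx, addMul_add_pow_char, addMul_pow_one D hv, addMul_pow_one D hy, hvp,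
    hyp, smul_zero, smul_zero, add_zero, mul_zero]

/-- In closed form, D^(m+1) x is a multiple of v^(m+1) x plus (m+1) times a multiple of v^m u. At m
+ 1 = p the first term vanishes by nilpotency of v and the second by its coefficient p. -/
theorem derivation_pow_eq_zero_of_add (D : Derivation 𝒦 A A) {v u x : A} {c : 𝒦}
    (hv : D v = c • v ^ 2) (hu : D u = v * u) (hx : D x = v * x + u) (hvp : v ^ p = 0) :
    ((D : A →ₗ[𝒦] A) ^ p : Module.End 𝒦 A) x = 0 := by
  have h : ∀ m : ℕ, ((D : A →ₗ[𝒦] A) ^ (m + 1) : Module.End 𝒦 A) x =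
      (∏ r ∈ Finset.range (m + 1), (1 + r * c)) • (v ^ (m + 1) * x) +
        ((m + 1 : ℕ) * ∏ r ∈ Finset.range m, (1 + r * c)) • (v ^ m * u) := by
    intro m
    induction m with
    | zero => simpa using hx
    | succ m ih =>
      rw [pow_succ', Module.End.mul_apply, ih, Finset.prod_range_succ _ (m + 1),
        Finset.prod_range_succ _ m]
      change D _ = _
      rw [map_add, D.map_smul, D.map_smul, D.leibniz, D.leibniz, derivation_pow_apply D hv,
        derivation_pow_apply D hv, hx, hu]
      simp only [smul_eq_mul]
      generalize ∏ r ∈ Finset.range m, (1 + r * c) = P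
      simp only [Algebra.smul_def, map_add, map_mul, map_one, map_natCast]
      push_cast
      ring
  obtain ⟨m, hm⟩ : ∃ m, p = m + 1 := ⟨p - 1, by have := (Fact.out : p.Prime).pos; omega⟩
  have hc : ((m + 1 : ℕ) : 𝒦) = 0 := by rw [← hm]; exact CharP.cast_eq_zero 𝒦 p
  have := h m
  rwa [hc, zero_mul, zero_smul, add_zero, ← hm, hvp, zero_mul, smul_zero] at this

theorem derivation_pow_eq_zero_of_eq_smul (D : Derivation 𝒦 A A) {v f x : A} {c e b : 𝒦}
    (hv : D v = c • v ^ 2) (hf : D f = b • (v * f)) (hx : D x = e • f)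
    (hvf : v ^ (p - 1) * f = 0) : ((D : A →ₗ[𝒦] A) ^ p : Module.End 𝒦 A) x = 0 := by
  have h : ∀ m : ℕ, ((D : A →ₗ[𝒦] A) ^ (m + 1) : Module.End 𝒦 A) x =
      (e * ∏ r ∈ Finset.range m, (b + r * c)) • (v ^ m * f) := by
    intro m
    induction m with
    | zero => simpa using hx
    | succ m ih =>
      rw [pow_succ', Module.End.mul_apply, ih, Finset.prod_range_succ]
      change D _ = _
      rw [D.map_smul, D.leibniz, derivation_pow_apply D hv, hf]
      simp only [smul_eq_mul]
      simp only [Algebra.smul_def, map_add, map_mul, map_prod, map_natCast]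
      ring
  obtain ⟨m, hm⟩ : ∃ m, p = m + 1 := ⟨p - 1, by have := (Fact.out : p.Prime).pos; omega⟩
  have := h m
  have e1 : p - 1 = m := by omega
  rw [e1] at hvf
  rwa [hvf, smul_zero, ← hm] at this

end TwistedDerivation

/-! ### The p-th powers of the operators D_K(x^(α)) -/

section ContactPower
variable (𝒦 : Type*) [Field 𝒦] (p n : ℕ)

theorem xvar_pow (i : Idx n) : xvar 𝒦 p n i ^ p = 0 := by
  rw [xvar, ← map_pow, TruncPoly.mk_eq_zero]
  exact Ideal.subset_span ⟨i, rfl⟩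

theorem divPow_pow {β : Idx n → ℕ} (h : β ≠ 0) : divPow 𝒦 p n β ^ p = 0 := by
  obtain ⟨i, hi⟩ := Function.ne_iff.1 h
  rw [divPow, ← Finset.prod_pow]
  refine Finset.prod_eq_zero (Finset.mem_univ i) ?_
  rw [smul_pow, ← pow_mul, mul_comm, pow_mul, xvar_pow, zero_pow hi, smul_zero]

variable [Fact p.Prime] [CharP 𝒦 p]

theorem pois_divPow {α β : Idx n → ℕ} (hβ : ∀ i, β i < p) (h : ∀ j : Fin n ⊕ Fin n, α (.inr j) = β (.inr j)) :
    pois 𝒦 p n (divPow 𝒦 p n α) (divPow 𝒦 p n β) = 0 := by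
  refine Finset.sum_eq_zero fun i _ => ?_
  rw [pd_mul_pd 𝒦 p n (by simp) (h _) (h _) hβ, sub_self]

theorem pois_divPow_of_ne {α β : Idx n → ℕ} (hβ : ∀ i, β i < p) (k : Fin n)
    (h : ∀ i ≠ k, α (.pos i) = β (.pos i) ∧ α (.neg i) = β (.neg i)) :
    pois 𝒦 p n (divPow 𝒦 p n α) (divPow 𝒦 p n β) =
      pd 𝒦 p n (.neg k) (divPow 𝒦 p n α) * pd 𝒦 p n (.pos k) (divPow 𝒦 p n β) -
        pd 𝒦 p n (.pos k) (divPow 𝒦 p n α) * pd 𝒦 p n (.neg k) (divPow 𝒦 p n β) := by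
  refine Finset.sum_eq_single k (fun i _ hi => ?_) (by simp)
  rw [pd_mul_pd 𝒦 p n (by simp) (h i hi).2 (h i hi).1 hβ, sub_self]

theorem euler_divPow (α : Idx n → ℕ) : euler 𝒦 p n (divPow 𝒦 p n α) =
    (∑ i : Fin n, ((α (.pos i) : 𝒦) + α (.neg i))) • divPow 𝒦 p n α := by
  rw [euler_apply, Finset.sum_smul]
  exact Finset.sum_congr rfl fun i _ => by rw [xvar_mul_pd_divPow, xvar_mul_pd_divPow, add_smul]

/-- A monomial f equals x_j D_j f / α_j, and x_j D_j multiplies D_j f by α_j - 1. From here come the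
relations D v = c v² on which the nilpotency criteria rest. -/
theorem divPow_mul_pd_pd {α : Idx n → ℕ} (hα : ∀ i, α i < p) {j : Idx n} (h : 0 < α j) :
    divPow 𝒦 p n α * pd 𝒦 p n j (pd 𝒦 p n j (divPow 𝒦 p n α)) =
      ((α j : 𝒦)⁻¹ * ((α j : 𝒦) - 1)) • pd 𝒦 p n j (divPow 𝒦 p n α) ^ 2 := by
  have h0 := cast_ne_zero_of_pos 𝒦 p h (hα j)
  have h1 := xvar_mul_pd_divPow 𝒦 p n α j
  have h2 : xvar 𝒦 p n j * pd 𝒦 p n j (pd 𝒦 p n j (divPow 𝒦 p n α)) =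
      ((α j : 𝒦) - 1) • pd 𝒦 p n j (divPow 𝒦 p n α) := by
    rw [pd_divPow_of_pos 𝒦 p n h (hα j), xvar_mul_pd_divPow]
    simp [Nat.cast_sub h]
  rw [mul_smul, eq_inv_smul_iff₀ h0, ← smul_mul_assoc, ← h1, sq, ← smul_mul_assoc, ← h2]
  ring

variable {𝒦 p n} in
theorem contactD_apply_of_agree {f g : TruncPoly 𝒦 p n} {s c : 𝒦} (hf : euler 𝒦 p n f = s • f)
    (hg : euler 𝒦 p n g = c • g) (h0 : f * pd 𝒦 p n .zero g = pd 𝒦 p n .zero f * g) :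
    contactD 𝒦 p n f g = (2 - s + c) • (pd 𝒦 p n .zero f * g) + pois 𝒦 p n f g := by
  rw [contactD_apply, hf, hg]
  simp only [Algebra.smul_def, map_add, map_sub, map_ofNat]
  linear_combination (2 - algebraMap 𝒦 (TruncPoly 𝒦 p n) s) * h0

/-- The `p`-th power of `D_K(x^(α))` kills `x_j`, where `j = ±k`; here `j' = -j`, and `σ` is the sign
of `j`. -/
theorem contactD_divPow_pow_inr {α : Idx n → ℕ} (hα : ∀ i, α i < p) {k : Fin n} {j j' : Fin n ⊕ Fin n}
    {σ : 𝒦} (hσ : σ ≠ 0)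
    (hjk : j = .inl k ∧ j' = .inr k ∨ j = .inr k ∧ j' = .inl k)
    (hx : contactD 𝒦 p n (divPow 𝒦 p n α) (xvar 𝒦 p n (.inr j)) =
      pd 𝒦 p n .zero (divPow 𝒦 p n α) * xvar 𝒦 p n (.inr j) +
        σ • pd 𝒦 p n (.inr j') (divPow 𝒦 p n α))
    {c : 𝒦} (hv : contactD 𝒦 p n (divPow 𝒦 p n α) (pd 𝒦 p n .zero (divPow 𝒦 p n α)) =
      c • pd 𝒦 p n .zero (divPow 𝒦 p n α) ^ 2)
    (hvp : pd 𝒦 p n .zero (divPow 𝒦 p n α) ^ p = 0) (hαH : α ≠ idxH k) :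
    ((contactD 𝒦 p n (divPow 𝒦 p n α) : TruncPoly 𝒦 p n →ₗ[𝒦] TruncPoly 𝒦 p n) ^ p :
      Module.End 𝒦 (TruncPoly 𝒦 p n)) (xvar 𝒦 p n (.inr j)) = 0 := by
  have hjj : (.inr j : Idx n) ≠ .inr j' := by rcases hjk with ⟨rfl, rfl⟩ | ⟨rfl, rfl⟩ <;> simp
  -- For monomials agreeing with α outside x_k and x_{-k} only the k-th Poisson term survives; the
  -- sign τ records which of j, j' is positive.
  have hP : ∃ τ : 𝒦, ∀ β : Idx n → ℕ, (∀ i, β i < p) →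
      (∀ i, i ≠ .inr j → i ≠ .inr j' → α i = β i) →
      pois 𝒦 p n (divPow 𝒦 p n α) (divPow 𝒦 p n β) = τ •
        (pd 𝒦 p n (.inr j') (divPow 𝒦 p n α) * pd 𝒦 p n (.inr j) (divPow 𝒦 p n β) -
        pd 𝒦 p n (.inr j) (divPow 𝒦 p n α) * pd 𝒦 p n (.inr j') (divPow 𝒦 p n β)) := by
    rcases hjk with ⟨rfl, rfl⟩ | ⟨rfl, rfl⟩
    · exact ⟨1, fun β hβ h => by
        rw [pois_divPow_of_ne 𝒦 p n hβ k fun i hi => ⟨h _ (by simpa) (by simp), h _ (by simp) (by simpa)⟩,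
          one_smul]⟩
    · exact ⟨-1, fun β hβ h => by
        rw [pois_divPow_of_ne 𝒦 p n hβ k fun i hi => ⟨h _ (by simp) (by simpa), h _ (by simpa) (by simp)⟩,
          neg_one_smul, neg_sub]⟩
  obtain ⟨τ, hτ⟩ := hP
  set f := divPow 𝒦 p n α with hfdef
  set s : 𝒦 := ∑ i : Fin n, ((α (.pos i) : 𝒦) + α (.neg i)) with hs
  have hf : euler 𝒦 p n f = s • f := euler_divPow 𝒦 p n α
  have hE : ∀ (i : Fin n ⊕ Fin n) (g : TruncPoly 𝒦 p n) (c : 𝒦), euler 𝒦 p n g = c • g →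
      euler 𝒦 p n (pd 𝒦 p n (.inr i) g) = (c - 1) • pd 𝒦 p n (.inr i) g := by
    intro i g c hg
    have := pd_euler_inr 𝒦 p n i g
    rw [hg, Derivation.map_smul] at this
    rw [sub_smul, one_smul, this, add_sub_cancel_right]
  -- With v = D₀f, the derivation sends x_j to v x_j + σ D_{j'} f. The second term vanishes if
  -- α_{j'} = 0, and it is multiplied by v under the derivation if α_j = 0. If both exponents are
  -- positive, it is a multiple of x_j.
  by_cases h0 : α (.inr j') = 0
  · rw [pd_divPow_of_zero 𝒦 p n h0, smul_zero] at hx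
    exact derivation_pow_eq_zero_of_add p _ hv (u := 0) (by simp) hx hvp
  have hj' := Nat.pos_of_ne_zero h0
  have hF := pd_divPow_of_pos 𝒦 p n hj' (hα _)
  have hβ : ∀ i, (α - Pi.single (.inr j') 1 : Idx n → ℕ) i < p :=
    fun i => lt_of_le_of_lt (Nat.sub_le _ _) (hα i)
  have hβ0 : ∀ i : Idx n, i ≠ .inr j' → α i = (α - Pi.single (.inr j') 1 : Idx n → ℕ) i := fun i hi => by
    simp [Pi.single_eq_of_ne hi]
  by_cases h1 : α (.inr j) = 0
  · refine derivation_pow_eq_zero_of_add p _ hv ?_ hx hvp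
    rw [Derivation.map_smul, contactD_apply_of_agree hf (hE j' f s hf), hF,
      hτ _ hβ fun i _ hi => hβ0 i hi, pd_divPow_of_zero 𝒦 p n h1,
      pd_divPow_of_zero 𝒦 p n ((hβ0 _ hjj).symm.trans h1)]
    · rw [mul_zero, zero_mul, sub_zero, smul_zero, add_zero, show 2 - s + (s - 1) = 1 by ring, one_smul,
        mul_smul_comm]
    · rw [hF]; exact divPow_mul_pd 𝒦 p n (hβ0 _ (by simp))
  have hj := Nat.pos_of_ne_zero h1
  have hG := pd_divPow_of_pos 𝒦 p n hj (hα _)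
  set w := pd 𝒦 p n (.inr j) (pd 𝒦 p n (.inr j') f) with hw
  have hw1 : w = divPow 𝒦 p n (α - Pi.single (.inr j') 1 - Pi.single (.inr j) 1) := by
    rw [hw, hF, pd_divPow_of_pos 𝒦 p n _ (hβ _)]
    rw [← hβ0 _ hjj]; exact hj
  have hw2 : w = pd 𝒦 p n (.inr j') (pd 𝒦 p n (.inr j) f) := pd_comm 𝒦 p n _ _ _
  have hγ : ∀ i, (α - Pi.single (.inr j') 1 - Pi.single (.inr j) 1 : Idx n → ℕ) i < p :=
    fun i => lt_of_le_of_lt (Nat.sub_le _ _) (hβ i)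
  -- w is a divided power monomial, hence nilpotent unless it is constant, which would force α to be
  -- the excluded index ε_k + ε_{-k}.
  have hwp : w ^ p = 0 := by
    rw [hw1]
    refine divPow_pow 𝒦 p n fun hc => hαH (funext fun i => ?_)
    have hci := congrFun hc i
    have hH : idxH k = Pi.single (.inr j) 1 + Pi.single (.inr j') 1 := by
      rcases hjk with ⟨rfl, rfl⟩ | ⟨rfl, rfl⟩
      · rfl
      · exact add_comm _ _
    rw [hH]
    simp only [Pi.sub_apply, Pi.zero_apply, Pi.add_apply, Pi.single_apply] at hci ⊢
    by_cases e1 : i = .inr j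
    · subst e1; simp only [if_neg hjj, if_true] at hci ⊢; omega
    · by_cases e2 : i = .inr j'
      · subst e2; simp only [if_neg e1, if_true] at hci ⊢; omega
      · simp only [if_neg e1, if_neg e2] at hci ⊢; omega
  have hpw : ∃ e : 𝒦, contactD 𝒦 p n f w = e • w ^ 2 := by
    have t1 := divPow_mul_pd_pd 𝒦 p n hβ (j := .inr j) (by rw [← hβ0 _ hjj]; exact hj)
    have t2 := divPow_mul_pd_pd 𝒦 p n (α := α - Pi.single (.inr j) 1)
      (fun i => lt_of_le_of_lt (Nat.sub_le _ _) (hα i)) (j := .inr j')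
      (by simpa [Pi.single_eq_of_ne hjj.symm] using hj')
    rw [← hF, ← hfdef, ← hw] at t1
    rw [← hG, ← hfdef, ← hw2] at t2
    have t3 := hτ _ hγ fun i hi hi' => by simp [Pi.single_eq_of_ne hi, Pi.single_eq_of_ne hi']
    rw [← hw1, t1, t2, ← sub_smul, smul_smul] at t3
    obtain ⟨e, t3⟩ : ∃ e : 𝒦, pois 𝒦 p n f w = e • w ^ 2 := ⟨_, t3⟩
    refine ⟨e, ?_⟩
    rw [contactD_apply_of_agree hf (hE j _ _ (hE j' f s hf)), t3, show 2 - s + (s - 1 - 1) = 0 by ring,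
      zero_smul, zero_add]
    rw [← hw, hw1]
    exact divPow_mul_pd 𝒦 p n (by simp)
  obtain ⟨e, he⟩ := hpw
  have ha := cast_ne_zero_of_pos 𝒦 p hj (hα _)
  -- Since x_j w = α_j D_{j'} f, the term σ D_{j'} f is y x_j with y = (σ/α_j) w, so x_j is sent to
  -- (v + y) x_j.
  refine derivation_pow_eq_zero_of_eq_add p _ hv (y := (σ * (α (.inr j) : 𝒦)⁻¹) • w)
    (d := (σ * (α (.inr j) : 𝒦)⁻¹)⁻¹ * e) ?_ ?_ hvp (by rw [smul_pow, hwp, smul_zero])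
  · rw [Derivation.map_smul, he, smul_pow, smul_smul, smul_smul]
    congr 1
    field_simp
  · have t := xvar_mul_pd_divPow 𝒦 p n (α - Pi.single (.inr j') 1) (.inr j)
    rw [← hF, ← hfdef, ← hw, ← hβ0 _ hjj] at t
    rw [hx, add_mul, smul_mul_assoc, mul_comm w, t, smul_smul, mul_assoc, inv_mul_cancel₀ ha, mul_one]

variable {n} in
/-- The derivation `D_K(x^(α))` as a linear map. -/
def contactEnd (α : Idx n → ℕ) : Module.End 𝒦 (TruncPoly 𝒦 p n) :=
  (contactD 𝒦 p n (divPow 𝒦 p n α) : TruncPoly 𝒦 p n →ₗ[𝒦] TruncPoly 𝒦 p n)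

theorem derivation_eq_of_xvar {D D' : Witt 𝒦 p n} (h : ∀ i, D (xvar 𝒦 p n i) = D' (xvar 𝒦 p n i)) :
    (D : TruncPoly 𝒦 p n →ₗ[𝒦] TruncPoly 𝒦 p n) = D' := by rw [witt_ext 𝒦 p n h]

/-- The p-th power is a derivation, so it suffices to treat the variables. The element v = D₀f
satisfies D v = c v², and v^p = 0 unless v is constant, which happens only for α = ε₀; the other
exclusion enters through the variables x_{±k}. -/
theorem contactEnd_pow_eq_zero {α : Idx n → ℕ} (hα : ∀ i, α i < p) (h0 : α ≠ eps .zero)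
    (hk : ∀ k, α ≠ idxH k) : contactEnd 𝒦 p α ^ p = 0 := by
  have hp := (Fact.out : p.Prime).two_le
  set D := contactD 𝒦 p n (divPow 𝒦 p n α) with hD
  have hf := euler_divPow 𝒦 p n α
  set f := divPow 𝒦 p n α with hfdef
  set s : 𝒦 := ∑ i : Fin n, ((α (.pos i) : 𝒦) + α (.neg i)) with hs
  set v := pd 𝒦 p n .zero f with hvdef
  have hvp : v ^ p = 0 := by
    rcases Nat.eq_zero_or_pos (α .zero) with h | h
    · rw [hvdef, pd_divPow_of_zero 𝒦 p n h, zero_pow (by omega)]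
    · rw [hvdef, pd_divPow_of_pos 𝒦 p n h (hα _)]
      refine divPow_pow 𝒦 p n fun hc => h0 (funext fun i => ?_)
      have hci := congrFun hc i
      simp only [eps, Pi.sub_apply, Pi.zero_apply, Pi.single_apply] at hci ⊢
      by_cases e : i = .zero
      · subst e; simp at hci ⊢; omega
      · simp only [if_neg e] at hci ⊢; omega
  have hv : ∃ c : 𝒦, D v = c • v ^ 2 := by
    rcases Nat.eq_zero_or_pos (α .zero) with h | h
    · exact ⟨0, by rw [hvdef, pd_divPow_of_zero 𝒦 p n h]; simp⟩
    · have h1 := divPow_mul_pd_pd 𝒦 p n hα h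
      have h2 : pois 𝒦 p n f v = 0 := by
        rw [hvdef, pd_divPow_of_pos 𝒦 p n h (hα _)]
        exact pois_divPow 𝒦 p n (fun i => lt_of_le_of_lt (Nat.sub_le _ _) (hα i)) fun j => by simp
      refine ⟨(2 - s) * ((α .zero : 𝒦)⁻¹ * ((α .zero : 𝒦) - 1)) + s, ?_⟩
      have h3 : euler 𝒦 p n v = s • v := by
        rw [hvdef, ← pd_euler_zero, hf, Derivation.map_smul]
      rw [hD, contactD_apply, hf, h2, h3, add_smul, mul_smul, ← h1]
      simp only [Algebra.smul_def, map_sub, map_ofNat]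
      ring
  obtain ⟨c, hv⟩ := hv
  have key : ∀ i, (contactEnd 𝒦 p α ^ p) (xvar 𝒦 p n i) = 0 := by
    rintro (⟨⟩ | i | i)
    -- Here D x₀ = (2 - s) f and D f = 2 v f. Since f is either free of x₀ or a multiple of x₀ v,
    -- the product v^(p-1) f vanishes.
    · refine derivation_pow_eq_zero_of_eq_smul p D (f := f) (b := 2) (e := 2 - s) hv ?_ ?_ ?_
      · rw [hD, contactD_apply_of_agree hf hf (mul_comm _ _), pois_divPow 𝒦 p n hα fun _ => rfl,
          add_zero, sub_add_cancel]
      · rw [hD]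
        refine (contactD_xzero 𝒦 p n f).trans ?_
        rw [hf, sub_smul, Algebra.smul_def 2, map_ofNat]
      · rcases Nat.eq_zero_or_pos (α .zero) with h | h
        · rw [hvdef, pd_divPow_of_zero 𝒦 p n h, zero_pow (by omega), zero_mul]
        · have ha := cast_ne_zero_of_pos 𝒦 p h (hα _)
          have h1 := xvar_mul_pd_divPow 𝒦 p n α .zero
          rw [← hfdef, ← hvdef] at h1
          have h2 : f = (α .zero : 𝒦)⁻¹ • (xvar 𝒦 p n .zero * v) := by
            rw [h1, smul_smul, inv_mul_cancel₀ ha, one_smul]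
          rw [h2, mul_smul_comm, mul_left_comm, ← pow_succ, Nat.sub_add_cancel (by omega), hvp, mul_zero,
            smul_zero]
    · refine contactD_divPow_pow_inr 𝒦 p n hα (k := i) (j' := .inr i) one_ne_zero (.inl ⟨rfl, rfl⟩)
        ?_ hv hvp (hk i)
      rw [one_smul]; exact contactD_xpos 𝒦 p n f i
    · refine contactD_divPow_pow_inr 𝒦 p n hα (k := i) (j' := .inl i) (neg_ne_zero.2 one_ne_zero)
        (.inr ⟨rfl, rfl⟩) ?_ hv hvp (hk i)
      rw [neg_one_smul, ← sub_eq_add_neg]; exact contactD_xneg 𝒦 p n f i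
  exact derivation_eq_of_xvar 𝒦 p n (D := derivationPow p D) (D' := 0) fun i => key i

theorem derivation_pow_eq_self {D : Witt 𝒦 p n} (c : Idx n → 𝒦) (hc : ∀ i, c i ^ p = c i)
    (h : ∀ i, D (xvar 𝒦 p n i) = c i • xvar 𝒦 p n i) :
    ((D : TruncPoly 𝒦 p n →ₗ[𝒦] TruncPoly 𝒦 p n) ^ p : Module.End 𝒦 (TruncPoly 𝒦 p n)) = D := by
  refine derivation_eq_of_xvar 𝒦 p n (D := derivationPow p D) (D' := D) fun i => ?_
  have : ∀ m : ℕ, ((D : TruncPoly 𝒦 p n →ₗ[𝒦] TruncPoly 𝒦 p n) ^ m : Module.End 𝒦 (TruncPoly 𝒦 p n))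
      (xvar 𝒦 p n i) = c i ^ m • xvar 𝒦 p n i := by
    intro m
    induction m with
    | zero => simp
    | succ m ih =>
      rw [pow_succ', Module.End.mul_apply, ih, map_smul, pow_succ, mul_smul, ← h]; rfl
  rw [derivationPow_apply, this, hc, h]

theorem divPow_eps (i : Idx n) : divPow 𝒦 p n (eps i) = xvar 𝒦 p n i := by
  rw [divPow, Finset.prod_eq_single i]
  · simp [eps]
  · intro j _ hj; simp [eps, Pi.single_eq_of_ne hj]
  · simp

theorem divPow_idxH (k : Fin n) : divPow 𝒦 p n (idxH k) = xvar 𝒦 p n (.pos k) * xvar 𝒦 p n (.neg k) := by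
  rw [divPow]
  have : ∀ i : Idx n, ((idxH k i).factorial : 𝒦)⁻¹ • xvar 𝒦 p n i ^ idxH k i =
      (if i = .pos k then xvar 𝒦 p n (.pos k) else 1) *
        if i = .neg k then xvar 𝒦 p n (.neg k) else 1 := by
    intro i
    by_cases h1 : i = .pos k
    · subst h1; simp [idxH, eps]
    · by_cases h2 : i = .neg k
      · subst h2; simp [idxH, eps]
      · simp only [idxH, eps, Pi.add_apply, Pi.single_apply, if_neg h1, if_neg h2]; simp
  rw [Finset.prod_congr rfl fun i _ => this i, Finset.prod_mul_distrib]
  simp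

theorem contactEnd_eps_zero_pow : contactEnd 𝒦 p (eps (.zero : Idx n)) ^ p = contactEnd 𝒦 p (eps .zero) := by
  have h2 : ((2 : ℕ) : 𝒦) ^ p = ((2 : ℕ) : 𝒦) := by
    rw [← frobenius_def, map_natCast]
  -- D_K(x₀) = 2 x₀ D₀ + E is diagonal on the variables, with eigenvalue 2 on x₀ and 1 on the
  -- others, all in the prime field.
  refine derivation_pow_eq_self 𝒦 p n (fun i => if i = .zero then ((2 : ℕ) : 𝒦) else 1) (fun i => ?_) ?_
  · split_ifs
    · exact h2
    · exact one_pow p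
  · rw [divPow_eps]
    rintro (⟨⟩ | i | i)
    · refine (contactD_xzero 𝒦 p n _).trans ?_
      rw [if_pos rfl, Nat.cast_smul_eq_nsmul, two_nsmul, two_mul]
      simp [euler_apply, pd_xvar]
    · refine (contactD_xpos 𝒦 p n _ i).trans ?_
      simp [pd_xvar]
    · refine (contactD_xneg 𝒦 p n _ i).trans ?_
      simp [pd_xvar]

theorem contactD_idxH_xvar (k : Fin n) (i : Idx n) :
    contactD 𝒦 p n (divPow 𝒦 p n (idxH k)) (xvar 𝒦 p n i) =
      ((if i = .pos k then 1 else 0) - (if i = .neg k then 1 else 0) : 𝒦) • xvar 𝒦 p n i := by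
  rw [divPow_idxH]
  rcases i with ⟨⟩ | i | i
  · refine (contactD_xzero 𝒦 p n _).trans ?_
    have : euler 𝒦 p n (xvar 𝒦 p n (.pos k) * xvar 𝒦 p n (.neg k)) =
        2 * (xvar 𝒦 p n (.pos k) * xvar 𝒦 p n (.neg k)) := by
      simp [euler_apply, pd_xvar]
      ring
    rw [this]; simp
  · refine (contactD_xpos 𝒦 p n _ i).trans ?_
    by_cases h : i = k
    · subst h; simp [pd_xvar]
    · simp [pd_xvar, h, Ne.symm h]
  · refine (contactD_xneg 𝒦 p n _ i).trans ?_
    by_cases h : i = k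
    · subst h; simp [pd_xvar]
    · simp [pd_xvar, h, Ne.symm h]

theorem contactEnd_idxH_pow (k : Fin n) : contactEnd 𝒦 p (idxH k) ^ p = contactEnd 𝒦 p (idxH k) := by
  refine derivation_pow_eq_self 𝒦 p n _ (fun i => ?_) (contactD_idxH_xvar 𝒦 p n k)
  have hp := (Fact.out : p.Prime).pos
  rw [sub_pow_char]
  split_ifs <;> simp [hp.ne']

end ContactPower

/-! ### The universal property of the restricted enveloping algebra -/

section RestrictedLift
attribute [local instance] LieRing.ofAssociativeRing

variable (𝒦 : Type*) [Field 𝒦] (p n : ℕ) [CharP 𝒦 p]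

/-- The canonical map of the contact algebra to its restricted enveloping algebra. -/
def restrictedι : ContactAlg 𝒦 p n →ₗ[𝒦] RestrictedU 𝒦 p n where
  toFun x := RingQuot.mkAlgHom 𝒦 (RestrictedRel 𝒦 p n) (UniversalEnvelopingAlgebra.ι 𝒦 x)
  map_add' x y := by rw [map_add, map_add]; rfl
  map_smul' c x := by rw [map_smul, map_smul]; rfl

theorem restrictedι_contactGen (α : Idx n → ℕ) :
    restrictedι 𝒦 p n (contactGen 𝒦 p n α) = genU 𝒦 p n α := rfl

theorem restrictedι_lie (x y : ContactAlg 𝒦 p n) : restrictedι 𝒦 p n ⁅x, y⁆ =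
    restrictedι 𝒦 p n x * restrictedι 𝒦 p n y - restrictedι 𝒦 p n y * restrictedι 𝒦 p n x := by
  have h := (UniversalEnvelopingAlgebra.ι 𝒦 : ContactAlg 𝒦 p n →ₗ⁅𝒦⁆ _).map_lie x y
  rw [LieRing.of_associative_ring_bracket] at h
  have h' := congrArg (RingQuot.mkAlgHom 𝒦 (RestrictedRel 𝒦 p n)) h
  rw [map_sub, map_mul, map_mul] at h'
  exact h'

theorem genU_eps_zero_pow : genU 𝒦 p n (eps .zero) ^ p = genU 𝒦 p n (eps .zero) := by
  have := RingQuot.mkAlgHom_rel 𝒦 (RestrictedRel.zero (𝒦 := 𝒦) (p := p) (n := n))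
  rwa [map_pow] at this

theorem genU_idxH_pow (k : Fin n) : genU 𝒦 p n (idxH k) ^ p = genU 𝒦 p n (idxH k) := by
  have := RingQuot.mkAlgHom_rel 𝒦 (RestrictedRel.toral (𝒦 := 𝒦) (p := p) (n := n) k)
  rwa [map_pow] at this

theorem genU_pow_eq_zero {α : Idx n → ℕ} (hα : Admissible p n α) (h0 : α ≠ eps .zero)
    (hk : ∀ k, α ≠ idxH k) : genU 𝒦 p n α ^ p = 0 := by
  have := RingQuot.mkAlgHom_rel 𝒦 (RestrictedRel.nil (𝒦 := 𝒦) (p := p) (n := n) α hα h0 hk)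
  rwa [map_pow, map_zero] at this

/-- A linear map of the contact algebra into an associative algebra that respects brackets and the
`p`-map of the basis. -/
structure RestrictedMap (V : Type*) [Ring V] [Algebra 𝒦 V] extends ContactAlg 𝒦 p n →ₗ[𝒦] V where
  lie x y : toLinearMap ⁅x, y⁆ =
    toLinearMap x * toLinearMap y - toLinearMap y * toLinearMap x
  zero_pow : toLinearMap (contactGen 𝒦 p n (eps .zero)) ^ p =
    toLinearMap (contactGen 𝒦 p n (eps .zero))
  toral_pow k : toLinearMap (contactGen 𝒦 p n (idxH k)) ^ p =
    toLinearMap (contactGen 𝒦 p n (idxH k))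
  nil_pow α : Admissible p n α → α ≠ eps .zero → (∀ k, α ≠ idxH k) →
    toLinearMap (contactGen 𝒦 p n α) ^ p = 0

variable {𝒦 p n} {V : Type*} [Ring V] [Algebra 𝒦 V]

/-- The universal property of the restricted enveloping algebra. -/
def RestrictedMap.lift (φ : RestrictedMap 𝒦 p n V) : RestrictedU 𝒦 p n →ₐ[𝒦] V :=
  RingQuot.liftAlgHom 𝒦 ⟨UniversalEnvelopingAlgebra.lift 𝒦
    ({ φ.toLinearMap with map_lie' := fun {x y} => φ.lie x y } : ContactAlg 𝒦 p n →ₗ⁅𝒦⁆ V), by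
      intro x y h
      induction h with
      | zero => rw [map_pow, UniversalEnvelopingAlgebra.lift_ι_apply]; exact φ.zero_pow
      | toral k => rw [map_pow, UniversalEnvelopingAlgebra.lift_ι_apply]; exact φ.toral_pow k
      | nil α hα h0 hk => rw [map_pow, UniversalEnvelopingAlgebra.lift_ι_apply, map_zero]; exact φ.nil_pow α hα h0 hk⟩

theorem RestrictedMap.lift_restrictedι (φ : RestrictedMap 𝒦 p n V) (x : ContactAlg 𝒦 p n) :
    φ.lift (restrictedι 𝒦 p n x) = φ.toLinearMap x := by
  refine (RingQuot.liftAlgHom_mkAlgHom_apply (S := 𝒦) (s := RestrictedRel 𝒦 p n) _ _ _).trans ?_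
  exact UniversalEnvelopingAlgebra.lift_ι_apply 𝒦 _ x

theorem restrictedU_hom_ext {f g : RestrictedU 𝒦 p n →ₐ[𝒦] V}
    (h : ∀ x, f (restrictedι 𝒦 p n x) = g (restrictedι 𝒦 p n x)) : f = g := by
  refine RingQuot.ringQuot_ext' 𝒦 _ _ (UniversalEnvelopingAlgebra.hom_ext 𝒦 (LieHom.ext fun x => ?_))
  exact h x

variable (𝒦 p n)

/-- The canonical map already takes values in the subalgebra S generated by its image. It therefore
lifts to a homomorphism into S, and composing with the inclusion of S gives the identity. -/
theorem adjoin_restrictedι :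
    Algebra.adjoin 𝒦 (LinearMap.range (restrictedι 𝒦 p n) : Set (RestrictedU 𝒦 p n)) = ⊤ := by
  set S := Algebra.adjoin 𝒦 (LinearMap.range (restrictedι 𝒦 p n) : Set (RestrictedU 𝒦 p n))
  have hmem : ∀ x, restrictedι 𝒦 p n x ∈ S := fun x => Algebra.subset_adjoin ⟨x, rfl⟩
  let φ : RestrictedMap 𝒦 p n S :=
    { toLinearMap := (restrictedι 𝒦 p n).codRestrict (Subalgebra.toSubmodule S) hmem
      lie := fun x y => Subtype.ext (restrictedι_lie 𝒦 p n x y)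
      zero_pow := Subtype.ext (genU_eps_zero_pow 𝒦 p n)
      toral_pow := fun k => Subtype.ext (genU_idxH_pow 𝒦 p n k)
      nil_pow := fun α hα h0 hk => Subtype.ext (genU_pow_eq_zero 𝒦 p n hα h0 hk) }
  have h : S.val.comp φ.lift = AlgHom.id 𝒦 _ := restrictedU_hom_ext fun x => by
    rw [AlgHom.comp_apply, φ.lift_restrictedι]; rfl
  rw [eq_top_iff]
  rintro x -
  have := AlgHom.congr_fun h x
  rw [← AlgHom.id_apply (R := 𝒦) x, ← this]
  exact (φ.lift x).2

end RestrictedLift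

/-! ### The dimension of the restricted enveloping algebra -/

section RestrictedBasis
variable (𝒦 : Type*) [Field 𝒦] (p n : ℕ) [Fact p.Prime] [CharP 𝒦 p]

variable {p} in
theorem Admissible.lt {α : Idx n → ℕ} (hα : Admissible p n α) (i : Idx n) : α i < p := by
  have := hα.1 i
  have := (Fact.out : p.Prime).pos
  omega

variable {p} in
theorem admissible_eps_zero (hp2 : p ≠ 2) : Admissible p n (eps .zero) := by
  have := (Fact.out : p.Prime).two_le
  refine ⟨fun i => ?_, fun _ h => ?_⟩
  · rw [eps, Pi.single_apply]; split_ifs <;> omega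
  · have := congrFun h .zero
    simp [eps] at this; omega

variable {p n} in
theorem admissible_idxH (k : Fin n) : Admissible p n (idxH k) := by
  have := (Fact.out : p.Prime).two_le
  refine ⟨fun i => ?_, fun _ h => ?_⟩
  · rw [idxH, eps, eps, Pi.add_apply, Pi.single_apply, Pi.single_apply]; split_ifs <;> simp_all <;> omega
  · have := congrFun h .zero
    simp [idxH, eps] at this; omega

variable {p n} in
theorem admissible_idxE (hp2 : p ≠ 2) (k : Fin n) : Admissible p n (idxE k) := by
  have := (Fact.out : p.Prime).two_le
  refine ⟨fun i => ?_, fun _ h => ?_⟩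
  · rw [idxE, eps, eps, Pi.add_apply, Pi.smul_apply, Pi.single_apply, Pi.single_apply]
    split_ifs <;> simp_all <;> omega
  · have := congrFun h .zero
    simp [idxE, eps] at this; omega

/-- The action of the contact algebra on `O(2n+1; 1)`. -/
def contactAction : ContactAlg 𝒦 p n →ₗ[𝒦] Module.End 𝒦 (TruncPoly 𝒦 p n) where
  toFun x := (((x : contactPrime 𝒦 p n) : Witt 𝒦 p n) : TruncPoly 𝒦 p n →ₗ[𝒦] TruncPoly 𝒦 p n)
  map_add' _ _ := rfl
  map_smul' _ _ := rfl

theorem contactAction_injective : Function.Injective (contactAction 𝒦 p n) := fun _ _ h =>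
  Subtype.ext (Subtype.ext (DFunLike.ext _ _ fun f => LinearMap.congr_fun h f))

theorem contactAction_lie (x y : ContactAlg 𝒦 p n) : contactAction 𝒦 p n ⁅x, y⁆ =
    contactAction 𝒦 p n x * contactAction 𝒦 p n y -
      contactAction 𝒦 p n y * contactAction 𝒦 p n x := by
  refine LinearMap.ext fun f => ?_
  exact Derivation.commutator_apply (D1 := ((x : contactPrime 𝒦 p n) : Witt 𝒦 p n))
    (D2 := ((y : contactPrime 𝒦 p n) : Witt 𝒦 p n)) f

variable {p}

theorem contactAction_contactGen (hp2 : p ≠ 2) {α : Idx n → ℕ} (hα : Admissible p n α) :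
    contactAction 𝒦 p n (contactGen 𝒦 p n α) = contactEnd 𝒦 p α := by
  have := contactGen_coe 𝒦 p n Fact.out hp2 α hα
  exact congrArg (fun D : Witt 𝒦 p n => (D : TruncPoly 𝒦 p n →ₗ[𝒦] TruncPoly 𝒦 p n)) this

/-- The action of the contact algebra on `O(2n+1; 1)` is restricted. -/
def contactRestrictedMap (hp2 : p ≠ 2) :
    RestrictedMap 𝒦 p n (Module.End 𝒦 (TruncPoly 𝒦 p n)) where
  toLinearMap := contactAction 𝒦 p n
  lie := contactAction_lie 𝒦 p n
  zero_pow := by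
    rw [contactAction_contactGen 𝒦 n hp2 (admissible_eps_zero n hp2), contactEnd_eps_zero_pow]
  toral_pow k := by
    rw [contactAction_contactGen 𝒦 n hp2 (admissible_idxH k), contactEnd_idxH_pow]
  nil_pow α hα h0 hk := by
    rw [contactAction_contactGen 𝒦 n hp2 hα, contactEnd_pow_eq_zero 𝒦 p n (hα.lt n) h0 hk]

/-- The action of the contact algebra on the polynomial functions on matrices. -/
def matrixRestrictedMap (hp2 : p ≠ 2) :
    RestrictedMap 𝒦 p n
      (Module.End 𝒦 (MvPolynomial ((Idx n → Fin p) × (Idx n → Fin p)) 𝒦)) :=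
  let δ : Module.End 𝒦 (TruncPoly 𝒦 p n) →ₗ[𝒦]
      Module.End 𝒦 (MvPolynomial ((Idx n → Fin p) × (Idx n → Fin p)) 𝒦) :=
    { toFun T := (matrixDerivation (divPowBasis 𝒦 p n) T : _ →ₗ[𝒦] _)
      map_add' S T := by rw [map_add]; rfl
      map_smul' c T := by rw [map_smul]; rfl }
  have hδ : ∀ S T, δ (S * T - T * S) = δ S * δ T - δ T * δ S := fun S T =>
    LinearMap.ext fun f => by
      change matrixDerivation _ _ f = _
      rw [matrixDerivation_lie, Derivation.commutator_apply]; rfl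
  have hδp : ∀ T, δ T ^ p = δ (T ^ p) := matrixDerivation_pow (divPowBasis 𝒦 p n) p
  let φ := contactRestrictedMap 𝒦 n hp2
  { toLinearMap := δ ∘ₗ φ.toLinearMap
    lie x y := by
      rw [LinearMap.comp_apply, φ.lie, hδ]; rfl
    zero_pow := by
      rw [LinearMap.comp_apply, hδp, φ.zero_pow]
    toral_pow k := by
      rw [LinearMap.comp_apply, hδp, φ.toral_pow]
    nil_pow α hα h0 hk := by
      rw [LinearMap.comp_apply, hδp, φ.nil_pow α hα h0 hk, map_zero] }

/-- Spanning is the straightening argument. For independence, End O(2n+1) has too small a dimension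
to separate the ordered monomials, so the action on polynomial functions on matrices is used
instead. -/
theorem finrank_restrictedU (hp2 : p ≠ 2) :
    Module.finrank 𝒦 (RestrictedU 𝒦 p n) = p ^ Nat.card (AdmIdx p n) := by
  classical
  set b : AdmIdx p n → RestrictedU 𝒦 p n := fun α => genU 𝒦 p n fun i => α.1 i with hb
  set l : List (AdmIdx p n) := Finset.univ.toList
  have hl : l.Nodup := Finset.nodup_toList _
  have hmem : ∀ i, i ∈ l := fun i => Finset.mem_toList.2 (Finset.mem_univ i)
  have hspan : Submodule.span 𝒦 (Set.range fun c : AdmIdx p n → Fin p =>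
      orderedMonomial b l fun i => c i) = ⊤ := by
    refine span_orderedMonomial (V := LinearMap.range (restrictedι 𝒦 p n))
      (Fact.out : p.Prime).two_le ?_ ?_ (fun α => ?_) hl hmem (adjoin_restrictedι 𝒦 p n)
    · rintro _ ⟨x, rfl⟩ _ ⟨y, rfl⟩
      exact ⟨_, restrictedι_lie 𝒦 p n x y⟩
    · rw [LinearMap.range_eq_map, ← span_contactGen 𝒦 n hp2, Submodule.map_span, ← Set.range_comp]
      rfl
    · by_cases h0 : (fun i => (α.1 i : ℕ)) = eps .zero
      · simp only [hb, h0, genU_eps_zero_pow]; exact ⟨_, rfl⟩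
      · by_cases hk : ∃ k, (fun i => (α.1 i : ℕ)) = idxH k
        · obtain ⟨k, hk⟩ := hk
          simp only [hb, hk, genU_idxH_pow]; exact ⟨_, rfl⟩
        · push Not at hk
          simp only [hb, genU_pow_eq_zero 𝒦 p n α.2 h0 hk]; exact Submodule.zero_mem _
  have hT := (linearIndependent_contactGen 𝒦 n hp2).map' (contactAction 𝒦 p n)
    (LinearMap.ker_eq_bot.2 (contactAction_injective 𝒦 p n))
  set T : AdmIdx p n → Module.End 𝒦 (TruncPoly 𝒦 p n) :=
    contactAction 𝒦 p n ∘ fun α => contactGen 𝒦 p n fun i => α.1 i with hTdef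
  -- P extends the coordinates dual to the operators of the basis to all endomorphisms; composed
  -- with `cotangent` it gives functions dual to the vector fields at the identity matrix.
  obtain ⟨P, hP⟩ := LinearMap.exists_leftInverse_of_injective (Finsupp.linearCombination 𝒦 T)
    (LinearMap.ker_eq_bot.2 hT)
  have hP' : ∀ α, P (T α) = Finsupp.single α 1 := fun α => by
    have := LinearMap.congr_fun hP (Finsupp.single α 1)
    simpa using this
  have hind : LinearIndependent 𝒦 (fun c : AdmIdx p n → Fin p =>
      orderedMonomial b l fun i => c i) := by
    refine linearIndependent_orderedMonomial (p := p)
      (fun α => matrixDerivation (divPowBasis 𝒦 p n) (T α)) (evalIdentity 𝒦 (Idx n → Fin p))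
      (fun α => cotangent (divPowBasis 𝒦 p n) (Finsupp.lapply α ∘ₗ P)) (fun α => ?_) (fun α β => ?_)
      (matrixRestrictedMap 𝒦 n hp2).lift b (fun α => ?_) hl hmem
    · exact evalIdentity_cotangent _ _
    · rw [evalIdentity_matrixDerivation_cotangent, LinearMap.comp_apply, hP', Finsupp.lapply_apply,
        Finsupp.single_apply]
      simp only [eq_comm]
    · exact (matrixRestrictedMap 𝒦 n hp2).lift_restrictedι (contactGen 𝒦 p n fun i => α.1 i)
  have hfin := Module.finrank_eq_card_basis (Module.Basis.mk hind hspan.ge)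
  rw [hfin]
  simp

variable (q : 𝒦)

theorem truncBase_monic : ((Polynomial.X : Polynomial 𝒦) ^ p - Polynomial.C q * Polynomial.X).Monic := by
  refine Polynomial.monic_X_pow_sub (lt_of_le_of_lt (Polynomial.degree_C_mul_X_le q) ?_)
  exact_mod_cast (Fact.out : p.Prime).one_lt

theorem truncBase_natDegree :
    ((Polynomial.X : Polynomial 𝒦) ^ p - Polynomial.C q * Polynomial.X).natDegree = p := by
  rw [Polynomial.natDegree_sub_eq_left_of_natDegree_lt, Polynomial.natDegree_X_pow]
  rw [Polynomial.natDegree_X_pow]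
  exact lt_of_le_of_lt ((Polynomial.natDegree_C_mul_le q _).trans Polynomial.natDegree_X_le)
    (Fact.out : p.Prime).one_lt

theorem finrank_utq (hp2 : p ≠ 2) :
    Module.finrank 𝒦 (UTQ 𝒦 p n q) = p ^ (Nat.card (AdmIdx p n) + 1) := by
  have h : Module.finrank 𝒦 (TruncBase 𝒦 p q) = p := by
    rw [(AdjoinRoot.powerBasis' (truncBase_monic 𝒦 q)).finrank, AdjoinRoot.powerBasis'_dim,
      truncBase_natDegree]
  rw [Module.finrank_tensorProduct, h, finrank_restrictedU 𝒦 n hp2, pow_succ']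

end RestrictedBasis

/-! ### Hopf structures generated by primitive elements -/

section Primitive
variable {R A : Type*} [CommRing R] [Ring A] [Algebra R A]

/-- The antipode underlying an anti-endomorphism. -/
def antipodeOfOp (S : A →ₐ[R] Aᵐᵒᵖ) : A →ₗ[R] A :=
  (MulOpposite.opLinearEquiv R).symm.toLinearMap ∘ₗ S.toLinearMap

theorem antipodeOfOp_mul (S : A →ₐ[R] Aᵐᵒᵖ) (a b : A) :
    antipodeOfOp S (a * b) = antipodeOfOp S b * antipodeOfOp S a := by
  simp [antipodeOfOp]

theorem antipodeOfOp_algebraMap (S : A →ₐ[R] Aᵐᵒᵖ) (r : R) :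
    antipodeOfOp S (algebraMap R A r) = algebraMap R A r := by
  simp [antipodeOfOp]

/-- The Hopf algebra structure on an algebra generated by elements that are to be primitive. -/
def HopfStructure.ofPrimitive {X : Set A} (hX : Algebra.adjoin R X = ⊤) (Δ : A →ₐ[R] A ⊗[R] A)
    (ε : A →ₐ[R] R) (S : A →ₐ[R] Aᵐᵒᵖ) (hΔ : ∀ x ∈ X, Δ x = x ⊗ₜ 1 + 1 ⊗ₜ x)
    (hε : ∀ x ∈ X, ε x = 0) (hS : ∀ x ∈ X, S x = MulOpposite.op (-x)) : HopfStructure R A where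
  comul := Δ
  counit := ε
  antipode := antipodeOfOp S
  coassoc := AlgHom.ext_of_adjoin_eq_top hX fun x hx => by
    simp [hΔ x hx, TensorProduct.tmul_add, TensorProduct.add_tmul, Algebra.TensorProduct.one_def,
      add_assoc]
  counit_left := AlgHom.ext_of_adjoin_eq_top hX fun x hx => by simp [hΔ x hx, hε x hx]
  counit_right := AlgHom.ext_of_adjoin_eq_top hX fun x hx => by simp [hΔ x hx, hε x hx]
  antipode_left := by
    refine LinearMap.ext fun a => ?_
    have h : LinearMap.mul' R A ∘ₗ (antipodeOfOp S).rTensor A = sandwichLeft (antipodeOfOp S) 1 := by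
      ext; simp
    rw [← LinearMap.comp_assoc, h]
    change sandwichLeft (antipodeOfOp S) 1 (Δ a) = algebraMap R A (ε a)
    have ha : a ∈ Algebra.adjoin R X := hX ▸ Algebra.mem_top
    induction ha using Algebra.adjoin_induction with
    | mem x hx =>
      rw [hΔ x hx, hε x hx]
      simp [antipodeOfOp, hS x hx]
    | algebraMap r =>
      rw [AlgHom.commutes, AlgHom.commutes, Algebra.TensorProduct.algebraMap_apply, sandwichLeft_tmul,
        antipodeOfOp_algebraMap]
      simp
    | add x y _ _ hx hy => simp only [map_add, hx, hy]
    | mul x y _ _ hx hy =>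
      -- The action of Δ(x) on 1 gives the scalar ε(x), which comes out before Δ(y) acts; this makes
      -- the antipode axiom pass to products.
      rw [map_mul, sandwichLeft_mul (antipodeOfOp_mul S), hx, Algebra.algebraMap_eq_smul_one,
        sandwichLeft_smul, hy, map_mul, map_mul, Algebra.smul_def]
  antipode_right := by
    refine LinearMap.ext fun a => ?_
    have h : LinearMap.mul' R A ∘ₗ (antipodeOfOp S).lTensor A =
        sandwichRight (antipodeOfOp S) 1 := by
      ext; simp
    rw [← LinearMap.comp_assoc, h]
    change sandwichRight (antipodeOfOp S) 1 (Δ a) = algebraMap R A (ε a)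
    have ha : a ∈ Algebra.adjoin R X := hX ▸ Algebra.mem_top
    induction ha using Algebra.adjoin_induction with
    | mem x hx =>
      rw [hΔ x hx, hε x hx]
      simp [antipodeOfOp, hS x hx]
    | algebraMap r =>
      rw [AlgHom.commutes, AlgHom.commutes, Algebra.TensorProduct.algebraMap_apply,
        sandwichRight_tmul, ← map_one (algebraMap R A), antipodeOfOp_algebraMap]
      simp
    | add x y _ _ hx hy => simp only [map_add, hx, hy]
    | mul x y _ _ hx hy =>
      rw [map_mul, sandwichRight_mul (antipodeOfOp_mul S), hy, Algebra.algebraMap_eq_smul_one,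
        sandwichRight_smul, hx, map_mul, map_mul, Algebra.smul_def, Algebra.commutes]

/-- The two summands commute, so Frobenius is additive on them. This is why the primitive coproduct
respects the p-th power relations. -/
theorem tmul_add_tmul_pow_char (𝒦 : Type*) [Field 𝒦] (p : ℕ) [Fact p.Prime] [CharP 𝒦 p] [Algebra 𝒦 R]
    (a : A) : (a ⊗ₜ[R] (1 : A) + (1 : A) ⊗ₜ[R] a) ^ p = (a ^ p) ⊗ₜ[R] 1 + 1 ⊗ₜ[R] (a ^ p) := by
  let _ : Algebra 𝒦 (A ⊗[R] A) := Algebra.compHom _ (algebraMap 𝒦 R)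
  rcases subsingleton_or_nontrivial (A ⊗[R] A) with _ | _
  · exact Subsingleton.elim _ _
  have : CharP (A ⊗[R] A) p :=
    charP_of_injective_algebraMap (algebraMap 𝒦 (A ⊗[R] A)).injective p
  rw [add_pow_char_of_commute (R := A ⊗[R] A) p (by simp [commute_iff_eq])]
  simp [Algebra.TensorProduct.tmul_pow]

end Primitive

/-! ### The standard Hopf structure on u_{t,q}(K) -/

section StandardHopf
variable (𝒦 : Type*) [Field 𝒦] (p n : ℕ) (q : 𝒦) [CharP 𝒦 p]

/-- The canonical map of the contact algebra to `u_{t,q}(K(2n+1; 1))`. -/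
def utqι : ContactAlg 𝒦 p n →ₗ[𝒦] UTQ 𝒦 p n q :=
  (Algebra.TensorProduct.includeRight : RestrictedU 𝒦 p n →ₐ[𝒦] UTQ 𝒦 p n q).toLinearMap ∘ₗ
    restrictedι 𝒦 p n

theorem utqι_contactGen (α : Idx n → ℕ) :
    utqι 𝒦 p n q (contactGen 𝒦 p n α) = gen 𝒦 p n q α := rfl

theorem utqι_lie (x y : ContactAlg 𝒦 p n) : utqι 𝒦 p n q ⁅x, y⁆ =
    utqι 𝒦 p n q x * utqι 𝒦 p n q y - utqι 𝒦 p n q y * utqι 𝒦 p n q x := by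
  simp only [utqι, LinearMap.comp_apply, restrictedι_lie, map_sub, AlgHom.toLinearMap_apply, map_mul]

theorem gen_eps_zero_pow : gen 𝒦 p n q (eps .zero) ^ p = gen 𝒦 p n q (eps .zero) := by
  rw [gen, Algebra.TensorProduct.tmul_pow, one_pow, genU_eps_zero_pow]

theorem gen_idxH_pow (k : Fin n) : gen 𝒦 p n q (idxH k) ^ p = gen 𝒦 p n q (idxH k) := by
  rw [gen, Algebra.TensorProduct.tmul_pow, one_pow, genU_idxH_pow]

theorem gen_pow_eq_zero {α : Idx n → ℕ} (hα : Admissible p n α) (h0 : α ≠ eps .zero)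
    (hk : ∀ k, α ≠ idxH k) : gen 𝒦 p n q α ^ p = 0 := by
  rw [gen, Algebra.TensorProduct.tmul_pow, genU_pow_eq_zero 𝒦 p n hα h0 hk, TensorProduct.tmul_zero]

theorem adjoin_utqι : Algebra.adjoin (TruncBase 𝒦 p q)
    (Set.range (utqι 𝒦 p n q)) = ⊤ := by
  set S := Algebra.adjoin (TruncBase 𝒦 p q) (Set.range (utqι 𝒦 p n q)) with hS
  have h : (⊤ : Subalgebra 𝒦 (RestrictedU 𝒦 p n)) ≤
      (S.restrictScalars 𝒦).comap Algebra.TensorProduct.includeRight := by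
    rw [← adjoin_restrictedι, Algebra.adjoin_le_iff]
    rintro _ ⟨x, rfl⟩
    exact Algebra.subset_adjoin (R := TruncBase 𝒦 p q) ⟨x, rfl⟩
  rw [eq_top_iff]
  rintro x -
  induction x using TensorProduct.induction_on with
  | zero => exact S.zero_mem
  | add x y hx hy => exact S.add_mem hx hy
  | tmul r u =>
    have h1 : (1 : TruncBase 𝒦 p q) ⊗ₜ[𝒦] u ∈ S := h (x := u) trivial
    have := S.smul_mem h1 r
    rwa [TensorProduct.smul_tmul', smul_eq_mul, mul_one] at this

variable {𝒦 p n} in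
/-- The homomorphism on `u_{t,q}(K(2n+1; 1))` given by a restricted map. -/
def RestrictedMap.liftUTQ {V : Type*} [Ring V] [Algebra 𝒦 V] [Algebra (TruncBase 𝒦 p q) V]
    [IsScalarTower 𝒦 (TruncBase 𝒦 p q) V] (φ : RestrictedMap 𝒦 p n V) :
    UTQ 𝒦 p n q →ₐ[TruncBase 𝒦 p q] V :=
  Algebra.TensorProduct.lift (Algebra.ofId _ V) φ.lift fun r _ => Algebra.commutes r _

variable {𝒦 p n} in
theorem RestrictedMap.liftUTQ_utqι {V : Type*} [Ring V] [Algebra 𝒦 V] [Algebra (TruncBase 𝒦 p q) V]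
    [IsScalarTower 𝒦 (TruncBase 𝒦 p q) V] (φ : RestrictedMap 𝒦 p n V) (x : ContactAlg 𝒦 p n) :
    φ.liftUTQ q (utqι 𝒦 p n q x) = φ.toLinearMap x := by
  refine (Algebra.TensorProduct.lift_tmul ..).trans ?_
  rw [map_one, one_mul, φ.lift_restrictedι]

variable [Fact p.Prime]

/-- The comultiplication for which the contact algebra is primitive. -/
def comulRestrictedMap :
    RestrictedMap 𝒦 p n (UTQ 𝒦 p n q ⊗[TruncBase 𝒦 p q] UTQ 𝒦 p n q) where
  toFun x := utqι 𝒦 p n q x ⊗ₜ 1 + 1 ⊗ₜ utqι 𝒦 p n q x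
  map_add' x y := by rw [map_add, TensorProduct.add_tmul, TensorProduct.tmul_add]; abel
  map_smul' c x := by
    rw [map_smul, RingHom.id_apply, smul_add, TensorProduct.smul_tmul', TensorProduct.tmul_smul]
  lie x y := by
    simp only [LinearMap.coe_mk, AddHom.coe_mk, utqι_lie, TensorProduct.sub_tmul, TensorProduct.tmul_sub,
      mul_add, add_mul, Algebra.TensorProduct.tmul_mul_tmul, one_mul, mul_one]
    abel
  zero_pow := by
    simp only [LinearMap.coe_mk, AddHom.coe_mk, utqι_contactGen, tmul_add_tmul_pow_char 𝒦 p,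
      gen_eps_zero_pow]
  toral_pow k := by
    simp only [LinearMap.coe_mk, AddHom.coe_mk, utqι_contactGen, tmul_add_tmul_pow_char 𝒦 p,
      gen_idxH_pow]
  nil_pow α hα h0 hk := by
    simp only [LinearMap.coe_mk, AddHom.coe_mk, utqι_contactGen, tmul_add_tmul_pow_char 𝒦 p,
      gen_pow_eq_zero 𝒦 p n q hα h0 hk, TensorProduct.zero_tmul, TensorProduct.tmul_zero, add_zero]

/-- The counit that vanishes on the contact algebra. -/
def counitRestrictedMap : RestrictedMap 𝒦 p n (TruncBase 𝒦 p q) where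
  toLinearMap := 0
  lie := by simp
  zero_pow := by simp [(Fact.out : p.Prime).ne_zero]
  toral_pow := by simp [(Fact.out : p.Prime).ne_zero]
  nil_pow := by simp [(Fact.out : p.Prime).ne_zero]

variable {p}

/-- The antipode that is `-1` on the contact algebra. -/
def antipodeRestrictedMap (hp2 : p ≠ 2) : RestrictedMap 𝒦 p n (UTQ 𝒦 p n q)ᵐᵒᵖ where
  toFun x := MulOpposite.op (-utqι 𝒦 p n q x)
  map_add' x y := by rw [map_add, neg_add, MulOpposite.op_add]
  map_smul' c x := by rw [map_smul, ← smul_neg]; rfl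
  lie x y := by
    simp only [LinearMap.coe_mk, AddHom.coe_mk, utqι_lie]
    simp [← MulOpposite.op_mul]
  zero_pow := by
    simp only [LinearMap.coe_mk, AddHom.coe_mk, utqι_contactGen]
    rw [← MulOpposite.op_pow, ((Fact.out : p.Prime).odd_of_ne_two hp2).neg_pow, gen_eps_zero_pow]
  toral_pow k := by
    simp only [LinearMap.coe_mk, AddHom.coe_mk, utqι_contactGen]
    rw [← MulOpposite.op_pow, ((Fact.out : p.Prime).odd_of_ne_two hp2).neg_pow, gen_idxH_pow]
  nil_pow α hα h0 hk := by
    simp only [LinearMap.coe_mk, AddHom.coe_mk, utqι_contactGen]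
    rw [← MulOpposite.op_pow, ((Fact.out : p.Prime).odd_of_ne_two hp2).neg_pow,
      gen_pow_eq_zero 𝒦 p n q hα h0 hk, neg_zero, MulOpposite.op_zero]

/-- The standard Hopf algebra structure on `u_{t,q}(K(2n+1; 1))`. -/
def standardHopf (hp2 : p ≠ 2) : HopfStructure (TruncBase 𝒦 p q) (UTQ 𝒦 p n q) :=
  HopfStructure.ofPrimitive (adjoin_utqι 𝒦 p n q) ((comulRestrictedMap 𝒦 p n q).liftUTQ q)
    ((counitRestrictedMap 𝒦 p n q).liftUTQ q) ((antipodeRestrictedMap 𝒦 n q hp2).liftUTQ q)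
    (by rintro _ ⟨x, rfl⟩; exact (comulRestrictedMap 𝒦 p n q).liftUTQ_utqι q x)
    (by rintro _ ⟨x, rfl⟩; exact (counitRestrictedMap 𝒦 p n q).liftUTQ_utqι q x)
    (by rintro _ ⟨x, rfl⟩; exact (antipodeRestrictedMap 𝒦 n q hp2).liftUTQ_utqι q x)

theorem standardHopf_comul_utqι (hp2 : p ≠ 2) (x : ContactAlg 𝒦 p n) :
    (standardHopf 𝒦 n q hp2).comul (utqι 𝒦 p n q x) = utqι 𝒦 p n q x ⊗ₜ 1 + 1 ⊗ₜ utqι 𝒦 p n q x :=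
  (comulRestrictedMap 𝒦 p n q).liftUTQ_utqι q x

theorem standardHopf_counit_utqι (hp2 : p ≠ 2) (x : ContactAlg 𝒦 p n) :
    (standardHopf 𝒦 n q hp2).counit (utqι 𝒦 p n q x) = 0 :=
  (counitRestrictedMap 𝒦 p n q).liftUTQ_utqι q x

theorem standardHopf_antipode_utqι (hp2 : p ≠ 2) (x : ContactAlg 𝒦 p n) :
    (standardHopf 𝒦 n q hp2).antipode (utqι 𝒦 p n q x) = -utqι 𝒦 p n q x :=
  congrArg MulOpposite.unop ((antipodeRestrictedMap 𝒦 n q hp2).liftUTQ_utqι q x)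

theorem standardHopf_antipode_mul (hp2 : p ≠ 2) (a b : UTQ 𝒦 p n q) :
    (standardHopf 𝒦 n q hp2).antipode (a * b) =
      (standardHopf 𝒦 n q hp2).antipode b * (standardHopf 𝒦 n q hp2).antipode a :=
  antipodeOfOp_mul _ a b

end StandardHopf

/-! ### The twisted coproduct of h, and extraction of the powers of t -/

section CoproductOfToral
variable {𝒦 : Type*} [Field 𝒦]
variable {R A : Type*} [CommRing R] [Algebra 𝒦 R] [Ring A] [Algebra R A] [Algebra 𝒦 A]
  [IsScalarTower 𝒦 R A]

theorem divAd_zero (e a : A) : divAd 𝒦 e 0 a = a := by simp [divAd]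

theorem divAd_eq_zero_of_commute {e a : A} (h : Commute e a) {m : ℕ} (hm : m ≠ 0) :
    divAd 𝒦 e m a = 0 := by
  obtain ⟨m, rfl⟩ := Nat.exists_eq_succ_of_ne_zero hm
  rw [divAd_eq, Nat.succ_eq_add_one, pow_succ, Module.End.mul_apply]
  simp [h.eq]

theorem divAd_smul_right (e : A) (r : R) (m : ℕ) (a : A) :
    divAd 𝒦 e m (r • a) = r • divAd 𝒦 e m a := by
  unfold divAd
  rw [← algebraMap_smul R ((m.factorial : 𝒦)⁻¹), ← algebraMap_smul R ((m.factorial : 𝒦)⁻¹),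
    smul_comm r]
  congr 1
  induction m with
  | zero => rfl
  | succ m ih =>
    rw [Function.iterate_succ_apply', ih, Function.iterate_succ_apply', mul_smul_comm, smul_mul_assoc,
      smul_sub]

variable {p : ℕ} [Fact p.Prime] [CharP 𝒦 p] {H : HopfStructure R A} {h T h' T' : A}

/-- [T, h] = -T commutes with T, so the series in ad T stops after m = 1, and the second twist does
not see h at all. The term h⊗(1 - T)⁻¹T will show that the coproduct is not cocommutative. -/
theorem verticalHopf_comul_self (hv : VerticalPair p H h T) (hv' : VerticalPair p H h' T')
    (hh : Commute h h') (hT : Commute T T') (h₁ : Commute h T') (h₂ : Commute T h')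
    (hS : ∀ a b, H.antipode (a * b) = H.antipode b * H.antipode a)
    (g g' : Aˣ) (hg : (g : A) = 1 - T) (hg' : (g' : A) = 1 - T') :
    (verticalHopf (𝒦 := 𝒦) hv hv' hh hT h₁ h₂ hS).comul h =
      h ⊗ₜ 1 + 1 ⊗ₜ h + h ⊗ₜ ((↑g⁻¹ : A) * T) := by
  have hp := (Fact.out : p.Prime).two_le
  have hTh : T * h - h * T = -T := by rw [hv.shift]; noncomm_ring
  have h1 : divAd 𝒦 T 1 h = -T := by simp [divAd, hTh]
  have h2 : ∀ m, 2 ≤ m → divAd 𝒦 T m h = 0 := by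
    intro m hm
    obtain ⟨m, rfl⟩ := Nat.exists_eq_add_of_le' hm
    rw [divAd_eq, pow_add, Module.End.mul_apply, pow_two, Module.End.mul_apply]
    simp [hTh]
  rw [verticalHopf_comul hv hv' hh hT h₁ h₂ hS g g' hg hg' (a := h) (z := 0) (z' := 0) (by simp)
    (by simp [hh.eq]) hv.comul_h, add_assoc]
  congr 1
  · simp
  · have hl : ∀ m ∈ Finset.range p, ∑ l ∈ Finset.range p, (-1 : R) ^ (l + m) •
        ((rising h' l * rising h m) ⊗ₜ[R] (((g' ^ (-(l : ℤ)) : Aˣ) : A) *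
          ((g ^ (-(m : ℤ)) : Aˣ) : A) * divAd 𝒦 T m (divAd 𝒦 T' l h))) =
        (-1 : R) ^ m • (rising h m ⊗ₜ[R] (((g ^ (-(m : ℤ)) : Aˣ) : A) * divAd 𝒦 T m h)) := by
      intro m _
      rw [Finset.sum_eq_single 0]
      · simp [divAd_zero, rising]
      · intro l _ hl
        rw [divAd_eq_zero_of_commute h₁.symm hl, divAd_eq, map_zero]
        simp
      · intro h0; exact absurd (Finset.mem_range.2 (by omega)) h0
    rw [Finset.sum_congr rfl hl, ← Finset.sum_subset (Finset.range_mono hp), Finset.sum_range_succ,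
      Finset.sum_range_one]
    · simp [divAd_zero, rising, h1, TensorProduct.tmul_neg]
    · intro m _ hm
      rw [h2 m (not_lt.1 fun h => hm (Finset.mem_range.2 h))]
      simp

theorem divAd_smul_divAd_smul (t : R) (e e' a : A) (m l : ℕ) :
    divAd 𝒦 (t • e) m (divAd 𝒦 (t • e') l a) = t ^ (m + l) • divAd 𝒦 e m (divAd 𝒦 e' l a) := by
  rw [divAd_smul (𝒦 := 𝒦), divAd_smul (𝒦 := 𝒦), divAd_smul_right, smul_smul, pow_add]

variable {t : R} {e e' : A} (hv : VerticalPair p H h (t • e)) (hv' : VerticalPair p H h' (t • e'))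
  (hh : Commute h h') (hT : Commute (t • e) (t • e')) (h₁ : Commute h (t • e'))
  (h₂ : Commute (t • e) h') (hS : ∀ a b, H.antipode (a * b) = H.antipode b * H.antipode a)
  (g g' : Aˣ) (hg : (g : A) = 1 - t • e) (hg' : (g' : A) = 1 - t • e') {a : A} {z z' : ℤ}
  (ha : h * a = a * (h + z)) (ha' : h' * a = a * (h' + z'))
include hg hg' ha ha'

theorem verticalHopf_comul_smul (hΔ : H.comul a = a ⊗ₜ 1 + 1 ⊗ₜ a) :
    (verticalHopf (𝒦 := 𝒦) hv hv' hh hT h₁ h₂ hS).comul a =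
      a ⊗ₜ (((g ^ z : Aˣ) : A) * ((g' ^ z' : Aˣ) : A)) +
      ∑ m ∈ Finset.range p, ∑ l ∈ Finset.range p, ((-1) ^ (l + m) * t ^ (m + l)) •
        ((rising h' l * rising h m) ⊗ₜ (((g' ^ (-(l : ℤ)) : Aˣ) : A) *
          ((g ^ (-(m : ℤ)) : Aˣ) : A) * divAd 𝒦 e m (divAd 𝒦 e' l a))) := by
  rw [verticalHopf_comul hv hv' hh hT h₁ h₂ hS g g' hg hg' ha ha' hΔ]
  congr 1
  refine Finset.sum_congr rfl fun m _ => Finset.sum_congr rfl fun l _ => ?_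
  rw [divAd_smul_divAd_smul, mul_smul_comm, TensorProduct.tmul_smul, smul_smul]

theorem verticalHopf_antipode_smul (hSa : H.antipode a = -a) :
    (verticalHopf (𝒦 := 𝒦) hv hv' hh hT h₁ h₂ hS).antipode a =
      -(((g' ^ (-z') : Aˣ) : A) * ((g ^ (-z) : Aˣ) : A) *
        ∑ m ∈ Finset.range p, ∑ l ∈ Finset.range p, t ^ (m + l) •
          (divAd 𝒦 e m (divAd 𝒦 e' l a) * rising (h + 1) m * rising (h' + 1) l)) := by
  rw [verticalHopf_antipode hv hv' hh hT h₁ h₂ hS g g' hg hg' ha ha' hSa]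
  simp only [divAd_smul_divAd_smul, smul_mul_assoc]

end CoproductOfToral

/-! ### Commutation relations of h(k) and e(k) in u_{t,q}(K) -/

section Relations
variable (𝒦 : Type*) [Field 𝒦] {p : ℕ} (n : ℕ) (q : 𝒦) [Fact p.Prime] [CharP 𝒦 p]

variable {n} in
theorem contactGen_lie (hp2 : p ≠ 2) {α β γ : Idx n → ℕ} (hα : Admissible p n α)
    (hβ : Admissible p n β) (hγ : Admissible p n γ) {c : 𝒦}
    (h : contactD 𝒦 p n (divPow 𝒦 p n α) (divPow 𝒦 p n β) -
      2 * pd 𝒦 p n .zero (divPow 𝒦 p n α) * divPow 𝒦 p n β = c • divPow 𝒦 p n γ) :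
    ⁅contactGen 𝒦 p n α, contactGen 𝒦 p n β⁆ = c • contactGen 𝒦 p n γ := by
  refine Subtype.ext (Subtype.ext ?_)
  change ⁅((contactGen 𝒦 p n α : contactPrime 𝒦 p n) : Witt 𝒦 p n),
    ((contactGen 𝒦 p n β : contactPrime 𝒦 p n) : Witt 𝒦 p n)⁆ =
    c • ((contactGen 𝒦 p n γ : contactPrime 𝒦 p n) : Witt 𝒦 p n)
  have hp : p.Prime := Fact.out
  rw [contactGen_coe 𝒦 p n hp hp2 α hα, contactGen_coe 𝒦 p n hp hp2 β hβ,
    contactGen_coe 𝒦 p n hp hp2 γ hγ, contactD_lie, h, map_smul]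

variable {n}

/-- The polynomial x_k x_{-k} does not involve x₀ and has Euler degree 2, so 2f - E f and D₀f vanish
and D_K(f) is x_k D_k - x_{-k} D_{-k}. This gives every D_K(x^(α)) the weight α_k - α_{-k}. -/
theorem bracket_idxH (k : Fin n) (α : Idx n → ℕ) :
    contactD 𝒦 p n (divPow 𝒦 p n (idxH k)) (divPow 𝒦 p n α) -
      2 * pd 𝒦 p n .zero (divPow 𝒦 p n (idxH k)) * divPow 𝒦 p n α =
      ((α (.pos k) : 𝒦) - α (.neg k)) • divPow 𝒦 p n α := by
  have h0 : pd 𝒦 p n .zero (divPow 𝒦 p n (idxH k)) = 0 :=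
    pd_divPow_of_zero 𝒦 p n (by simp [idxH, eps])
  have hE : euler 𝒦 p n (divPow 𝒦 p n (idxH k)) = 2 * divPow 𝒦 p n (idxH k) := by
    rw [euler_divPow]
    have : (∑ i : Fin n, ((idxH k (.pos i) : 𝒦) + idxH k (.neg i))) = 2 := by
      simp [idxH, eps, Pi.single_apply, Finset.sum_add_distrib]
      norm_num
    rw [this, Algebra.smul_def, map_ofNat]
  have hP : pois 𝒦 p n (divPow 𝒦 p n (idxH k)) (divPow 𝒦 p n α) =
      ((α (.pos k) : 𝒦) - α (.neg k)) • divPow 𝒦 p n α := by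
    rw [sub_smul, ← xvar_mul_pd_divPow, ← xvar_mul_pd_divPow, divPow_idxH, pois,
      Finset.sum_eq_single k]
    · simp [pd_xvar]
    · intro i _ hi
      simp [pd_xvar, Ne.symm hi]
    · simp
  rw [contactD_apply, h0, hE, hP]
  simp

/-- The two polynomials involve disjoint pairs of variables and no x₀. The zero is written as a
multiple of a monomial to fit `contactGen_lie`; which admissible monomial is chosen is immaterial.
-/
theorem bracket_idxE {k k' : Fin n} (hk : k ≠ k') :
    contactD 𝒦 p n (divPow 𝒦 p n (idxE k)) (divPow 𝒦 p n (idxE k')) -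
      2 * pd 𝒦 p n .zero (divPow 𝒦 p n (idxE k)) * divPow 𝒦 p n (idxE k') =
      (0 : 𝒦) • divPow 𝒦 p n (idxE k') := by
  have h0 : ∀ k : Fin n, pd 𝒦 p n .zero (divPow 𝒦 p n (idxE k)) = 0 := fun k =>
    pd_divPow_of_zero 𝒦 p n (by simp [idxE, eps])
  have hP : pois 𝒦 p n (divPow 𝒦 p n (idxE k)) (divPow 𝒦 p n (idxE k')) = 0 := by
    refine Finset.sum_eq_zero fun i _ => ?_
    have h1 : ∀ {k : Fin n}, i ≠ k → pd 𝒦 p n (.pos i) (divPow 𝒦 p n (idxE k)) = 0 ∧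
        pd 𝒦 p n (.neg i) (divPow 𝒦 p n (idxE k)) = 0 := fun {k} hi =>
      ⟨pd_divPow_of_zero 𝒦 p n (by simp [idxE, eps, hi]),
        pd_divPow_of_zero 𝒦 p n (by simp [idxE, eps, hi])⟩
    by_cases hi : i = k
    · subst hi; simp [h1 hk]
    · simp [h1 hi]
  rw [contactD_apply, h0, h0, hP]
  simp

theorem hElt_mul_gen (hp2 : p ≠ 2) (k : Fin n) {α : Idx n → ℕ} (hα : Admissible p n α) :
    hElt 𝒦 p q k * gen 𝒦 p n q α =
      gen 𝒦 p n q α * (hElt 𝒦 p q k + (((α (.pos k) : ℤ) - α (.neg k) : ℤ) : UTQ 𝒦 p n q)) := by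
  have h := utqι_lie 𝒦 p n q (contactGen 𝒦 p n (idxH k)) (contactGen 𝒦 p n α)
  have hc : ((α (.pos k) : 𝒦) - α (.neg k)) = (((α (.pos k) : ℤ) - α (.neg k) : ℤ) : 𝒦) := by
    push_cast; rfl
  rw [contactGen_lie 𝒦 hp2 (admissible_idxH k) hα hα (bracket_idxH 𝒦 k α), map_smul, hc,
    Int.cast_smul_eq_zsmul, zsmul_eq_mul, utqι_contactGen, utqι_contactGen] at h
  rw [mul_add, ← Int.cast_comm, h, hElt]
  abel

theorem eElt_eq_smul (k : Fin n) : eElt 𝒦 p q k = (2 : 𝒦) • gen 𝒦 p n q (idxE k) := by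
  rw [eElt, Algebra.smul_def, map_ofNat]

theorem eElt_eq_utqι (k : Fin n) :
    eElt 𝒦 p q k = utqι 𝒦 p n q ((2 : 𝒦) • contactGen 𝒦 p n (idxE k)) := by
  rw [eElt_eq_smul, map_smul, utqι_contactGen]

theorem hElt_mul_eElt (hp2 : p ≠ 2) (k : Fin n) :
    hElt 𝒦 p q k * eElt 𝒦 p q k = eElt 𝒦 p q k * (hElt 𝒦 p q k + 1) := by
  rw [eElt_eq_smul, mul_smul_comm, hElt_mul_gen 𝒦 q hp2 k (admissible_idxE hp2 k), smul_mul_assoc]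
  simp [idxE, eps]

theorem commute_hElt_eElt (hp2 : p ≠ 2) {k k' : Fin n} (hk : k ≠ k') :
    Commute (hElt 𝒦 p q k) (eElt 𝒦 p q k') := by
  rw [commute_iff_eq, eElt_eq_smul, mul_smul_comm, hElt_mul_gen 𝒦 q hp2 k (admissible_idxE hp2 k'),
    smul_mul_assoc]
  simp [idxE, eps, hk]

theorem commute_hElt_hElt (hp2 : p ≠ 2) {k k' : Fin n} (hk : k ≠ k') :
    Commute (hElt 𝒦 p q k) (hElt 𝒦 p q k') := by
  rw [commute_iff_eq, hElt, hElt, ← hElt, hElt_mul_gen 𝒦 q hp2 k (admissible_idxH k')]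
  simp [idxH, eps, hk]

theorem commute_eElt_eElt (hp2 : p ≠ 2) {k k' : Fin n} (hk : k ≠ k') :
    Commute (eElt 𝒦 p q k) (eElt 𝒦 p q k') := by
  have h := utqι_lie 𝒦 p n q (contactGen 𝒦 p n (idxE k)) (contactGen 𝒦 p n (idxE k'))
  rw [contactGen_lie 𝒦 hp2 (admissible_idxE hp2 k) (admissible_idxE hp2 k') (admissible_idxE hp2 k')
    (bracket_idxE 𝒦 hk), zero_smul, map_zero] at h
  have hc : Commute (gen 𝒦 p n q (idxE k)) (gen 𝒦 p n q (idxE k')) := (sub_eq_zero.1 h.symm)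
  rw [eElt_eq_smul, eElt_eq_smul]
  exact (hc.smul_left _).smul_right _

theorem eElt_pow (hp2 : p ≠ 2) (k : Fin n) : eElt 𝒦 p q k ^ p = 0 := by
  rw [eElt_eq_smul, smul_pow, gen_pow_eq_zero 𝒦 p n q (admissible_idxE hp2 k), smul_zero]
  · intro h
    have := congrFun h .zero
    simp [idxE, eps] at this
  · intro i h
    have h1 := congrFun h (.pos k)
    by_cases hi : k = i
    · subst hi; simp [idxE, idxH, eps] at h1
    · simp [idxE, idxH, eps, hi] at h1

theorem standardHopf_comul_gen (hp2 : p ≠ 2) (α : Idx n → ℕ) :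
    (standardHopf 𝒦 n q hp2).comul (gen 𝒦 p n q α) = gen 𝒦 p n q α ⊗ₜ 1 + 1 ⊗ₜ gen 𝒦 p n q α :=
  standardHopf_comul_utqι 𝒦 n q hp2 (contactGen 𝒦 p n α)

theorem standardHopf_counit_gen (hp2 : p ≠ 2) (α : Idx n → ℕ) :
    (standardHopf 𝒦 n q hp2).counit (gen 𝒦 p n q α) = 0 :=
  standardHopf_counit_utqι 𝒦 n q hp2 (contactGen 𝒦 p n α)

theorem standardHopf_antipode_gen (hp2 : p ≠ 2) (α : Idx n → ℕ) :
    (standardHopf 𝒦 n q hp2).antipode (gen 𝒦 p n q α) = -gen 𝒦 p n q α :=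
  standardHopf_antipode_utqι 𝒦 n q hp2 (contactGen 𝒦 p n α)

theorem verticalPair (hp2 : p ≠ 2) (k : Fin n) :
    VerticalPair p (standardHopf 𝒦 n q hp2) (hElt 𝒦 p q k) (tvar 𝒦 p q • eElt 𝒦 p q k) where
  comul_h := standardHopf_comul_gen 𝒦 q hp2 (idxH k)
  comul_T := by
    rw [map_smul, eElt_eq_utqι, standardHopf_comul_utqι, smul_add, TensorProduct.smul_tmul',
      TensorProduct.tmul_smul]
  antipode_h := standardHopf_antipode_gen 𝒦 q hp2 (idxH k)
  antipode_T := by rw [map_smul, eElt_eq_utqι, standardHopf_antipode_utqι, smul_neg]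
  counit_h := standardHopf_counit_gen 𝒦 q hp2 (idxH k)
  counit_T := by rw [map_smul, eElt_eq_utqι, standardHopf_counit_utqι, smul_zero]
  shift := by rw [mul_smul_comm, hElt_mul_eElt 𝒦 q hp2, smul_mul_assoc]
  pow_h := gen_idxH_pow 𝒦 p n q k
  pow_T := by rw [smul_pow, eElt_pow 𝒦 q hp2, smul_zero]

theorem verticalTwist_eq (k : Fin n) : verticalTwist 𝒦 p q k =
    vTwist 𝒦 p (TruncBase 𝒦 p q) (hElt 𝒦 p q k) (tvar 𝒦 p q • eElt 𝒦 p q k) := by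
  rw [vTwist_eq, verticalTwist]
  refine Finset.sum_congr rfl fun r _ => ?_
  rw [smul_pow, TensorProduct.smul_tmul']

end Relations

/-! ### Linear forms after extension of scalars -/

section Functional
variable {𝒦 : Type*} [Field 𝒦] {R U : Type*} [CommRing R] [Algebra 𝒦 R] [Ring U] [Algebra 𝒦 U]

/-- The extension of scalars of a linear form. -/
def baseChangeForm (R : Type*) [CommRing R] [Algebra 𝒦 R] (φ : U →ₗ[𝒦] 𝒦) : R ⊗[𝒦] U →ₗ[R] R :=
  (TensorProduct.AlgebraTensorModule.rid 𝒦 R R).toLinearMap ∘ₗ φ.baseChange R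

theorem baseChangeForm_one_tmul (φ : U →ₗ[𝒦] 𝒦) (u : U) :
    baseChangeForm R φ ((1 : R) ⊗ₜ[𝒦] u) = algebraMap 𝒦 R (φ u) := by
  simp [baseChangeForm, Algebra.algebraMap_eq_smul_one]

variable {A : Type*} [Ring A] [Algebra R A]

/-- The product of two linear forms, as a linear form on the tensor square. -/
def formTmul (φ ψ : A →ₗ[R] R) : A ⊗[R] A →ₗ[R] R :=
  LinearMap.mul' R R ∘ₗ TensorProduct.map φ ψ

theorem formTmul_tmul (φ ψ : A →ₗ[R] R) (a b : A) : formTmul φ ψ (a ⊗ₜ b) = φ a * ψ b := by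
  simp [formTmul]

end Functional

/-! ### Noncommutativity and noncocommutativity -/

section NotCocommutative
variable (𝒦 : Type*) [Field 𝒦] {p n : ℕ} (q : 𝒦) [Fact p.Prime] [CharP 𝒦 p]

/-- The coefficient of `x^(γ)` in the image of `x^(β)` under the action of `u(K(2n+1; 1))`. -/
def matrixCoeff (hp2 : p ≠ 2) (γ : Idx n → Fin p) (β : Idx n → ℕ) : RestrictedU 𝒦 p n →ₗ[𝒦] 𝒦 :=
  (divPowBasis 𝒦 p n).coord γ ∘ₗ LinearMap.applyₗ (divPow 𝒦 p n β) ∘ₗ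
    (contactRestrictedMap 𝒦 n hp2).lift.toLinearMap

theorem lift_genU (hp2 : p ≠ 2) {α : Idx n → ℕ} (hα : Admissible p n α) (f : TruncPoly 𝒦 p n) :
    (contactRestrictedMap 𝒦 n hp2).lift (genU 𝒦 p n α) f = contactD 𝒦 p n (divPow 𝒦 p n α) f := by
  rw [← restrictedι_contactGen, RestrictedMap.lift_restrictedι]
  exact LinearMap.congr_fun (contactAction_contactGen 𝒦 n hp2 hα) f

theorem contactD_idxH_neg (k : Fin n) : contactD 𝒦 p n (divPow 𝒦 p n (idxH k))
    (divPow 𝒦 p n (eps (.neg k))) = -divPow 𝒦 p n (eps (.neg k)) := by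
  rw [divPow_eps, contactD_idxH_xvar]
  simp

theorem contactD_idxE_neg (hp2 : p ≠ 2) (k : Fin n) : contactD 𝒦 p n (divPow 𝒦 p n (idxE k))
    (divPow 𝒦 p n (eps (.neg k))) = -divPow 𝒦 p n (idxH k) := by
  have h0 : pd 𝒦 p n .zero (divPow 𝒦 p n (idxE k)) = 0 :=
    pd_divPow_of_zero 𝒦 p n (by simp [idxE, eps])
  have h1 : idxE k = idxH k + Pi.single (.pos k) 1 := by
    rw [idxE, idxH, two_smul, eps]; abel
  rw [divPow_eps, contactD_xneg, h0, h1, pd_divPow]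
  · simp
  · have := two_ne_zero_of_char 𝒦 p hp2
    have e : idxH k (.pos k) = 1 := by simp [idxH, eps]
    rw [e]; exact_mod_cast this

theorem contactD_idxH_idxH (k : Fin n) : contactD 𝒦 p n (divPow 𝒦 p n (idxH k))
    (divPow 𝒦 p n (idxH k)) = 0 := by
  conv_lhs => rw [divPow_idxH 𝒦 p n k, Derivation.leibniz, ← divPow_idxH, contactD_idxH_xvar,
    contactD_idxH_xvar]
  simp
  ring

theorem exists_fin_idx {α : Idx n → ℕ} (hα : Admissible p n α) :
    ∃ γ : Idx n → Fin p, (fun i => (γ i : ℕ)) = α := ⟨fun i => ⟨α i, hα.lt n i⟩, rfl⟩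

theorem coord_divPow (γ δ : Idx n → Fin p) :
    (divPowBasis 𝒦 p n).coord γ (divPow 𝒦 p n fun i => δ i) = if δ = γ then 1 else 0 := by
  rw [← divPowBasis_apply, Module.Basis.coord_apply, Module.Basis.repr_self, Finsupp.single_apply]

theorem tvar_ne_zero : tvar 𝒦 p q ≠ 0 := by
  intro h
  have := AdjoinRoot.mk_eq_zero.1 (h : AdjoinRoot.mk _ Polynomial.X = 0)
  have h1 := Polynomial.natDegree_le_of_dvd this Polynomial.X_ne_zero
  rw [truncBase_natDegree, Polynomial.natDegree_X] at h1
  have := (Fact.out : p.Prime).two_le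
  omega

/-- Both forms are matrix coefficients at the vector x_{-k}. There h acts by -1, and e gives -2 x_k
x_{-k}, which h annihilates. φ reads off the coefficient of x_k x_{-k} and ψ that of x_{-k}. -/
theorem exists_forms (hp2 : p ≠ 2) (k : Fin n) :
    ∃ φ ψ : UTQ 𝒦 p n q →ₗ[TruncBase 𝒦 p q] TruncBase 𝒦 p q,
      (φ (hElt 𝒦 p q k) = 0 ∧ φ (eElt 𝒦 p q k) = -2 ∧ φ (hElt 𝒦 p q k * eElt 𝒦 p q k) = 0) ∧
      (ψ (hElt 𝒦 p q k) = -1 ∧ ψ (eElt 𝒦 p q k) = 0 ∧ ψ (hElt 𝒦 p q k * eElt 𝒦 p q k) = 0) := by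
  obtain ⟨γ, hγ⟩ := exists_fin_idx (admissible_idxH (p := p) k)
  have hadm : Admissible p n (eps (.neg k)) := by
    have := (Fact.out : p.Prime).two_le
    refine ⟨fun i => ?_, fun _ h => ?_⟩
    · rw [eps, Pi.single_apply]; split_ifs <;> omega
    · have := congrFun h .zero
      simp [eps] at this; omega
  obtain ⟨δ, hδ⟩ := exists_fin_idx hadm
  have hne : δ ≠ γ := by
    rintro rfl
    have := congrFun (hγ.symm.trans hδ) (.pos k)
    simp [idxH, eps] at this
  have hh : ∀ u, (contactRestrictedMap 𝒦 n hp2).lift (genU 𝒦 p n (idxH k)) u =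
    contactD 𝒦 p n (divPow 𝒦 p n (idxH k)) u := lift_genU 𝒦 hp2 (admissible_idxH k)
  have he : ∀ u, (contactRestrictedMap 𝒦 n hp2).lift (genU 𝒦 p n (idxE k)) u =
    contactD 𝒦 p n (divPow 𝒦 p n (idxE k)) u := lift_genU 𝒦 hp2 (admissible_idxE hp2 k)
  have e1 : hElt 𝒦 p q k = 1 ⊗ₜ[𝒦] genU 𝒦 p n (idxH k) := rfl
  have e2 : eElt 𝒦 p q k = 1 ⊗ₜ[𝒦] ((2 : 𝒦) • genU 𝒦 p n (idxE k)) := by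
    rw [eElt_eq_smul, gen, TensorProduct.tmul_smul]
  have e3 : hElt 𝒦 p q k * eElt 𝒦 p q k =
      1 ⊗ₜ[𝒦] ((2 : 𝒦) • (genU 𝒦 p n (idxH k) * genU 𝒦 p n (idxE k))) := by
    rw [e1, e2, Algebra.TensorProduct.tmul_mul_tmul, mul_one, mul_smul_comm]
  have key : ∀ ζ : Idx n → Fin p,
      (matrixCoeff 𝒦 hp2 ζ (eps (.neg k)) (genU 𝒦 p n (idxH k)) = -if δ = ζ then 1 else 0) ∧
      (matrixCoeff 𝒦 hp2 ζ (eps (.neg k)) ((2 : 𝒦) • genU 𝒦 p n (idxE k)) =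
        2 * -if γ = ζ then 1 else 0) ∧
      (matrixCoeff 𝒦 hp2 ζ (eps (.neg k))
        ((2 : 𝒦) • (genU 𝒦 p n (idxH k) * genU 𝒦 p n (idxE k))) = 0) := by
    intro ζ
    simp only [matrixCoeff, LinearMap.comp_apply, LinearMap.applyₗ_apply_apply, AlgHom.toLinearMap_apply,
      map_mul, Module.End.mul_apply, hh, he, map_smul, contactD_idxH_neg,
      contactD_idxE_neg 𝒦 hp2, map_neg, smul_eq_mul, contactD_idxH_idxH, map_zero, neg_zero, mul_zero,
      and_true]
    rw [← coord_divPow 𝒦 ζ δ, ← coord_divPow 𝒦 ζ γ, hγ, hδ]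
    exact ⟨rfl, rfl⟩
  refine ⟨baseChangeForm _ (matrixCoeff 𝒦 hp2 γ (eps (.neg k))),
    baseChangeForm _ (matrixCoeff 𝒦 hp2 δ (eps (.neg k))), ?_, ?_⟩
  · rw [e3, e1, e2, baseChangeForm_one_tmul, baseChangeForm_one_tmul, baseChangeForm_one_tmul,
      (key γ).1, (key γ).2.1, (key γ).2.2, if_neg hne, if_pos rfl]
    exact ⟨by simp, by rw [mul_neg_one, map_neg, map_ofNat], map_zero _⟩
  · rw [e3, e1, e2, baseChangeForm_one_tmul, baseChangeForm_one_tmul, baseChangeForm_one_tmul,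
      (key δ).1, (key δ).2.1, (key δ).2.2, if_neg hne.symm, if_pos rfl]
    simp

theorem two_smul_ne_zero (hp2 : p ≠ 2) {x : TruncBase 𝒦 p q} (hx : x ≠ 0) : 2 * x ≠ 0 := by
  have h : (2 : TruncBase 𝒦 p q) * x = (2 : 𝒦) • x := by rw [Algebra.smul_def, map_ofNat]
  rw [h]
  exact smul_ne_zero (two_ne_zero_of_char 𝒦 p hp2) hx

theorem hElt_mul_eElt_ne (hp2 : p ≠ 2) (k : Fin n) :
    hElt 𝒦 p q k * eElt 𝒦 p q k ≠ eElt 𝒦 p q k * hElt 𝒦 p q k := by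
  intro h
  obtain ⟨φ, -, ⟨-, h2, -⟩, -⟩ := exists_forms 𝒦 q hp2 k
  rw [hElt_mul_eElt 𝒦 q hp2, mul_add, mul_one, add_eq_left] at h
  rw [h, map_zero] at h2
  refine two_smul_ne_zero 𝒦 q hp2 (tvar_ne_zero 𝒦 q) ?_
  rw [← neg_neg (2 : TruncBase 𝒦 p q), ← h2, neg_zero, zero_mul]

/-- After the symmetric part is removed and g⊗g is multiplied on the right to clear g⁻¹, symmetry
would say that hg⊗T equals T⊗hg, where hg = h - t·he. The form φ⊗ψ takes the values 0 and 2t on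
these, and 2t ≠ 0. -/
theorem not_cocommutative (hp2 : p ≠ 2) (k : Fin n) (g : (UTQ 𝒦 p n q)ˣ)
    (hg : (g : UTQ 𝒦 p n q) = 1 - tvar 𝒦 p q • eElt 𝒦 p q k) :
    TensorProduct.comm (TruncBase 𝒦 p q) _ _ (hElt 𝒦 p q k ⊗ₜ[TruncBase 𝒦 p q] (1 : UTQ 𝒦 p n q) +
      1 ⊗ₜ hElt 𝒦 p q k +
      hElt 𝒦 p q k ⊗ₜ ((↑g⁻¹ : UTQ 𝒦 p n q) * (tvar 𝒦 p q • eElt 𝒦 p q k))) ≠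
      hElt 𝒦 p q k ⊗ₜ[TruncBase 𝒦 p q] (1 : UTQ 𝒦 p n q) +
      1 ⊗ₜ hElt 𝒦 p q k +
      hElt 𝒦 p q k ⊗ₜ ((↑g⁻¹ : UTQ 𝒦 p n q) * (tvar 𝒦 p q • eElt 𝒦 p q k)) := by
  intro h
  obtain ⟨φ, ψ, ⟨h1, h2, h3⟩, ⟨h4, h5, h6⟩⟩ := exists_forms 𝒦 q hp2 k
  set t := tvar 𝒦 p q
  set x := hElt 𝒦 p q k
  set e := eElt 𝒦 p q k
  simp only [map_add, TensorProduct.comm_tmul] at h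
  rw [add_comm ((1 : UTQ 𝒦 p n q) ⊗ₜ[TruncBase 𝒦 p q] x), add_right_inj] at h
  replace h := congrArg (· * ((g : UTQ 𝒦 p n q) ⊗ₜ[TruncBase 𝒦 p q] (g : UTQ 𝒦 p n q))) h
  have hc : (t • e) * (g : UTQ 𝒦 p n q) = g * (t • e) := by 
    rw [hg, mul_sub, sub_mul, mul_one, one_mul]
  have hx : x * (g : UTQ 𝒦 p n q) = x - t • (x * e) := by rw [hg, mul_sub, mul_one, mul_smul_comm]
  simp only [Algebra.TensorProduct.tmul_mul_tmul, mul_assoc, hc, Units.inv_mul_cancel_left, hx] at h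
  have h' := congrArg (formTmul φ ψ) h
  simp only [formTmul_tmul, map_sub, map_smul, h1, h2, h3, h4, h5, h6, mul_zero, smul_eq_mul,
    sub_zero] at h'
  refine two_smul_ne_zero 𝒦 q hp2 (tvar_ne_zero 𝒦 q) ?_
  linear_combination h'

end NotCocommutative

end
end ContactHopf
-- The main theorem
open ContactHopf in
theorem mainTheorem5 (𝒦 : Type*) [Field 𝒦] (p : ℕ) [Fact p.Prime] [CharP 𝒦 p] (hp2 : p ≠ 2)
    (n : ℕ) (q : 𝒦) (k k' : Fin n) (hkk' : k ≠ k') :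
    ∃ (H₀ H : HopfStructure (TruncBase 𝒦 p q) (UTQ 𝒦 p n q)) (g g' : (UTQ 𝒦 p n q)ˣ),
      -- `g = 1 - e(k) t` and `g' = 1 - e(k') t` are invertible
      (g : UTQ 𝒦 p n q) = 1 - tvar 𝒦 p q • eElt 𝒦 p q k ∧
      (g' : UTQ 𝒦 p n q) = 1 - tvar 𝒦 p q • eElt 𝒦 p q k' ∧
      -- `H₀` is the standard Hopf algebra structure
      (∀ α, Admissible p n α →
        H₀.comul (gen 𝒦 p n q α) = gen 𝒦 p n q α ⊗ₜ 1 + 1 ⊗ₜ gen 𝒦 p n q α ∧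
        H₀.antipode (gen 𝒦 p n q α) = - gen 𝒦 p n q α ∧
        H₀.counit (gen 𝒦 p n q α) = 0) ∧
      -- the two vertical twists commute, and `H` is the twisting of `H₀` by their product
      IsDrinfeldTwist H₀ (verticalTwist 𝒦 p q k) ∧
      IsDrinfeldTwist H₀ (verticalTwist 𝒦 p q k') ∧
      Commute (verticalTwist 𝒦 p q k) (verticalTwist 𝒦 p q k') ∧
      IsDrinfeldTwist H₀ (verticalTwist 𝒦 p q k * verticalTwist 𝒦 p q k') ∧
      (∀ a, H.comul a * (verticalTwist 𝒦 p q k * verticalTwist 𝒦 p q k') =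
        (verticalTwist 𝒦 p q k * verticalTwist 𝒦 p q k') * H₀.comul a) ∧
      -- the explicit formulas
      (∀ α, Admissible p n α →
        H.comul (gen 𝒦 p n q α) =
          gen 𝒦 p n q α ⊗ₜ
            ((↑(g ^ ((α (.pos k) : ℤ) - α (.neg k))) : UTQ 𝒦 p n q) *
              (↑(g' ^ ((α (.pos k') : ℤ) - α (.neg k'))) : UTQ 𝒦 p n q)) +
          ∑ m ∈ Finset.range p, ∑ l ∈ Finset.range p,
            ((-1) ^ (l + m) * tvar 𝒦 p q ^ (m + l)) •
              ((rising (hElt 𝒦 p q k') l * rising (hElt 𝒦 p q k) m) ⊗ₜ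
                ((↑(g' ^ (-(l : ℤ))) : UTQ 𝒦 p n q) * (↑(g ^ (-(m : ℤ))) : UTQ 𝒦 p n q) *
                  divAd 𝒦 (eElt 𝒦 p q k) m (divAd 𝒦 (eElt 𝒦 p q k') l (gen 𝒦 p n q α)))) ∧
        H.antipode (gen 𝒦 p n q α) =
          -((↑(g' ^ ((α (.neg k') : ℤ) - α (.pos k'))) : UTQ 𝒦 p n q) *
            (↑(g ^ ((α (.neg k) : ℤ) - α (.pos k))) : UTQ 𝒦 p n q) *
            ∑ m ∈ Finset.range p, ∑ l ∈ Finset.range p,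
              tvar 𝒦 p q ^ (m + l) •
                (divAd 𝒦 (eElt 𝒦 p q k) m (divAd 𝒦 (eElt 𝒦 p q k') l (gen 𝒦 p n q α)) *
                  rising (hElt 𝒦 p q k + 1) m * rising (hElt 𝒦 p q k' + 1) l)) ∧
        H.counit (gen 𝒦 p n q α) = 0) ∧
      -- noncommutative and noncocommutative
      (∃ a b : UTQ 𝒦 p n q, a * b ≠ b * a) ∧
      (∃ a : UTQ 𝒦 p n q, TensorProduct.comm (TruncBase 𝒦 p q) _ _ (H.comul a) ≠ H.comul a) ∧
      -- the dimension
      (¬ p ∣ 2 * n + 4 → Module.finrank 𝒦 (UTQ 𝒦 p n q) = p ^ (p ^ (2 * n + 1) + 1)) ∧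
      (p ∣ 2 * n + 4 → Module.finrank 𝒦 (UTQ 𝒦 p n q) = p ^ (p ^ (2 * n + 1))) := by
  obtain ⟨g, hg⟩ := IsNilpotent.isUnit_one_sub (r := tvar 𝒦 p q • eElt 𝒦 p q k)
    ⟨p, by rw [smul_pow, eElt_pow 𝒦 q hp2 k, smul_zero]⟩
  obtain ⟨g', hg'⟩ := IsNilpotent.isUnit_one_sub (r := tvar 𝒦 p q • eElt 𝒦 p q k')
    ⟨p, by rw [smul_pow, eElt_pow 𝒦 q hp2 k', smul_zero]⟩
  have hv := verticalPair 𝒦 q hp2 k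
  have hv' := verticalPair 𝒦 q hp2 k'
  have hh := commute_hElt_hElt 𝒦 q hp2 hkk'
  have hT : Commute (tvar 𝒦 p q • eElt 𝒦 p q k) (tvar 𝒦 p q • eElt 𝒦 p q k') :=
    ((commute_eElt_eElt 𝒦 q hp2 hkk').smul_left _).smul_right _
  have h₁ : Commute (hElt 𝒦 p q k) (tvar 𝒦 p q • eElt 𝒦 p q k') :=
    (commute_hElt_eElt 𝒦 q hp2 hkk').smul_right _
  have h₂ : Commute (tvar 𝒦 p q • eElt 𝒦 p q k) (hElt 𝒦 p q k') :=
    ((commute_hElt_eElt 𝒦 q hp2 hkk'.symm).symm).smul_left _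
  have hS := standardHopf_antipode_mul 𝒦 n q hp2
  rw [verticalTwist_eq, verticalTwist_eq]
  refine ⟨standardHopf 𝒦 n q hp2, verticalHopf (𝒦 := 𝒦) hv hv' hh hT h₁ h₂ hS, g, g', hg, hg',
    fun α _ => ⟨standardHopf_comul_gen 𝒦 q hp2 α, standardHopf_antipode_gen 𝒦 q hp2 α,
      standardHopf_counit_gen 𝒦 q hp2 α⟩, hv.isDrinfeldTwist, hv'.isDrinfeldTwist,
    commute_vTwist_vTwist hh hT, isDrinfeldTwist_mul hv hv' hh hT h₁ h₂,
    verticalHopf_comul_mul hv hv' hh hT h₁ h₂ hS, fun α hα => ⟨?_, ?_, ?_⟩,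
    ⟨_, _, hElt_mul_eElt_ne 𝒦 q hp2 k⟩, ⟨hElt 𝒦 p q k, ?_⟩, fun h => ?_, fun h => ?_⟩
  · exact verticalHopf_comul_smul hv hv' hh hT h₁ h₂ hS g g' hg hg' (hElt_mul_gen 𝒦 q hp2 k hα)
      (hElt_mul_gen 𝒦 q hp2 k' hα) (standardHopf_comul_gen 𝒦 q hp2 α)
  · have := verticalHopf_antipode_smul (𝒦 := 𝒦) hv hv' hh hT h₁ h₂ hS g g' hg hg'
      (hElt_mul_gen 𝒦 q hp2 k hα) (hElt_mul_gen 𝒦 q hp2 k' hα)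
      (standardHopf_antipode_gen 𝒦 q hp2 α)
    rwa [neg_sub, neg_sub] at this
  · exact standardHopf_counit_gen 𝒦 q hp2 α
  · rw [verticalHopf_comul_self hv hv' hh hT h₁ h₂ hS g g' hg hg']
    exact not_cocommutative 𝒦 q hp2 k g hg
  · rw [finrank_utq 𝒦 n q hp2, card_admIdx_of_not_dvd p n h]
  -- The extra factor p contributed by 𝒦[t]_p^(q) makes up exactly for the missing index τ.
  · rw [finrank_utq 𝒦 n q hp2, card_admIdx_of_dvd p n h]
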